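/- Let $\Omega\subset\mathbb R^2$ be a bounded domain (open and connected) with smooth boundary and let $S\supset\Omega$ be a polygonal region. Let $\gamma,\rho>0$. There is a constant $\beta_2>0$ (depending at most on $\Omega,S,\gamma,\rho$, hence independent of the mesh size $h$) such that the following holds. Let $\mathcal S_h$ be any (finite, conforming) triangulation of $S$ that is shape regular and quasi-uniform with constants $\gamma,\rho$: every triangle $T$ of $\mathcal S_h$ contains a ball of radius $\gamma\,\mathrm{diam}(T)$, and $\mathrm{diam}(T)\le\rho\,\mathrm{diam}(T')$ for all triangles $T,T'$ of $\mathcal S_h$. Let $\mathcal T_h=\{T\in\mathcal S_h:\ \bar T\subset\bar\Omega\}$, assumed nonempty, let $\Omega_h=\mathrm{int}\big(\bigcup_{T\in\mathcal T_h}\bar T\big)$, let $\mathcal T_h^{ct}$ be the Clough–Tocher refinement of $\mathcal T_h$ (each triangle is split into three by joining its vertices to its barycenter), let $\mathcal E_h^B$ be the set of boundary edges of $\mathcal T_h$, let $\boldsymbol n_h$ be the outward unit normal on $\partial\Omega_h$, let $h_e=\mathrm{diam}(e)$, and write $\int_{\partial\Omega_h}q\,ds=\sum_{e\in\mathcal E_h^B}\int_e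 q\,ds$. Set $$\boldsymbol V_h=\Big\{\boldsymbol v\in \boldsymbol H^1(\Omega_h):\ \boldsymbol v|_K\in\boldsymbol{\mathcal P}_2(K)\ \ \forall K\in\mathcal T_h^{ct},\ \int_{\partial\Omega_h}\boldsymbol v\cdot\boldsymbol n_h\,ds=0\Big\},$$ $$\mathring X_h=\Big\{\mu\in C(\partial\Omega_h):\ \mu|_e\in\mathcal P_2(e)\ \ \forall e\in\mathcal E_h^B,\ \int_{\partial\Omega_h}\mu\,ds=0\Big\},$$ $$\|\boldsymbol v\|_{1,h}^2=\|\nabla\boldsymbol v\|_{L^2(\Omega_h)}^2+\sum_{e\in\mathcal E_h^B}h_e^{-1}\|\boldsymbol v\|_{L^2(e)}^2,\qquad \|\mu\|_{-1/2,h}^2=\sum_{e\in\mathcal E_h^B}h_e\|\mu\|_{L^2(e)}^2,$$ where $\mathcal P_2$ denotes polynomials of degree at most $2$ and boundary values of $\boldsymbol v$ are traces. Then $$\sup_{\boldsymbol v\in\boldsymbol V_h\setminus\{0\}}\frac{\int_{\partial\Omega_h}(\boldsymbol v\cdot\boldsymbol n_h)\,\mu\,ds}{\|\boldsymbol v\|_{1,h}}\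 \ge\ \beta_2\,\|\mu\|_{-1/2,h}\qquad\forall\mu\in\mathring X_h .$$ -/

import Mathlib

open MeasureTheory Set Filter Topology
open scoped ContDiff

noncomputable section

namespace StokesFEM

/-- The Euclidean plane. -/
abbrev Plane : Type := EuclideanSpace ℝ (Fin 2)

/-- `Ω` has smooth boundary: near each boundary point, `Ω` is the negativity set of a smooth
function with nonvanishing differential there. -/
def HasSmoothBoundary (Ω : Set Plane) : Prop :=
  ∀ x ∈ frontier Ω, ∃ φ : Plane → ℝ, ContDiff ℝ ∞ φ ∧ fderiv ℝ φ x ≠ 0 ∧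
    ∀ᶠ y in 𝓝 x, (y ∈ Ω ↔ φ y < 0)

/-- A (conforming) triangulation of the closed polygonal region `S`: a finite geometric simplicial
complex with underlying space `S`, all of whose simplices are faces of triangles. -/
structure Triangulation (S : Set Plane) extends Geometry.SimplicialComplex ℝ Plane where
  finite_faces : faces.Finite
  pure_two : ∀ s ∈ faces, ∃ T ∈ faces, s ⊆ T ∧ T.card = 3
  space_eq : (⋃ s ∈ faces, convexHull ℝ (s : Set Plane)) = S

/-- The closed triangle (more generally: simplex) with vertex set `T`. -/
def cell (T : Finset Plane) : Set Plane := convexHull ℝ (T : Set Plane)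

open Classical in
/-- The triangles of a triangulation, each given by its set of three vertices. -/
def Triangulation.triangles {S : Set Plane} (𝒮 : Triangulation S) : Finset (Finset Plane) :=
  𝒮.finite_faces.toFinset.filter fun T => T.card = 3

/-- Shape regularity with constant `γ`: each triangle `T` contains a ball of radius
`γ * diam T`. -/
def Triangulation.ShapeRegular {S : Set Plane} (𝒮 : Triangulation S) (γ : ℝ) : Prop :=
  ∀ T ∈ 𝒮.triangles, ∃ x, Metric.closedBall x (γ * Metric.diam (cell T)) ⊆ cell T

/-- Quasi-uniformity with constant `ρ`: the diameters of any two triangles are comparable. -/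
def Triangulation.QuasiUniform {S : Set Plane} (𝒮 : Triangulation S) (ρ : ℝ) : Prop :=
  ∀ T ∈ 𝒮.triangles, ∀ T' ∈ 𝒮.triangles, Metric.diam (cell T) ≤ ρ * Metric.diam (cell T')

open Classical in
/-- The computational mesh `𝒯_h`: the closed triangles of the background mesh contained in the
closure of `Ω`. -/
def Triangulation.compMesh {S : Set Plane} (𝒮 : Triangulation S) (Ω : Set Plane) :
    Finset (Finset Plane) :=
  𝒮.triangles.filter fun T => cell T ⊆ closure Ω

/-- The computational domain `Ω_h`, the interior of the union of the closed mesh triangles. -/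
def domain (𝒯 : Finset (Finset Plane)) : Set Plane := interior (⋃ T ∈ 𝒯, cell T)

/-- The barycenter of the triangle with vertex set `T`. -/
def barycenter (T : Finset Plane) : Plane := (3 : ℝ)⁻¹ • ∑ x ∈ T, x

/-- The closed edge of the triangle `T` opposite to its vertex `p`. -/
def edge (T : Finset Plane) (p : Plane) : Set Plane := convexHull ℝ ((T : Set Plane) \ {p})

/-- The closed triangle of the Clough-Tocher split of `T` spanned by the barycenter of `T` and the
edge opposite to `p`. For `T` in the mesh and `p` a vertex of `T`, these are the elements of the
Clough-Tocher refinement `𝒯_h^ct`. -/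
def ctCell (T : Finset Plane) (p : Plane) : Set Plane :=
  convexHull ℝ (insert (barycenter T) ((T : Set Plane) \ {p}))

/-- The edge of `T` opposite to `p` is a boundary edge of the mesh `𝒯`: it is an edge of no
other triangle of `𝒯`. A boundary edge `e` is always recorded by the unique such pair `(T, p)`;
then `e` is also an edge of `ctCell T p`, and of no other element of the refined mesh. -/
def IsBoundaryEdge (𝒯 : Finset (Finset Plane)) (T : Finset Plane) (p : Plane) : Prop :=
  T ∈ 𝒯 ∧ p ∈ T ∧ ∀ T' ∈ 𝒯, (T : Set Plane) \ {p} ⊆ (T' : Set Plane) → T' = T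

open Classical in
/-- The sum over all boundary edges of the mesh `𝒯`. -/
def sumBoundary (𝒯 : Finset (Finset Plane)) (f : Finset Plane → Plane → ℝ) : ℝ :=
  ∑ T ∈ 𝒯, ∑ p ∈ T with IsBoundaryEdge 𝒯 T p, f T p

/-- The length `h_e` of the edge of `T` opposite to `p`. -/
def edgeLength (T : Finset Plane) (p : Plane) : ℝ := Metric.diam (edge T p)

/-- The integral of `q` over the edge of `T` opposite to `p` with respect to arc length, i.e.
one-dimensional Hausdorff measure. -/
def edgeIntegral (T : Finset Plane) (p : Plane) (q : Plane → ℝ) : ℝ :=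
  ∫ x in edge T p, q x ∂(Measure.hausdorffMeasure (1 : ℝ) : Measure Plane)

/-- `n` is the unit normal of the edge of `T` opposite to `p` that points out of `T`. -/
def IsOutwardNormal (T : Finset Plane) (p n : Plane) : Prop :=
  ‖n‖ = 1 ∧ ∀ a ∈ (T : Set Plane) \ {p},
    0 < inner ℝ n (a - p) ∧ ∀ b ∈ (T : Set Plane) \ {p}, inner ℝ n (b - a) = 0

/-- The outward unit normal `n_h` on the edge of `T` opposite to `p`. -/
def outwardNormal (T : Finset Plane) (p : Plane) : Plane :=
  Classical.epsilon (IsOutwardNormal T p)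

/-- `v` belongs to `H¹(U)` (vector valued): `v` is square integrable on `U` and has square
integrable weak partial derivatives `G 0`, `G 1` on `U`. -/
def MemH1 (U : Set Plane) (v : Plane → Plane) : Prop :=
  MemLp v 2 (volume.restrict U) ∧
    ∃ G : Fin 2 → Plane → Plane, (∀ j, MemLp (G j) 2 (volume.restrict U)) ∧
      ∀ φ : Plane → ℝ, ContDiff ℝ ∞ φ → HasCompactSupport φ → tsupport φ ⊆ U →
        ∀ j : Fin 2, ∫ x in U, fderiv ℝ φ x (EuclideanSpace.single j 1) • v x =
          -∫ x in U, φ x • G j x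

/-- `f` coincides on `D` with a bivariate polynomial of total degree at most `2`. -/
def IsQuadraticOn (D : Set Plane) (f : Plane → ℝ) : Prop :=
  ∃ P : MvPolynomial (Fin 2) ℝ, P.totalDegree ≤ 2 ∧
    ∀ x ∈ D, f x = MvPolynomial.eval (fun i => x i) P

/-- The trace of `v` on the edge of `T` opposite to `p`, taken from the element `ctCell T p`:
the continuous extension of `v` from the interior of this element. -/
def trace (v : Plane → Plane) (T : Finset Plane) (p : Plane) : Plane → Plane :=
  extendFrom (interior (ctCell T p)) v

/-- The boundary pairing `∫_{∂Ω_h} (v · n_h) μ ds`. -/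
def boundaryPairing (𝒯 : Finset (Finset Plane)) (v : Plane → Plane) (μ : Plane → ℝ) : ℝ :=
  sumBoundary 𝒯 fun T p =>
    edgeIntegral T p fun x => inner ℝ (trace v T p x) (outwardNormal T p) * μ x

/-- The velocity space `V_h`: `H¹(Ω_h)` vector fields that are quadratic on each element of the
Clough-Tocher refinement and have zero flux through `∂Ω_h`. Elements of `H¹` are represented by
functions that are polynomial at every point of the open elements; values elsewhere (a null set
within `Ω_h`) are immaterial. -/
def velocitySpace (𝒯 : Finset (Finset Plane)) : Set (Plane → Plane) :=
  {v | MemH1 (domain 𝒯) v ∧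
    (∀ T ∈ 𝒯, ∀ p ∈ T, ∀ i : Fin 2, IsQuadraticOn (interior (ctCell T p)) fun x => v x i) ∧
    boundaryPairing 𝒯 v (fun _ => 1) = 0}

/-- The multiplier space `X_h`: continuous functions on `∂Ω_h` that are quadratic on each boundary
edge. -/
def multiplierSpace (𝒯 : Finset (Finset Plane)) : Set (Plane → ℝ) :=
  {μ | ContinuousOn μ (frontier (domain 𝒯)) ∧
    ∀ T p, IsBoundaryEdge 𝒯 T p → IsQuadraticOn (edge T p) μ}

/-- The mean-zero multiplier space. -/
def multiplierSpace₀ (𝒯 : Finset (Finset Plane)) : Set (Plane → ℝ) :=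
  {μ | μ ∈ multiplierSpace 𝒯 ∧ sumBoundary 𝒯 (fun T p => edgeIntegral T p μ) = 0}

/-- The squared Frobenius norm of the gradient of `v` at `x`. -/
def gradNormSq (v : Plane → Plane) (x : Plane) : ℝ :=
  ∑ i : Fin 2, ∑ j : Fin 2, (fderiv ℝ v x (EuclideanSpace.single j 1) i) ^ 2

/-- The norm `‖v‖_{1,h}` on `V_h`. For `v ∈ V_h` the classical gradient exists on the open
elements, hence almost everywhere in `Ω_h`, and agrees with the weak gradient there. -/
def norm1h (𝒯 : Finset (Finset Plane)) (v : Plane → Plane) : ℝ :=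
  Real.sqrt ((∫ x in domain 𝒯, gradNormSq v x) +
    sumBoundary 𝒯 fun T p =>
      (edgeLength T p)⁻¹ * edgeIntegral T p fun x => ‖trace v T p x‖ ^ 2)

/-- The norm `‖μ‖_{-1/2,h}` on the multiplier space. -/
def normNegHalf (𝒯 : Finset (Finset Plane)) (μ : Plane → ℝ) : ℝ :=
  Real.sqrt (sumBoundary 𝒯 fun T p => edgeLength T p * edgeIntegral T p fun x => μ x ^ 2)

/-- The nonzero elements of `V_h`; as an element of `H¹(Ω_h)`, `v` is zero iff it vanishes almost
everywhere in `Ω_h`. -/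
def velocitySpaceNonzero (𝒯 : Finset (Finset Plane)) : Set (Plane → Plane) :=
  {v | v ∈ velocitySpace 𝒯 ∧ ¬ v =ᵐ[volume.restrict (domain 𝒯)] 0}

end StokesFEM

end

/-! It suffices to find, for each multiplier `μ`, one velocity `v` with `v · n_h = μ` exactly on
every boundary edge. The pairing is then `P = ∫ μ²`, and the zero-flux condition on `v` is the
zero-mean condition on `μ`. If the mesh size is comparable to `D`, then `‖μ‖²_{-1/2,h} ≤ R D P`, so
a bound `‖v‖²_{1,h} ≤ C P / D` gives the quotient the lower bound `‖μ‖_{-1/2,h} / √(C R)`, in which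
`D` cancels.

The field is a quadratic Lagrange interpolant on whole triangles, hence also on the Clough-Tocher
split. Its value at the midpoint of a boundary edge is `μ n`, and its value at a vertex `a` is `μ(a)
w`, where `w` has normal component one on the boundary edges at `a`. Quadratic interpolation along
an edge gives `v · n = μ` (`inner_testField`). Scaling, equivalence of nodal values with the `L²`
norm on edges, and a bounded number of triangles per vertex give the norm bound
(`exists_test_field`).

The crux is to bound `w` uniformly. The triangles at `a` split into fans, connected through common
edges, and a fan has at most one first and one last boundary edge, with unit directions `u` and
`u'`. The two conditions on `w` have a solution of length `2 / ‖u - u'‖`, which blows up only if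
these edges nearly coincide, that is, for a very thin fan or a very thin slit. Thin fans contradict
fatness of the triangles. Slits are excluded by `vertexCondition_compMesh`: around a vertex in `Ω`
the background mesh fills the gap with fat triangles, while at a vertex on the smooth boundary of
`Ω` all mesh triangles lie in one half plane. This gives `le_norm_dir_sub` and `exists_fan_vector`.

Different fans at one vertex may carry different vectors. This does not harm continuity, because a
vertex of a boundary edge is never in the open set `domain 𝒯`. A continuous piecewise smooth
function there belongs to `H¹` (`memH1_of_piecewise`). -/

namespace StokesFEM

/-! ### Barycentric coordinates of a triangle -/

/-- A nondegenerate triangle, given by its set of vertices. -/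
def IsTriangle (T : Finset Plane) : Prop :=
  AffineIndependent ℝ ((↑) : T → Plane) ∧ T.card = 3

theorem IsTriangle.affineSpan_eq_top {T : Finset Plane} (h : IsTriangle T) :
    affineSpan ℝ (T : Set Plane) = ⊤ := by
  have := (h.1.affineSpan_eq_top_iff_card_eq_finrank_add_one (V := Plane)).2 (by
    simp [h.2])
  simpa using this

/-- The vertices of a triangle as an affine basis of the plane. -/
noncomputable def IsTriangle.basis {T : Finset Plane} (h : IsTriangle T) :
    AffineBasis T ℝ Plane :=
  ⟨(↑), h.1, by simpa using h.affineSpan_eq_top⟩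

open Classical in
/-- The barycentric coordinate of the vertex `a` of the triangle `T`. -/
noncomputable def lam (T : Finset Plane) (a : Plane) : Plane →ᵃ[ℝ] ℝ :=
  if h : IsTriangle T ∧ a ∈ T then h.1.basis.coord ⟨a, h.2⟩ else 0

theorem lam_eq_coord {T : Finset Plane} (h : IsTriangle T) (i : T) :
    lam T i = h.basis.coord i := by
  rw [lam, dif_pos ⟨h, i.2⟩]

section Barycentric

variable {T : Finset Plane} (hT : IsTriangle T)
include hT

theorem lam_self {a : Plane} (ha : a ∈ T) : lam T a a = 1 := by
  rw [lam_eq_coord hT ⟨a, ha⟩]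
  exact hT.basis.coord_apply_eq ⟨a, ha⟩

theorem lam_of_ne {a b : Plane} (ha : a ∈ T) (hb : b ∈ T) (hab : b ≠ a) : lam T a b = 0 := by
  rw [lam_eq_coord hT ⟨a, ha⟩]
  exact hT.basis.coord_apply_ne (i := ⟨a, ha⟩) (j := ⟨b, hb⟩) (by simpa using hab.symm)

theorem mem_cell_iff {x : Plane} : x ∈ cell T ↔ ∀ a ∈ T, 0 ≤ lam T a x := by
  have h := hT.basis.convexHull_eq_nonneg_coord
  have hr : range hT.basis = (T : Set Plane) := Subtype.range_coe
  rw [hr] at h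
  rw [cell, h]
  simp only [mem_ofPred_eq, Subtype.forall]
  exact forall₂_congr fun a ha => by rw [← lam_eq_coord hT ⟨a, ha⟩]

theorem mem_interior_cell_iff {x : Plane} : x ∈ interior (cell T) ↔ ∀ a ∈ T, 0 < lam T a x := by
  have h := hT.basis.interior_convexHull
  have hr : range hT.basis = (T : Set Plane) := Subtype.range_coe
  rw [hr] at h
  rw [cell, h]
  simp only [mem_ofPred_eq, Subtype.forall]
  exact forall₂_congr fun a ha => by rw [← lam_eq_coord hT ⟨a, ha⟩]

theorem sum_lam (x : Plane) : ∑ a ∈ T, lam T a x = 1 := by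
  rw [← hT.basis.sum_coord_apply_eq_one x, ← Finset.sum_coe_sort]
  exact Finset.sum_congr rfl fun i _ => by rw [lam_eq_coord hT]

theorem lam_le_one {a x : Plane} (ha : a ∈ T) (hx : x ∈ cell T) : lam T a x ≤ 1 := by
  rw [← sum_lam hT x]
  exact Finset.single_le_sum (f := fun a => lam T a x) (fun b hb => (mem_cell_iff hT).1 hx b hb) ha

theorem affineMap_eq_of_eqOn {f g : Plane →ᵃ[ℝ] ℝ} (h : ∀ a ∈ T, f a = g a) : f = g :=
  AffineMap.ext_on hT.affineSpan_eq_top fun a ha => h a ha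

end Barycentric

theorem affineMap_eqOn_convexHull {f g : Plane →ᵃ[ℝ] ℝ} {s : Set Plane} (h : EqOn f g s) :
    EqOn f g (convexHull ℝ s) := fun _ hx =>
  AffineMap.eqOn_affineSpan h (convexHull_subset_affineSpan s hx)

theorem lam_eq_zero_of_mem_hull {T : Finset Plane} (hT : IsTriangle T) {s : Set Plane}
    (hs : s ⊆ T) {a x : Plane} (ha : a ∈ T) (has : a ∉ s) (hx : x ∈ convexHull ℝ s) :
    lam T a x = 0 :=
  affineMap_eqOn_convexHull (g := 0)
    (fun _ hb => lam_of_ne hT ha (hs hb) (fun h => has (h ▸ hb))) hx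

/-- An affine function on a hull is determined by its values at the generating points. Hence the
coordinates of neighbouring triangles match on their common face, which makes the pieces of the test
field fit together. -/
theorem lam_eq_lam_of_mem_hull {T T' : Finset Plane} (hT : IsTriangle T) (hT' : IsTriangle T')
    {s : Set Plane} (hs : s ⊆ T) (hs' : s ⊆ T') {a x : Plane} (ha : a ∈ T) (ha' : a ∈ T')
    (hx : x ∈ convexHull ℝ s) : lam T a x = lam T' a x :=
  affineMap_eqOn_convexHull (fun b hb => by
    by_cases hab : b = a
    · subst hab; rw [lam_self hT ha, lam_self hT' ha']
    · rw [lam_of_ne hT ha (hs hb) hab, lam_of_ne hT' ha' (hs' hb) hab]) hx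

theorem continuous_lam (T : Finset Plane) (a : Plane) : Continuous (lam T a) :=
  AffineMap.continuous_of_finiteDimensional _

/-- The gradient of a barycentric coordinate. -/
noncomputable def gradLam (T : Finset Plane) (a : Plane) : Plane →L[ℝ] ℝ :=
  LinearMap.toContinuousLinearMap (lam T a).linear

theorem lam_sub_lam (T : Finset Plane) (a x y : Plane) :
    lam T a x - lam T a y = gradLam T a (x - y) := by
  have := (lam T a).linearMap_vsub x y
  simpa [gradLam] using this.symm

theorem lam_add_smul (T : Finset Plane) (a x u : Plane) (s : ℝ) :
    lam T a (x + s • u) = lam T a x + s * gradLam T a u := by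
  have := lam_sub_lam T a (x + s • u) x
  simp at this
  linarith

theorem lam_add_smul_sub (T : Finset Plane) (a x y : Plane) (s : ℝ) :
    lam T a (x + s • (y - x)) = lam T a x + s * (lam T a y - lam T a x) := by
  rw [lam_add_smul, lam_sub_lam]

theorem hasFDerivAt_lam (T : Finset Plane) (a x : Plane) :
    HasFDerivAt (lam T a) (gradLam T a) x := by
  have h : (lam T a : Plane → ℝ) = fun y => gradLam T a y + lam T a 0 := by
    funext y
    have := lam_sub_lam T a y 0
    simp at this
    linarith
  rw [h]
  exact (gradLam T a).hasFDerivAt.add_const _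

theorem contDiff_lam (T : Finset Plane) (a : Plane) {n : WithTop ℕ∞} : ContDiff ℝ n (lam T a) := by
  have h : (lam T a : Plane → ℝ) = fun y => gradLam T a y + lam T a 0 := by
    funext y
    have := lam_sub_lam T a y 0
    simp at this
    linarith
  rw [h]
  exact (gradLam T a).contDiff.add contDiff_const

theorem isCompact_cell (T : Finset Plane) : IsCompact (cell T) :=
  T.finite_toSet.isCompact_convexHull ℝ

theorem isClosed_cell (T : Finset Plane) : IsClosed (cell T) := (isCompact_cell T).isClosed

theorem subset_cell (T : Finset Plane) : (T : Set Plane) ⊆ cell T := subset_convexHull ℝ _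

theorem dist_le_diam_cell {T : Finset Plane} {x y : Plane} (hx : x ∈ cell T) (hy : y ∈ cell T) :
    ‖x - y‖ ≤ Metric.diam (cell T) := by
  rw [← dist_eq_norm]
  exact Metric.dist_le_diam_of_mem (isCompact_cell T).isBounded hx hy

theorem IsTriangle.exists_eq {T : Finset Plane} (hT : IsTriangle T) {p : Plane} (hp : p ∈ T) :
    ∃ a b, a ≠ b ∧ a ≠ p ∧ b ≠ p ∧ T = {a, b, p} := by
  classical
  obtain ⟨a, b, hab, h⟩ := Finset.card_eq_two.1 (by
    rw [Finset.card_erase_of_mem hp, hT.2] : (T.erase p).card = 2)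
  have ha : a ∈ T.erase p := by simp [h]
  have hb : b ∈ T.erase p := by simp [h]
  refine ⟨a, b, hab, (Finset.mem_erase.1 ha).1, (Finset.mem_erase.1 hb).1, ?_⟩
  rw [← Finset.insert_erase hp, h]
  ext; simp; tauto

theorem IsTriangle.diam_pos {T : Finset Plane} (hT : IsTriangle T) :
    0 < Metric.diam (cell T) := by
  obtain ⟨p, hp⟩ : T.Nonempty := Finset.card_pos.1 (by rw [hT.2]; norm_num)
  obtain ⟨a, b, hab, -, -, h⟩ := hT.exists_eq hp
  have ha : a ∈ T := by simp [h]
  have hb : b ∈ T := by simp [h]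
  exact (norm_pos_iff.2 (sub_ne_zero.2 hab)).trans_le
    (dist_le_diam_cell (subset_cell T ha) (subset_cell T hb))

/-- The triangle `T` contains a ball of radius `γ * diam T`. -/
def IsFat (γ : ℝ) (T : Finset Plane) : Prop :=
  ∃ x, Metric.closedBall x (γ * Metric.diam (cell T)) ⊆ cell T

/-- Along any diameter of the inscribed ball, of length `2 γ d`, the coordinate stays in `[0, 1]`,
so its slope is at most `1 / (2 γ d)`. -/
theorem norm_gradLam_le {T : Finset Plane} (hT : IsTriangle T) {γ : ℝ} (hγ : 0 < γ)
    (hf : IsFat γ T) {a : Plane} (ha : a ∈ T) :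
    ‖gradLam T a‖ ≤ (2 * γ * Metric.diam (cell T))⁻¹ := by
  obtain ⟨x, hx⟩ := hf
  set d := Metric.diam (cell T)
  have hd : 0 < d := hT.diam_pos
  have key : ∀ u : Plane, ‖u‖ = 1 → |gradLam T a u| ≤ (2 * γ * d)⁻¹ := by
    intro u hu
    have h1 : x + (γ * d) • u ∈ cell T := hx (by
      simp [norm_smul, hu, abs_of_pos hγ, abs_of_pos hd])
    have h2 : x + (-(γ * d)) • u ∈ cell T := hx (by
      simp [norm_smul, hu, abs_of_pos hγ, abs_of_pos hd])
    have b1 := (mem_cell_iff hT).1 h1 a ha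
    have b2 := (mem_cell_iff hT).1 h2 a ha
    have c1 := lam_le_one hT ha h1
    have c2 := lam_le_one hT ha h2
    rw [lam_add_smul] at b1 b2 c1 c2
    rw [← one_div, le_div_iff₀ (by positivity)]
    rcases abs_cases (gradLam T a u) with ⟨h, -⟩ | ⟨h, -⟩ <;> rw [h] <;> nlinarith
  refine ContinuousLinearMap.opNorm_le_of_unit_norm (by positivity) fun u hu => key u hu


/-! ### Triangles of a simplicial complex -/

section Complex

variable {K : Geometry.SimplicialComplex ℝ Plane} {T T' F : Finset Plane}

theorem isTriangle_of_mem_faces (hT : T ∈ K.faces) (h3 : T.card = 3) : IsTriangle T :=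
  ⟨K.indep hT, h3⟩

/-- This is how conformity enters: a common point of two simplices lies in the hull of their common
vertices, so every vertex that carries weight there is shared. -/
theorem mem_of_lam_ne_zero (hT : T ∈ K.faces) (h3 : T.card = 3) (hF : F ∈ K.faces)
    {a x : Plane} (ha : a ∈ T) (hxT : x ∈ cell T) (hxF : x ∈ cell F) (h : lam T a x ≠ 0) :
    a ∈ F := by
  by_contra haF
  exact h (lam_eq_zero_of_mem_hull (isTriangle_of_mem_faces hT h3) inter_subset_left ha
    (fun h' => haF h'.2) (K.inter_subset_convexHull hT hF ⟨hxT, hxF⟩))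

/-- The unit vector pointing from `a` to `p`. -/
noncomputable def dir (a p : Plane) : Plane := ‖p - a‖⁻¹ • (p - a)

theorem norm_dir {a p : Plane} (h : p ≠ a) : ‖dir a p‖ = 1 := by
  rw [dir, norm_smul, norm_inv, norm_norm, inv_mul_cancel₀ (norm_ne_zero_iff.2 (sub_ne_zero.2 h))]

theorem IsTriangle.eq_of_mem {a p q b : Plane} (hT : IsTriangle T) (ha : a ∈ T) (hp : p ∈ T)
    (hq : q ∈ T) (hap : a ≠ p) (hqa : q ≠ a) (hqp : q ≠ p) (hb : b ∈ T) :
    b = a ∨ b = p ∨ b = q := by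
  classical
  have : ({a, p, q} : Finset Plane) = T := Finset.eq_of_subset_of_card_le (by
    intro y
    simp only [Finset.mem_insert, Finset.mem_singleton]
    rintro (rfl | rfl | rfl) <;> assumption)
    (by rw [hT.2, Finset.card_eq_three.2 ⟨a, p, q, hap, hqa.symm, hqp.symm, rfl⟩])
  rw [← this] at hb
  simpa using hb

theorem eventually_lam_pos {a x y : Plane} (h : 0 < lam T a x) :
    ∀ᶠ s in 𝓝[>] (0 : ℝ), 0 < lam T a (x + s • (y - x)) := by
  have hc : Continuous fun s : ℝ => lam T a (x + s • (y - x)) :=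
    (continuous_lam T a).comp (by fun_prop)
  have : Tendsto (fun s : ℝ => lam T a (x + s • (y - x))) (𝓝[>] 0) (𝓝 (lam T a x)) := by
    have := hc.tendsto 0
    simp only [zero_smul, add_zero] at this
    exact this.mono_left nhdsWithin_le_nhds
  exact this.eventually_const_lt h

/-- Two edges of a simplicial complex at `a` coincide if they enclose a small angle and the second
one lies on the side of the first one on which there is a triangle. -/
theorem eq_of_norm_dir_sub_lt (hT : T ∈ K.faces) (h3 : T.card = 3) {γ : ℝ} (hγ : 0 < γ)
    (hf : IsFat γ T) {a p q z : Plane} (ha : a ∈ T) (hp : p ∈ T) (hq : q ∈ T) (hap : a ≠ p)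
    (hqa : q ≠ a) (hqp : q ≠ p) (hz : F ∈ K.faces) (haF : a ∈ F) (hzF : z ∈ F)
    (hF : ∀ b ∈ F, b = a ∨ b = z) (hza : z ≠ a)
    (hside : 0 ≤ lam T q z) (hlt : ‖dir a z - dir a p‖ < 2 * γ) : z = p := by
  have htri := isTriangle_of_mem_faces hT h3
  -- The slope of `lam T p` in the direction of `p` is `1 / ‖p - a‖ ≥ 1 / d`. Turning the direction
  -- by less than `2 γ` changes the slope by less than `1 / d`, so it stays positive.
  have hpos : 0 < lam T p z := by
    set d := Metric.diam (cell T)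
    have hd : 0 < d := htri.diam_pos
    have e1 : lam T p z = ‖z - a‖ * gradLam T p (dir a z) := by
      have := lam_sub_lam T p z a
      rw [lam_of_ne htri hp ha hap, sub_zero] at this
      rw [this, dir, map_smul, smul_eq_mul, mul_inv_cancel_left₀]
      exact norm_ne_zero_iff.2 (sub_ne_zero.2 hza)
    have e2 : 1 = ‖p - a‖ * gradLam T p (dir a p) := by
      have := lam_sub_lam T p p a
      rw [lam_of_ne htri hp ha hap, sub_zero, lam_self htri hp] at this
      rw [this, dir, map_smul, smul_eq_mul, mul_inv_cancel_left₀]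
      exact norm_ne_zero_iff.2 (sub_ne_zero.2 hap.symm)
    have hpa : 0 < ‖p - a‖ := norm_pos_iff.2 (sub_ne_zero.2 hap.symm)
    have e3 : d⁻¹ ≤ gradLam T p (dir a p) := by
      have hle : ‖p - a‖ ≤ d := dist_le_diam_cell (subset_cell T hp) (subset_cell T ha)
      have : gradLam T p (dir a p) = ‖p - a‖⁻¹ := by field_simp; linarith
      rw [this]
      exact inv_anti₀ hpa hle
    have e4 : |gradLam T p (dir a z - dir a p)| < d⁻¹ := by
      calc |gradLam T p (dir a z - dir a p)| ≤ ‖gradLam T p‖ * ‖dir a z - dir a p‖ :=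
            (gradLam T p).le_opNorm _
        _ ≤ (2 * γ * d)⁻¹ * ‖dir a z - dir a p‖ := by
            gcongr; exact norm_gradLam_le htri hγ hf hp
        _ < (2 * γ * d)⁻¹ * (2 * γ) := by gcongr
        _ = d⁻¹ := by field_simp
    rw [e1]
    refine mul_pos (norm_pos_iff.2 (sub_ne_zero.2 hza)) ?_
    rw [map_sub] at e4
    have := (abs_lt.1 e4).1
    linarith
  have hev : ∀ᶠ s in 𝓝[>] (0 : ℝ), 0 < lam T a (a + s • (z - a)) :=
    eventually_lam_pos (by rw [lam_self htri ha]; norm_num)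
  obtain ⟨s, ⟨hs, hs1⟩, hs0⟩ :=
    ((hev.and (eventually_nhdsWithin_of_eventually_nhds (eventually_lt_nhds one_pos))).and
      self_mem_nhdsWithin).exists
  have hs0 : 0 < s := hs0
  -- A point of the edge `a z` close to `a` lies in `T` with positive weight at `p`, so conformity
  -- makes `p` a vertex of that edge.
  set y := a + s • (z - a)
  have hyp : 0 < lam T p y := by
    rw [lam_add_smul_sub, lam_of_ne htri hp ha hap, sub_zero, zero_add]; positivity
  have hyq : 0 ≤ lam T q y := by
    rw [lam_add_smul_sub, lam_of_ne htri hq ha hqa.symm, sub_zero, zero_add]; positivity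
  have hyT : y ∈ cell T := (mem_cell_iff htri).2 fun b hb => by
    rcases htri.eq_of_mem ha hp hq hap hqa hqp hb with rfl | rfl | rfl
    · exact hs.le
    · exact hyp.le
    · exact hyq
  have hyF : y ∈ cell F :=
    (convex_convexHull ℝ _).add_smul_sub_mem (subset_cell F haF) (subset_cell F hzF)
      ⟨hs0.le, hs1.le⟩
  rcases hF p (mem_of_lam_ne_zero hT h3 hz hp hyT hyF hyp.ne') with h | h
  · exact absurd h.symm hap
  · exact h.symm

/-- Two triangles on the same side of a common edge coincide. -/
theorem eq_of_same_side (hT : T ∈ K.faces) (h3 : T.card = 3) (hT' : T' ∈ K.faces)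
    (h3' : T'.card = 3) {a p q q' : Plane} (ha : a ∈ T) (hp : p ∈ T) (hq : q ∈ T) (ha' : a ∈ T')
    (hp' : p ∈ T') (hq' : q' ∈ T') (hap : a ≠ p) (hqa : q ≠ a) (hqp : q ≠ p) (hqa' : q' ≠ a)
    (hqp' : q' ≠ p) (hside : 0 < lam T' q' q) : q = q' ∧ T = T' := by
  have htri := isTriangle_of_mem_faces hT h3
  have htri' := isTriangle_of_mem_faces hT' h3'
  -- Moving slightly from the midpoint of the common edge towards `q` reaches a point of both
  -- triangles with positive weight at `q`.
  set m := a + (2⁻¹ : ℝ) • (p - a)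
  have hm : ∀ S : Finset Plane, IsTriangle S → a ∈ S → p ∈ S → ∀ b ∈ S, (b = a ∨ b = p) →
      0 < lam S b m := by
    intro S hS haS hpS b hb h
    rw [lam_add_smul_sub]
    rcases h with rfl | rfl
    · rw [lam_self hS hb, lam_of_ne hS hb hpS hap.symm]; norm_num
    · rw [lam_self hS hb, lam_of_ne hS hb haS hap]; norm_num
  have hmq : lam T q m = 0 := by
    rw [lam_add_smul_sub, lam_of_ne htri hq ha hqa.symm, lam_of_ne htri hq hp hqp.symm]; norm_num
  have hmq' : lam T' q' m = 0 := by
    rw [lam_add_smul_sub, lam_of_ne htri' hq' ha' hqa'.symm, lam_of_ne htri' hq' hp' hqp'.symm]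
    norm_num
  obtain ⟨s, ⟨⟨⟨h1, h2⟩, h3⟩, h4⟩, hs0⟩ :=
    ((((eventually_lam_pos (y := q) (hm T htri ha hp a ha (.inl rfl))).and
      (eventually_lam_pos (y := q) (hm T htri ha hp p hp (.inr rfl)))).and
      (eventually_lam_pos (y := q) (hm T' htri' ha' hp' a ha' (.inl rfl)))).and
      (eventually_lam_pos (y := q) (hm T' htri' ha' hp' p hp' (.inr rfl)))).and
      self_mem_nhdsWithin |>.exists
  have hs0 : 0 < s := hs0
  set y := m + s • (q - m)
  have hyq : 0 < lam T q y := by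
    rw [lam_add_smul_sub, hmq, lam_self htri hq]; simpa using hs0
  have hyq' : 0 < lam T' q' y := by
    rw [lam_add_smul_sub, hmq', sub_zero, zero_add]; positivity
  have hyT : y ∈ cell T := (mem_cell_iff htri).2 fun b hb => by
    rcases htri.eq_of_mem ha hp hq hap hqa hqp hb with rfl | rfl | rfl
    exacts [h1.le, h2.le, hyq.le]
  have hyT' : y ∈ cell T' := (mem_cell_iff htri').2 fun b hb => by
    rcases htri'.eq_of_mem ha' hp' hq' hap hqa' hqp' hb with rfl | rfl | rfl
    exacts [h3.le, h4.le, hyq'.le]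
  have hqT' := mem_of_lam_ne_zero hT htri.2 hT' hq hyT hyT' hyq.ne'
  have hqq : q = q' := by
    rcases htri'.eq_of_mem ha' hp' hq' hap hqa' hqp' hqT' with h | h | h
    exacts [absurd h hqa, absurd h hqp, h]
  refine ⟨hqq, Finset.eq_of_subset_of_card_le (fun b hb => ?_) (by rw [htri.2, htri'.2])⟩
  rcases htri.eq_of_mem ha hp hq hap hqa hqp hb with rfl | rfl | rfl <;> assumption

/-- If a point of the open edge from `a` to `p` of a triangle is interior to a union of triangles,
then one of these triangles lies on the other side of the edge. -/
theorem exists_neighbor {𝒦 : Finset (Finset Plane)} (h𝒦 : ∀ T' ∈ 𝒦, T' ∈ K.faces ∧ T'.card = 3)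
    (hT : T ∈ K.faces) (h3 : T.card = 3) {a p q : Plane} (ha : a ∈ T) (hp : p ∈ T) (hq : q ∈ T)
    (hap : a ≠ p) (hqa : q ≠ a) (hqp : q ≠ p) {t : ℝ} (ht0 : 0 < t) (ht1 : t < 1)
    (hx : a + t • (p - a) ∈ interior (⋃ T' ∈ 𝒦, cell T')) :
    ∃ T' ∈ 𝒦, T' ≠ T ∧ a ∈ T' ∧ p ∈ T' := by
  classical
  have htri := isTriangle_of_mem_faces hT h3
  set x := a + t • (p - a)
  have hxa : lam T a x = 1 - t := by
    rw [lam_add_smul_sub, lam_self htri ha, lam_of_ne htri ha hp hap.symm]; ring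
  have hxp : lam T p x = t := by
    rw [lam_add_smul_sub, lam_self htri hp, lam_of_ne htri hp ha hap]; ring
  have hxq : lam T q x = 0 := by
    rw [lam_add_smul_sub, lam_of_ne htri hq ha hqa.symm, lam_of_ne htri hq hp hqp.symm]; ring
  have hxT : x ∈ cell T :=
    (convex_convexHull ℝ _).add_smul_sub_mem (subset_cell T ha) (subset_cell T hp)
      ⟨ht0.le, ht1.le⟩
  -- Any other triangle through `x` would contain both `a` and `p`. Without one, the union coincides
  -- with `T` near `x`, so `x` would be interior to `T` although its weight at `q` is zero.
  by_contra! hcon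
  have hother : ∀ T' ∈ 𝒦, T' ≠ T → x ∉ cell T' := by
    intro T' hT' hne hxT'
    have h := h𝒦 T' hT'
    exact hcon T' hT' hne
      (mem_of_lam_ne_zero hT h3 h.1 ha hxT hxT' (by rw [hxa]; linarith))
      (mem_of_lam_ne_zero hT h3 h.1 hp hxT hxT' (by rw [hxp]; linarith))
  have hclosed : IsClosed (⋃ T' ∈ 𝒦.erase T, cell T') :=
    isClosed_biUnion_finset fun T' _ => isClosed_cell T'
  have hxint : x ∈ interior (cell T) := by
    rw [mem_interior_iff_mem_nhds]
    filter_upwards [mem_interior_iff_mem_nhds.1 hx, hclosed.isOpen_compl.mem_nhds (by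
      simp only [mem_compl_iff, mem_iUnion, not_exists]
      exact fun T' hT' => hother T' (Finset.mem_of_mem_erase hT') (Finset.ne_of_mem_erase hT'))]
      with y hy hy'
    simp only [mem_iUnion, mem_compl_iff, not_exists, exists_prop] at hy hy'
    obtain ⟨T', hT', hyT'⟩ := hy
    by_cases h : T' = T
    · exact h ▸ hyT'
    · exact (hy' T' ⟨Finset.mem_erase.2 ⟨h, hT'⟩, hyT'⟩).elim
  exact (hxq ▸ (mem_interior_cell_iff htri).1 hxint q hq).false

end Complex

/-! ### Orientation and normals -/

/-- The cross product of two plane vectors. -/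
def cr (u v : Plane) : ℝ := u 0 * v 1 - u 1 * v 0

/-- Rotation by a right angle. -/
noncomputable def rot (u : Plane) : Plane := !₂[-u 1, u 0]

theorem inner_eq (u v : Plane) : inner ℝ u v = u 0 * v 0 + u 1 * v 1 := by
  simp [PiLp.inner_apply, Fin.sum_univ_two]; ring

theorem norm_sq_eq (u : Plane) : ‖u‖ ^ 2 = u 0 ^ 2 + u 1 ^ 2 := by
  rw [← real_inner_self_eq_norm_sq, inner_eq]; ring

theorem inner_rot (u v : Plane) : inner ℝ (rot u) v = cr u v := by
  rw [inner_eq]; simp [rot, cr]; ring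

theorem inner_rot_rot (u v : Plane) : inner ℝ (rot u) (rot v) = inner ℝ u v := by
  rw [inner_eq, inner_eq]; simp [rot]; ring

theorem norm_rot (u : Plane) : ‖rot u‖ = ‖u‖ := by
  have : ‖rot u‖ ^ 2 = ‖u‖ ^ 2 := by
    rw [← real_inner_self_eq_norm_sq, ← real_inner_self_eq_norm_sq, inner_rot_rot]
  exact (sq_eq_sq₀ (norm_nonneg _) (norm_nonneg _)).1 this

theorem cr_swap (u v : Plane) : cr u v = -cr v u := by simp [cr]; ring

theorem cr_smul_left (c : ℝ) (u v : Plane) : cr (c • u) v = c * cr u v := by simp [cr]; ring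

theorem cr_self (u : Plane) : cr u u = 0 := by simp [cr]; ring

/-- The affine function `z ↦ cr (p - a) (z - a)`. -/
noncomputable def crAffine (a p : Plane) : Plane →ᵃ[ℝ] ℝ where
  toFun z := cr (p - a) (z - a)
  linear :=
    { toFun := fun v => cr (p - a) v
      map_add' := fun u v => by simp [cr]; ring
      map_smul' := fun c v => by simp [cr]; ring }
  map_vadd' z v := by simp [cr]; ring

theorem crAffine_apply (a p z : Plane) : crAffine a p z = cr (p - a) (z - a) := rfl

section Triangle

variable {T : Finset Plane} (hT : IsTriangle T) {a p q : Plane} (ha : a ∈ T) (hp : p ∈ T)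
  (hq : q ∈ T) (hap : a ≠ p) (hqa : q ≠ a) (hqp : q ≠ p)
include hT ha hp hq hap hqa hqp

/-- Both sides are affine in `z` and agree at the three vertices. The sign of a barycentric
coordinate thus tells on which side of an edge a point lies. -/
theorem cr_eq_mul_lam (z : Plane) :
    cr (p - a) (z - a) = cr (p - a) (q - a) * lam T q z := by
  have : crAffine a p = cr (p - a) (q - a) • lam T q :=
    affineMap_eq_of_eqOn hT fun b hb => by
      rw [crAffine_apply]
      change _ = cr (p - a) (q - a) * lam T q b
      rcases hT.eq_of_mem ha hp hq hap hqa hqp hb with rfl | rfl | rfl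
      · rw [lam_of_ne hT hq hb hqa.symm]; simp [cr]
      · rw [lam_of_ne hT hq hb hqp.symm, cr_self, mul_zero]
      · rw [lam_self hT hb, mul_one]
  rw [← crAffine_apply, this]; rfl

theorem cr_ne_zero : cr (p - a) (q - a) ≠ 0 := by
  intro h0
  -- At this point the left side is `‖p - a‖²`.
  have h := cr_eq_mul_lam hT ha hp hq hap hqa hqp (a + rot (p - a))
  rw [h0, zero_mul, add_sub_cancel_left, ← inner_rot, real_inner_self_eq_norm_sq, norm_rot] at h
  exact hap.symm (sub_eq_zero.1 (norm_eq_zero.1 (pow_eq_zero_iff two_ne_zero |>.1 h)))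

end Triangle

theorem IsTriangle.outwardNormal_spec {T : Finset Plane} (hT : IsTriangle T) {p : Plane}
    (hp : p ∈ T) : IsOutwardNormal T p (outwardNormal T p) := by
  refine Classical.epsilon_spec (p := IsOutwardNormal T p) ?_
  obtain ⟨a, b, hab, hap, hbp, h⟩ := hT.exists_eq hp
  have ha : a ∈ T := by simp [h]
  have hb : b ∈ T := by simp [h]
  have hc := cr_ne_zero hT ha hb hp hab hap.symm hbp.symm
  have hba : b - a ≠ 0 := sub_ne_zero.2 hab.symm
  set c := cr (b - a) (p - a)
  have key : ∀ x y, (x = a ∨ x = b) → (y = a ∨ y = b) →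
      cr (b - a) (x - p) = -c ∧ cr (b - a) (y - x) = 0 := by
    rintro x y (rfl | rfl) (rfl | rfl) <;> simp [c, cr] <;> (try constructor) <;> ring
  -- The sign of the orientation `c` selects the rotated edge direction that points away from `p`.
  refine ⟨(-(SignType.sign c : ℝ) * ‖b - a‖⁻¹) • rot (b - a), ?_, ?_⟩
  · rw [norm_smul, norm_rot, norm_mul, norm_inv, norm_norm, mul_assoc,
      inv_mul_cancel₀ (norm_ne_zero_iff.2 hba)]
    rcases hc.lt_or_gt with h | h <;> simp [h]
  · have hmem : ∀ x, x ∈ (T : Set Plane) \ {p} → x = a ∨ x = b := by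
      intro x hx
      have := hx.2
      have h1 := hx.1
      simp [h] at this h1
      tauto
    intro x hx
    refine ⟨?_, fun y hy => ?_⟩
    · have e : (starRingEnd ℝ) (-(SignType.sign c : ℝ) * ‖b - a‖⁻¹) * -c = ‖b - a‖⁻¹ * |c| := by
        rw [conj_trivial, ← self_mul_sign]; ring
      rw [inner_smul_left, inner_rot, (key x x (hmem x hx) (hmem x hx)).1, e]
      exact mul_pos (inv_pos.2 (norm_pos_iff.2 hba)) (abs_pos.2 hc)
    · rw [inner_smul_left, inner_rot, (key x y (hmem x hx) (hmem y hy)).2, mul_zero]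

/-- The outward normal on the edge from `a` to `p` of a triangle whose third vertex `q` lies to the
left or to the right of this edge. -/
theorem outwardNormal_eq {T : Finset Plane} (hT : IsTriangle T) {a p q : Plane} (ha : a ∈ T)
    (hp : p ∈ T) (hq : q ∈ T) (hap : a ≠ p) (hqa : q ≠ a) (hqp : q ≠ p) :
    (0 < cr (p - a) (q - a) → outwardNormal T q = -rot (dir a p)) ∧
      (cr (p - a) (q - a) < 0 → outwardNormal T q = rot (dir a p)) := by
  obtain ⟨h1, h2⟩ := hT.outwardNormal_spec hq
  set n := outwardNormal T q
  obtain ⟨h3, h4⟩ := h2 a ⟨ha, by simpa using hqa.symm⟩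
  have h5 := h4 p ⟨hp, by simpa using hqp.symm⟩
  have hpos : 0 < ‖p - a‖ := norm_pos_iff.2 (sub_ne_zero.2 hap.symm)
  set u := dir a p with hu
  have hu1 : u 0 ^ 2 + u 1 ^ 2 = 1 := by rw [← norm_sq_eq, norm_dir hap.symm, one_pow]
  have hn1 : n 0 ^ 2 + n 1 ^ 2 = 1 := by rw [← norm_sq_eq, h1, one_pow]
  have hpu : p - a = ‖p - a‖ • u := by
    rw [hu, dir, smul_inv_smul₀ hpos.ne']
  have h6 : u 0 * n 0 + u 1 * n 1 = 0 := by
    rw [hpu, inner_smul_right, mul_eq_zero_iff_left hpos.ne', inner_eq] at h5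
    linarith
  -- Since `n` is a unit vector orthogonal to `u`, it equals `s • rot u` with `s = ±1`; the position
  -- of `q` decides the sign.
  set s := cr u n with hs
  have hns : n = s • rot u := by
    ext i
    fin_cases i <;> simp [rot, hs, cr]
    · linear_combination (-n 0) * hu1 + u 0 * h6
    · linear_combination (-n 1) * hu1 + u 1 * h6
  have hs2 : s ^ 2 = 1 := by
    have : ‖n‖ ^ 2 = s ^ 2 * ‖u‖ ^ 2 := by
      rw [hns, norm_smul, norm_rot, mul_pow, Real.norm_eq_abs, sq_abs]
    rw [h1, norm_dir hap.symm] at this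
    linarith
  have h7 : 0 < -(s * cr u (q - a)) := by
    rw [hns, inner_smul_left, inner_rot] at h3
    have : cr u (a - q) = -cr u (q - a) := by simp [cr]; ring
    rw [this] at h3
    simpa using h3
  have hs1 : s = 1 ∨ s = -1 := by
    have : (s - 1) * (s + 1) = 0 := by linarith
    rcases mul_eq_zero.1 this with h | h
    · exact .inl (by linarith)
    · exact .inr (by linarith)
  rw [hpu, cr_smul_left]
  constructor
  · intro h
    have hc : 0 < cr u (q - a) := pos_of_mul_pos_right h hpos.le
    have : s = -1 := by
      rcases hs1 with h | h
      · nlinarith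
      · exact h
    rw [hns, this]; simp
  · intro h
    have hc : cr u (q - a) < 0 := by
      by_contra hcon
      push Not at hcon
      nlinarith [mul_nonneg hpos.le hcon]
    have : s = 1 := by
      rcases hs1 with h | h
      · exact h
      · nlinarith
    rw [hns, this]; simp

/-! ### Fans of triangles -/

section Relation

variable {α : Type*} {r : α → α → Prop}

/-- When predecessors are unique, an element without predecessor starts a chain that exhausts its
component: stepping back from a later element of the chain cannot leave it. -/
theorem reflTransGen_of_eqvGen (hl : ∀ x y z, r x z → r y z → x = y) {t x : α}
    (ht : ∀ y, ¬r y t) (h : Relation.EqvGen r t x) : Relation.ReflTransGen r t x := by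
  have key : ∀ x y, Relation.EqvGen r x y →
      (Relation.ReflTransGen r t x ↔ Relation.ReflTransGen r t y) := by
    intro x y hxy
    induction hxy with
    | rel x y hxy =>
      refine ⟨fun h => h.tail hxy, fun h => ?_⟩
      rcases Relation.ReflTransGen.cases_tail h with rfl | ⟨z, hz, hzy⟩
      · exact absurd hxy (ht _)
      · exact hl _ _ _ hzy hxy ▸ hz
    | refl x => rfl
    | symm x y _ ih => exact ih.symm
    | trans x y z _ _ ih1 ih2 => exact ih1.trans ih2
  exact (key t x h).1 .refl

theorem eq_of_eqvGen_of_no_pred (hl : ∀ x y z, r x z → r y z → x = y) {t t' : α}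
    (ht : ∀ y, ¬r y t) (ht' : ∀ y, ¬r y t') (h : Relation.EqvGen r t t') : t = t' := by
  rcases Relation.ReflTransGen.cases_tail (reflTransGen_of_eqvGen hl ht h) with rfl | ⟨z, -, hz⟩
  · rfl
  · exact absurd hz (ht' _)

theorem eqvGen_swap {x y : α} (h : Relation.EqvGen r x y) :
    Relation.EqvGen (Function.swap r) x y := by
  induction h with
  | rel x y h => exact .symm _ _ (.rel _ _ h)
  | refl x => exact .refl x
  | symm x y _ ih => exact .symm _ _ ih
  | trans x y z _ _ ih1 ih2 => exact .trans _ _ _ ih1 ih2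

end Relation

/-- Two triangles of `𝒯` share an edge at `a`. -/
def FanAdj (𝒯 : Finset (Finset Plane)) (a : Plane) (X Y : Finset Plane) : Prop :=
  X ∈ 𝒯 ∧ Y ∈ 𝒯 ∧ a ∈ X ∧ a ∈ Y ∧ ∃ b, b ≠ a ∧ b ∈ X ∧ b ∈ Y

/-- `T` is a triangle of `𝒯` with positively ordered vertices `a`, `r`, `l`. -/
structure IsFanPair (𝒯 : Finset (Finset Plane)) (a : Plane) (T : Finset Plane) (r l : Plane) :
    Prop where
  mem : T ∈ 𝒯
  ha : a ∈ T
  hr : r ∈ T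
  hl : l ∈ T
  har : a ≠ r
  hal : a ≠ l
  hrl : r ≠ l
  pos : 0 < cr (r - a) (l - a)

/-- `Y` follows `X` in counterclockwise order around `a`. -/
def FanNext (𝒯 : Finset (Finset Plane)) (a : Plane) (X Y : Finset Plane) : Prop :=
  ∃ r m l, IsFanPair 𝒯 a X r m ∧ IsFanPair 𝒯 a Y m l

/-! ### Counterclockwise succession of the triangles around a vertex. -/

section Fan

variable {K : Geometry.SimplicialComplex ℝ Plane} {𝒯 : Finset (Finset Plane)}
  (h𝒯 : ∀ T ∈ 𝒯, T ∈ K.faces ∧ T.card = 3) {a : Plane} {T X Y : Finset Plane}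
include h𝒯

theorem exists_isFanPair (hT : T ∈ 𝒯) (ha : a ∈ T) : ∃ r l, IsFanPair 𝒯 a T r l := by
  have htri := isTriangle_of_mem_faces (h𝒯 T hT).1 (h𝒯 T hT).2
  obtain ⟨r, l, hrl, hra, hla, h⟩ := htri.exists_eq ha
  have hr : r ∈ T := by simp [h]
  have hl : l ∈ T := by simp [h]
  rcases (cr_ne_zero htri ha hr hl hra.symm hla hrl.symm).lt_or_gt with h | h
  · exact ⟨l, r, hT, ha, hl, hr, hla.symm, hra.symm, hrl.symm, by rw [cr_swap]; linarith⟩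
  · exact ⟨r, l, hT, ha, hr, hl, hra.symm, hla.symm, hrl, h⟩

theorem IsFanPair.eq_of_mem {r l b : Plane} (h : IsFanPair 𝒯 a T r l) (hb : b ∈ T) (hba : b ≠ a) :
    b = r ∨ b = l := by
  have htri := isTriangle_of_mem_faces (h𝒯 T h.mem).1 (h𝒯 T h.mem).2
  rcases htri.eq_of_mem h.ha h.hr h.hl h.har h.hal.symm h.hrl.symm hb with h | h | h
  · exact absurd h hba
  · exact .inl h
  · exact .inr h

theorem IsFanPair.unique {r l r' l' : Plane} (h : IsFanPair 𝒯 a T r l)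
    (h' : IsFanPair 𝒯 a T r' l') : r = r' ∧ l = l' := by
  rcases h.eq_of_mem h𝒯 h'.hr h'.har.symm with rfl | rfl
  · rcases h.eq_of_mem h𝒯 h'.hl h'.hal.symm with rfl | rfl
    · exact absurd rfl h'.hrl
    · exact ⟨rfl, rfl⟩
  · rcases h.eq_of_mem h𝒯 h'.hl h'.hal.symm with rfl | rfl
    · have h1 := h.pos
      have h2 := h'.pos
      rw [cr_swap] at h2
      linarith
    · exact absurd rfl h'.hrl

/-- Both triangles lie to the right of the edge from `a` to `m`, so `eq_of_same_side` applies. -/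
theorem IsFanPair.eq_of_left {r r' m : Plane} (h : IsFanPair 𝒯 a X r m)
    (h' : IsFanPair 𝒯 a Y r' m) : X = Y := by
  have htri' := isTriangle_of_mem_faces (h𝒯 Y h'.mem).1 (h𝒯 Y h'.mem).2
  refine (eq_of_same_side (h𝒯 X h.mem).1 (h𝒯 X h.mem).2 (h𝒯 Y h'.mem).1 (h𝒯 Y h'.mem).2
    h.ha h.hl h.hr h'.ha h'.hl h'.hr h.hal h.har.symm h.hrl h'.har.symm h'.hrl ?_).2
  have := cr_eq_mul_lam htri' h'.ha h'.hl h'.hr h.hal h'.har.symm h'.hrl r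
  have h1 := h.pos
  have h2 := h'.pos
  rw [cr_swap] at h1 h2
  by_contra! hcon
  nlinarith

theorem IsFanPair.eq_of_right {m l l' : Plane} (h : IsFanPair 𝒯 a X m l)
    (h' : IsFanPair 𝒯 a Y m l') : X = Y := by
  have htri' := isTriangle_of_mem_faces (h𝒯 Y h'.mem).1 (h𝒯 Y h'.mem).2
  refine (eq_of_same_side (h𝒯 X h.mem).1 (h𝒯 X h.mem).2 (h𝒯 Y h'.mem).1 (h𝒯 Y h'.mem).2
    h.ha h.hr h.hl h'.ha h'.hr h'.hl h.har h.hal.symm h.hrl.symm h'.hal.symm h'.hrl.symm ?_).2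
  have := cr_eq_mul_lam htri' h'.ha h'.hr h'.hl h.har h'.hal.symm h'.hrl.symm l
  have h1 := h.pos
  have h2 := h'.pos
  by_contra! hcon
  nlinarith

theorem fanNext_left_unique (X Y Z : Finset Plane) (h : FanNext 𝒯 a X Z) (h' : FanNext 𝒯 a Y Z) :
    X = Y := by
  obtain ⟨r, m, l, h1, h2⟩ := h
  obtain ⟨r', m', l', h1', h2'⟩ := h'
  obtain ⟨rfl, rfl⟩ := h2.unique h𝒯 h2'
  exact h1.eq_of_left h𝒯 h1'

theorem fanNext_right_unique (X Y Z : Finset Plane) (h : FanNext 𝒯 a Z X) (h' : FanNext 𝒯 a Z Y) :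
    X = Y := by
  obtain ⟨r, m, l, h1, h2⟩ := h
  obtain ⟨r', m', l', h1', h2'⟩ := h'
  obtain ⟨rfl, rfl⟩ := h1.unique h𝒯 h1'
  exact h2.eq_of_right h𝒯 h2'

/-- If the common edge is the left edge of one triangle and the right edge of the other, they are
consecutive; otherwise they lie on the same side of it and coincide. -/
theorem eqvGen_fanNext_of_fanAdj (h : FanAdj 𝒯 a X Y) : Relation.EqvGen (FanNext 𝒯 a) X Y := by
  obtain ⟨hX, hY, haX, haY, b, hba, hbX, hbY⟩ := h
  obtain ⟨r, l, h⟩ := exists_isFanPair h𝒯 hX haX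
  obtain ⟨r', l', h'⟩ := exists_isFanPair h𝒯 hY haY
  rcases h.eq_of_mem h𝒯 hbX hba with rfl | rfl
  · rcases h'.eq_of_mem h𝒯 hbY hba with rfl | rfl
    · rw [h.eq_of_right h𝒯 h']; exact .refl _
    · exact .symm _ _ (.rel _ _ ⟨_, _, _, h', h⟩)
  · rcases h'.eq_of_mem h𝒯 hbY hba with rfl | rfl
    · exact .rel _ _ ⟨_, _, _, h, h'⟩
    · rw [h.eq_of_left h𝒯 h']; exact .refl _

theorem eqvGen_fanNext (h : Relation.EqvGen (FanAdj 𝒯 a) X Y) :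
    Relation.EqvGen (FanNext 𝒯 a) X Y := by
  induction h with
  | rel x y h => exact eqvGen_fanNext_of_fanAdj h𝒯 h
  | refl x => exact .refl x
  | symm x y _ ih => exact .symm _ _ ih
  | trans x y z _ _ ih1 ih2 => exact .trans _ _ _ ih1 ih2

theorem IsFanPair.sdiff_left_subset {r l : Plane} (h : IsFanPair 𝒯 a T r l) (haY : a ∈ Y)
    (hrY : r ∈ Y) : (T : Set Plane) \ {l} ⊆ Y := by
  rintro b ⟨hb, hbl⟩
  by_cases hba : b = a
  · exact hba ▸ haY
  · rcases h.eq_of_mem h𝒯 hb hba with rfl | rfl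
    · exact hrY
    · exact absurd rfl hbl

theorem IsFanPair.sdiff_right_subset {r l : Plane} (h : IsFanPair 𝒯 a T r l) (haY : a ∈ Y)
    (hlY : l ∈ Y) : (T : Set Plane) \ {r} ⊆ Y := by
  rintro b ⟨hb, hbl⟩
  by_cases hba : b = a
  · exact hba ▸ haY
  · rcases h.eq_of_mem h𝒯 hb hba with rfl | rfl
    · exact absurd rfl hbl
    · exact hlY

/-- If the right edge of `T` is a boundary edge, then `T` has no predecessor. -/
theorem IsFanPair.not_fanNext_of_boundary {r l : Plane} (h : IsFanPair 𝒯 a T r l)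
    (hb : IsBoundaryEdge 𝒯 T l) (X : Finset Plane) : ¬FanNext 𝒯 a X T := by
  rintro ⟨r', m, l', h1, h2⟩
  obtain ⟨rfl, rfl⟩ := h.unique h𝒯 h2
  obtain rfl := hb.2.2 X h1.mem (h.sdiff_left_subset h𝒯 h1.ha h1.hl)
  exact h.hrl (h1.unique h𝒯 h).2

/-- If the left edge of `T` is a boundary edge, then `T` has no successor. -/
theorem IsFanPair.not_fanNext_of_boundary' {r l : Plane} (h : IsFanPair 𝒯 a T r l)
    (hb : IsBoundaryEdge 𝒯 T r) (X : Finset Plane) : ¬FanNext 𝒯 a T X := by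
  rintro ⟨r', m, l', h1, h2⟩
  obtain ⟨rfl, rfl⟩ := h.unique h𝒯 h1
  obtain rfl := hb.2.2 X h2.mem (h.sdiff_right_subset h𝒯 h2.ha h2.hr)
  exact h.hrl (h2.unique h𝒯 h).1.symm

end Fan

/-- The mesh `𝒯`, part of the complex `K`, is harmless near its vertex `a`: either every edge of a
triangle of `𝒯` at `a` has a fat triangle of `K` on its other side, or `𝒯` lies in a half plane
near `a`. -/
def VertexCondition (K : Geometry.SimplicialComplex ℝ Plane) (γ : ℝ) (𝒯 : Finset (Finset Plane))
    (a : Plane) : Prop :=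
  (∀ T ∈ 𝒯, a ∈ T → ∀ p ∈ T, p ≠ a →
    ∃ T' ∈ K.faces, T'.card = 3 ∧ IsFat γ T' ∧ T' ≠ T ∧ a ∈ T' ∧ p ∈ T') ∨
  ∃ ν : Plane, ν ≠ 0 ∧ ∀ T ∈ 𝒯, a ∈ T → ∀ p ∈ T, 0 ≤ inner ℝ ν (p - a)

/-- The angle of `u` in the half plane with inner normal `ν`. -/
noncomputable def halfPlaneArg (ν u : Plane) : ℝ := Complex.arg ⟨-cr ν u, inner ℝ ν u⟩

/-- Up to the factor `‖ν‖`, the pair `(-cr ν u, inner ν u)` gives the coordinates of `u` in a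
positively oriented orthonormal frame with second axis along `ν`. The identity is the cross product
in polar form. -/
theorem cr_eq_sin_halfPlaneArg (ν u v : Plane) :
    ‖ν‖ ^ 2 * cr u v = ‖(⟨-cr ν u, inner ℝ ν u⟩ : ℂ)‖ * ‖(⟨-cr ν v, inner ℝ ν v⟩ : ℂ)‖ *
      Real.sin (halfPlaneArg ν v - halfPlaneArg ν u) := by
  have h1 := Complex.norm_mul_cos_arg ⟨-cr ν u, inner ℝ ν u⟩
  have h2 := Complex.norm_mul_sin_arg ⟨-cr ν u, inner ℝ ν u⟩
  have h3 := Complex.norm_mul_cos_arg ⟨-cr ν v, inner ℝ ν v⟩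
  have h4 := Complex.norm_mul_sin_arg ⟨-cr ν v, inner ℝ ν v⟩
  rw [Real.sin_sub]
  have : ‖ν‖ ^ 2 * cr u v = (-cr ν u) * inner ℝ ν v - inner ℝ ν u * (-cr ν v) := by
    rw [norm_sq_eq, inner_eq, inner_eq]; simp only [cr]; ring
  simp only at h1 h2 h3 h4
  rw [this]
  have aux : ∀ {N θ M φ x y x' y' : ℝ}, N * Real.cos θ = x → N * Real.sin θ = y →
      M * Real.cos φ = x' → M * Real.sin φ = y' →
      x * y' - y * x' = N * M * (Real.sin φ * Real.cos θ - Real.cos φ * Real.sin θ) := by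
    rintro N θ M φ x y x' y' rfl rfl rfl rfl
    ring
  exact aux h1 h2 h3 h4

/-- The argument of `v` is at least `0` and that of `u` at most `π`, so in the wrong order their
difference would lie in `[0, π]`, where the sine is nonnegative. The branch cut causes no trouble.
-/
theorem halfPlaneArg_lt {ν u v : Plane} (hν : ν ≠ 0) (hv : 0 ≤ inner ℝ ν v)
    (h : 0 < cr u v) : halfPlaneArg ν u < halfPlaneArg ν v := by
  by_contra! hcon
  have h1 : 0 ≤ halfPlaneArg ν v := Complex.arg_nonneg_iff.2 hv
  have h2 : halfPlaneArg ν u ≤ Real.pi := Complex.arg_le_pi _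
  have h3 : 0 ≤ Real.sin (halfPlaneArg ν u - halfPlaneArg ν v) :=
    Real.sin_nonneg_of_nonneg_of_le_pi (by linarith) (by linarith)
  have h4 := cr_eq_sin_halfPlaneArg ν u v
  rw [← neg_sub, Real.sin_neg] at h4
  have h5 : 0 < ‖ν‖ ^ 2 * cr u v := mul_pos (by positivity) h
  have h6 : 0 ≤ ‖(⟨-cr ν u, inner ℝ ν u⟩ : ℂ)‖ * ‖(⟨-cr ν v, inner ℝ ν v⟩ : ℂ)‖ *
      Real.sin (halfPlaneArg ν u - halfPlaneArg ν v) := by positivity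
  linarith

theorem cr_nonneg_of_halfPlaneArg_lt {ν u v : Plane} (hν : ν ≠ 0) (hu : 0 ≤ inner ℝ ν u)
    (h : halfPlaneArg ν u < halfPlaneArg ν v) : 0 ≤ cr u v := by
  have h1 : 0 ≤ halfPlaneArg ν u := Complex.arg_nonneg_iff.2 hu
  have h2 : halfPlaneArg ν v ≤ Real.pi := Complex.arg_le_pi _
  have h3 : 0 ≤ Real.sin (halfPlaneArg ν v - halfPlaneArg ν u) :=
    Real.sin_nonneg_of_nonneg_of_le_pi (by linarith) (by linarith)
  have h4 := cr_eq_sin_halfPlaneArg ν u v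
  have h5 : 0 ≤ ‖ν‖ ^ 2 * cr u v := by rw [h4]; positivity
  exact nonneg_of_mul_nonneg_right h5 (by positivity)

/-! ### Angle bound and bounded normal vectors on fans. -/

section FanVector

variable {K : Geometry.SimplicialComplex ℝ Plane} {𝒯 : Finset (Finset Plane)}
  (h𝒯 : ∀ T ∈ 𝒯, T ∈ K.faces ∧ T.card = 3) {γ : ℝ} (hγ : 0 < γ) (hfat : ∀ T ∈ 𝒯, IsFat γ T)
  {a : Plane} (hv : VertexCondition K γ 𝒯 a)
include h𝒯 hγ hfat hv

/-- The two boundary edges of a fan enclose an angle that is bounded below. -/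
theorem le_norm_dir_sub {T T' : Finset Plane} {z l r p : Plane} (hT : IsFanPair 𝒯 a T z l)
    (hT' : IsFanPair 𝒯 a T' r p) (hbT : IsBoundaryEdge 𝒯 T l)
    (hchain : Relation.ReflTransGen (FanNext 𝒯 a) T T') :
    2 * γ ≤ ‖dir a z - dir a p‖ := by
  classical
  by_contra! hlt
  have hzp : z ≠ p := by
    rintro rfl
    obtain rfl := hbT.2.2 T' hT'.mem (hT.sdiff_left_subset h𝒯 hT'.ha hT'.hl)
    exact hT.hrl (hT'.unique h𝒯 hT).2
  have hF : ({a, z} : Finset Plane) ∈ K.faces := by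
    refine K.down_closed (h𝒯 T hT.mem).1 ?_ (by simp)
    intro b; simp only [Finset.mem_insert, Finset.mem_singleton]
    rintro (rfl | rfl)
    exacts [hT.ha, hT.hr]
  -- No fat triangle of `K` with edge `a p` can lie on the side of that edge where `z` is, since `z`
  -- would then have to be `p`.
  have cone : ∀ S ∈ K.faces, S.card = 3 → IsFat γ S → a ∈ S → p ∈ S → ∀ q ∈ S, q ≠ a → q ≠ p →
      0 ≤ lam S q z → False := fun S hS hS3 hSf haS hpS q hq hqa hqp hside =>
    hzp (eq_of_norm_dir_sub_lt hS hS3 hγ hSf haS hpS hq hT'.hal hqa hqp hF (by simp) (by simp)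
      (by simp) hT.har.symm hside hlt)
  have tri' := isTriangle_of_mem_faces (h𝒯 T' hT'.mem).1 (h𝒯 T' hT'.mem).2
  have hneg : cr (p - a) (r - a) < 0 := by rw [cr_swap]; linarith [hT'.pos]
  -- The last triangle `T'` lies to the right of the edge `a p`. If `z` is on that side, `T'` itself
  -- gives the contradiction; otherwise the gap outside the fan is thin, and the vertex condition is
  -- needed.
  rcases le_or_gt (cr (p - a) (z - a)) 0 with hc | hc
  · refine cone T' (h𝒯 T' hT'.mem).1 (h𝒯 T' hT'.mem).2 (hfat T' hT'.mem) hT'.ha hT'.hl r hT'.hr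
      hT'.har.symm hT'.hrl ?_
    have := cr_eq_mul_lam tri' hT'.ha hT'.hl hT'.hr hT'.hal hT'.har.symm hT'.hrl z
    by_contra! hcon
    nlinarith
  · rcases hv with hA | ⟨ν, hν, hB⟩
    · obtain ⟨S, hS, hS3, hSf, hSne, haS, hpS⟩ := hA T' hT'.mem hT'.ha p hT'.hl hT'.hal.symm
      have triS := isTriangle_of_mem_faces hS hS3
      obtain ⟨q, hqS, hq⟩ : ∃ q ∈ S, q ∉ ({a, p} : Finset Plane) :=
        Finset.exists_mem_notMem_of_card_lt_card
          (by rw [hS3]; exact (Finset.card_le_two).trans_lt (by norm_num))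
      simp only [Finset.mem_insert, Finset.mem_singleton, not_or] at hq
      have e := cr_eq_mul_lam triS haS hpS hqS hT'.hal hq.1 hq.2
      rcases (cr_ne_zero triS haS hpS hqS hT'.hal hq.1 hq.2).lt_or_gt with hs | hs
      -- A neighbour with its third vertex on the right would coincide with `T'`; hence `S` lies on
      -- the left, where `z` is.
      · refine hSne (eq_of_same_side (h𝒯 T' hT'.mem).1 (h𝒯 T' hT'.mem).2 hS hS3 hT'.ha hT'.hl
          hT'.hr haS hpS hqS hT'.hal hT'.har.symm hT'.hrl hq.1 hq.2 ?_).2.symm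
        have := e r
        by_contra! hcon
        nlinarith
      · refine cone S hS hS3 hSf haS hpS q hqS hq.1 hq.2 ?_
        have := e z
        by_contra! hcon
        nlinarith
    -- In a half plane the angle strictly increases along the fan, so the last edge cannot have
    -- turned past the first one.
    · have key : ∀ X, Relation.ReflTransGen (FanNext 𝒯 a) T X → ∀ r l, IsFanPair 𝒯 a X r l →
          halfPlaneArg ν (z - a) < halfPlaneArg ν (l - a) := by
        have step : ∀ {X r l}, IsFanPair 𝒯 a X r l →
            halfPlaneArg ν (r - a) < halfPlaneArg ν (l - a) := fun {X r l} h =>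
          halfPlaneArg_lt hν (hB X h.mem h.ha l h.hl) h.pos
        intro X hX
        induction hX with
        | refl =>
          intro r l h
          obtain ⟨rfl, rfl⟩ := hT.unique h𝒯 h
          exact step h
        | tail _ hXY ih =>
          intro r' l' h
          obtain ⟨r, m, l, h1, h2⟩ := hXY
          obtain ⟨rfl, rfl⟩ := h.unique h𝒯 h2
          exact (ih _ _ h1).trans (step h2)
      have h1 := cr_nonneg_of_halfPlaneArg_lt hν (hB T hT.mem hT.ha z hT.hr)
        (key T' hchain r p hT')
      rw [cr_swap] at h1
      linarith

/-- On each fan of triangles at `a` there is a bounded vector whose normal component on the boundary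
edges at `a` is one. -/
theorem exists_fan_vector (T : Finset Plane) :
    ∃ w : Plane, ‖w‖ ≤ 1 + γ⁻¹ ∧
      (∀ T', Relation.EqvGen (FanAdj 𝒯 a) T T' → ∀ p, IsBoundaryEdge 𝒯 T' p → a ∈ T' → a ≠ p →
        inner ℝ w (outwardNormal T' p) = 1) ∧
      (w ≠ 0 → ∃ T' p, IsBoundaryEdge 𝒯 T' p ∧ a ∈ T' ∧ a ≠ p) := by
  have hγ' : 0 < γ⁻¹ := inv_pos.2 hγ
  have htri : ∀ X ∈ 𝒯, IsTriangle X := fun X hX =>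
    isTriangle_of_mem_faces (h𝒯 X hX).1 (h𝒯 X hX).2
  let Src : Finset Plane → Plane → Prop := fun X r =>
    Relation.EqvGen (FanAdj 𝒯 a) T X ∧ ∃ l, IsFanPair 𝒯 a X r l ∧ IsBoundaryEdge 𝒯 X l
  let Snk : Finset Plane → Plane → Prop := fun X l =>
    Relation.EqvGen (FanAdj 𝒯 a) T X ∧ ∃ r, IsFanPair 𝒯 a X r l ∧ IsBoundaryEdge 𝒯 X r
  have hconn : ∀ {X Y}, Relation.EqvGen (FanAdj 𝒯 a) T X → Relation.EqvGen (FanAdj 𝒯 a) T Y →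
      Relation.EqvGen (FanNext 𝒯 a) X Y := fun hX hY =>
    eqvGen_fanNext h𝒯 (.trans _ _ _ (.symm _ _ hX) hY)
  -- A first boundary edge belongs to a triangle without predecessor, and a fan has at most one such
  -- triangle; symmetrically for last edges.
  have hSrcU : ∀ {X Y r r'}, Src X r → Src Y r' → r = r' := by
    rintro X Y r r' ⟨hX, l, h1, h2⟩ ⟨hY, l', h1', h2'⟩
    obtain rfl := eq_of_eqvGen_of_no_pred (fanNext_left_unique h𝒯)
      (h1.not_fanNext_of_boundary h𝒯 h2) (h1'.not_fanNext_of_boundary h𝒯 h2') (hconn hX hY)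
    exact (h1.unique h𝒯 h1').1
  have hSnkU : ∀ {X Y l l'}, Snk X l → Snk Y l' → l = l' := by
    rintro X Y l l' ⟨hX, r, h1, h2⟩ ⟨hY, r', h1', h2'⟩
    obtain rfl := eq_of_eqvGen_of_no_pred (r := Function.swap (FanNext 𝒯 a))
      (fun x y z h h' => fanNext_right_unique h𝒯 x y z h h')
      (h1.not_fanNext_of_boundary' h𝒯 h2) (h1'.not_fanNext_of_boundary' h𝒯 h2')
      (eqvGen_swap (hconn hX hY))
    exact (h1.unique h𝒯 h1').2
  have hcase : ∀ w : Plane, (∀ X r, Src X r → inner ℝ w (-rot (dir a r)) = 1) →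
      (∀ X l, Snk X l → inner ℝ w (rot (dir a l)) = 1) →
      ∀ T', Relation.EqvGen (FanAdj 𝒯 a) T T' → ∀ p, IsBoundaryEdge 𝒯 T' p → a ∈ T' → a ≠ p →
        inner ℝ w (outwardNormal T' p) = 1 := by
    intro w h1 h2 T' hT' p hp ha hap
    obtain ⟨r, l, h⟩ := exists_isFanPair h𝒯 hp.1 ha
    have ht := htri T' hp.1
    rcases h.eq_of_mem h𝒯 hp.2.1 hap.symm with rfl | rfl
    · rw [(outwardNormal_eq ht h.ha h.hl h.hr h.hal h.har.symm h.hrl).2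
        (by rw [cr_swap]; linarith [h.pos])]
      exact h2 T' l ⟨hT', _, h, hp⟩
    · rw [(outwardNormal_eq ht h.ha h.hr h.hl h.har h.hal.symm h.hrl.symm).1 h.pos]
      exact h1 T' r ⟨hT', _, h, hp⟩
  by_cases hs : ∃ X z, Src X z
  · obtain ⟨X, z, hX⟩ := hs
    obtain ⟨hXT, l, hXp, hXb⟩ := id hX
    have hbd : ∃ T' p, IsBoundaryEdge 𝒯 T' p ∧ a ∈ T' ∧ a ≠ p := ⟨X, l, hXb, hXp.ha, hXp.hal⟩
    have hz : ‖dir a z‖ = 1 := norm_dir hXp.har.symm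
    by_cases hk : ∃ Y p, Snk Y p
    · obtain ⟨Y, p, hY⟩ := hk
      obtain ⟨hYT, r, hYp, hYb⟩ := id hY
      have hp : ‖dir a p‖ = 1 := norm_dir hYp.hal.symm
      have hang := le_norm_dir_sub h𝒯 hγ hfat hv hXp hYp hXb
        (reflTransGen_of_eqvGen (fanNext_left_unique h𝒯) (hXp.not_fanNext_of_boundary h𝒯 hXb)
          (hconn hXT hYT))
      set u := dir a z
      set v := dir a p
      have hsq : ‖u - v‖ ^ 2 = 2 * (1 - inner ℝ u v) := by
        rw [norm_sub_sq_real, hz, hp]; ring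
      have hpos : 0 < ‖u - v‖ := by linarith
      have hi : 0 < 1 - inner ℝ u v := by nlinarith [sq_pos_of_pos hpos]
      -- The outward normals are `-rot u` and `rot v`, and their sum, rescaled, has the same inner
      -- product with both. As `1 - inner u v = ‖u - v‖² / 2`, its length is `2 / ‖u - v‖ ≤ 1 / γ`.
      refine ⟨(1 - inner ℝ u v)⁻¹ • (rot v - rot u), ?_, hcase _ ?_ ?_, fun _ => hbd⟩
      · have e1 : ‖rot v - rot u‖ = ‖u - v‖ := by
          rw [← norm_neg, neg_sub, ← norm_rot (u - v)]
          congr 1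
          ext i
          fin_cases i
          · simp [rot]; abel
          · simp [rot]
        have e2 : 1 - inner ℝ u v = ‖u - v‖ ^ 2 / 2 := by linarith
        rw [norm_smul, e1, e2, norm_inv, Real.norm_of_nonneg (by positivity)]
        have e3 : (‖u - v‖ ^ 2 / 2)⁻¹ * ‖u - v‖ = 2 * ‖u - v‖⁻¹ := by field_simp
        have e4 : ‖u - v‖⁻¹ ≤ (2 * γ)⁻¹ := inv_anti₀ (by positivity) hang
        rw [mul_inv] at e4
        rw [e3]; linarith
      · intro X' r' h'
        obtain rfl := hSrcU hX h'
        change inner ℝ _ (-rot u) = 1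
        rw [inner_smul_left, inner_neg_right, inner_sub_left, inner_rot_rot, inner_rot_rot,
          real_inner_self_eq_norm_sq, real_inner_comm u v, hz, conj_trivial]
        field_simp
        ring
      · intro X' r' h'
        obtain rfl := hSnkU hY h'
        change inner ℝ _ (rot v) = 1
        rw [inner_smul_left, inner_sub_left, inner_rot_rot, inner_rot_rot,
          real_inner_self_eq_norm_sq, hp, conj_trivial]
        field_simp
    · refine ⟨-rot (dir a z), by rw [norm_neg, norm_rot, hz]; linarith, hcase _ ?_ ?_,
        fun _ => hbd⟩
      · intro X' r' h'
        obtain rfl := hSrcU hX h'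
        rw [inner_neg_neg, real_inner_self_eq_norm_sq, norm_rot, hz, one_pow]
      · exact fun X' l' h' => absurd ⟨X', l', h'⟩ hk
  · by_cases hk : ∃ Y p, Snk Y p
    · obtain ⟨Y, p, hY⟩ := hk
      obtain ⟨hYT, r, hYp, hYb⟩ := id hY
      have hp : ‖dir a p‖ = 1 := norm_dir hYp.hal.symm
      refine ⟨rot (dir a p), by rw [norm_rot, hp]; linarith, hcase _ ?_ ?_,
        fun _ => ⟨Y, r, hYb, hYp.ha, hYp.har⟩⟩
      · exact fun X' l' h' => absurd ⟨X', l', h'⟩ hs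
      · intro X' r' h'
        obtain rfl := hSnkU hY h'
        rw [real_inner_self_eq_norm_sq, norm_rot, hp, one_pow]
    -- A fan without boundary edges imposes no condition. Taking zero here confines the test field
    -- to triangles touching the boundary.
    · exact ⟨0, by rw [norm_zero]; linarith,
        hcase _ (fun X' l' h' => absurd ⟨X', l', h'⟩ hs) (fun X' l' h' => absurd ⟨X', l', h'⟩ hk),
        fun h => absurd rfl h⟩

end FanVector

/-- Vectors attached to the vertices of the triangles of a mesh that are constant on fans and have
normal component one on the boundary edges. -/
theorem exists_vertex_vectors {K : Geometry.SimplicialComplex ℝ Plane}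
    {𝒯 : Finset (Finset Plane)} (h𝒯 : ∀ T ∈ 𝒯, T ∈ K.faces ∧ T.card = 3) {γ : ℝ} (hγ : 0 < γ)
    (hfat : ∀ T ∈ 𝒯, IsFat γ T) (hv : ∀ T ∈ 𝒯, ∀ a ∈ T, VertexCondition K γ 𝒯 a) :
    ∃ w : Plane → Finset Plane → Plane,
      (∀ a X Y, FanAdj 𝒯 a X Y → w a X = w a Y) ∧
      (∀ T p a, IsBoundaryEdge 𝒯 T p → a ∈ T → a ≠ p →
        inner ℝ (w a T) (outwardNormal T p) = 1) ∧
      (∀ T ∈ 𝒯, ∀ a ∈ T, ‖w a T‖ ≤ 1 + γ⁻¹) ∧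
      ∀ T ∈ 𝒯, ∀ a ∈ T, w a T ≠ 0 → ∃ T' p, IsBoundaryEdge 𝒯 T' p ∧ a ∈ T' ∧ a ≠ p := by
  let P : Plane → Finset Plane → Plane → Prop := fun a T w => ‖w‖ ≤ 1 + γ⁻¹ ∧
      (∀ T', Relation.EqvGen (FanAdj 𝒯 a) T T' → ∀ p, IsBoundaryEdge 𝒯 T' p → a ∈ T' → a ≠ p →
        inner ℝ w (outwardNormal T' p) = 1) ∧
      (w ≠ 0 → ∃ T' p, IsBoundaryEdge 𝒯 T' p ∧ a ∈ T' ∧ a ≠ p)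
  have hP : ∀ T ∈ 𝒯, ∀ a ∈ T, P a T (Classical.epsilon (P a T)) := fun T hT a ha =>
    Classical.epsilon_spec (exists_fan_vector h𝒯 hγ hfat (hv T hT a ha) T)
  refine ⟨fun a T => Classical.epsilon (P a T), fun a X Y h => ?_, fun T p a hb ha hap => ?_,
    fun T hT a ha => (hP T hT a ha).1, fun T hT a ha => (hP T hT a ha).2.2⟩
  -- The predicate depends on the triangle only through its fan, so the choice operator returns the
  -- same vector on the whole fan.
  · have : P a X = P a Y := by
      funext w
      have : ∀ T', Relation.EqvGen (FanAdj 𝒯 a) X T' ↔ Relation.EqvGen (FanAdj 𝒯 a) Y T' :=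
        fun T' => ⟨fun h' => .trans _ _ _ (.symm _ _ (.rel _ _ h)) h',
          fun h' => .trans _ _ _ (.rel _ _ h) h'⟩
      simp only [P, this]
    simp only [this]
  · exact (hP T hb.1 a ha).2.1 T (.refl _) p hb ha hap

/-! ### The mesh near its vertices -/

theorem Triangulation.mem_triangles {S : Set Plane} {𝒮 : Triangulation S} {T : Finset Plane} :
    T ∈ 𝒮.triangles ↔ T ∈ 𝒮.faces ∧ T.card = 3 := by
  simp [Triangulation.triangles]

theorem Triangulation.mem_compMesh {S Ω : Set Plane} {𝒮 : Triangulation S} {T : Finset Plane} :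
    T ∈ 𝒮.compMesh Ω ↔ (T ∈ 𝒮.faces ∧ T.card = 3) ∧ cell T ⊆ closure Ω := by
  simp [Triangulation.compMesh, Triangulation.mem_triangles]

theorem Triangulation.iUnion_cell {S : Set Plane} (𝒮 : Triangulation S) :
    ⋃ T ∈ 𝒮.triangles, cell T = S := by
  refine Eq.trans ?_ 𝒮.space_eq
  apply subset_antisymm
  · exact iUnion₂_subset fun T hT => subset_iUnion₂_of_subset T (mem_triangles.1 hT).1 subset_rfl
  · refine iUnion₂_subset fun s hs => ?_
    obtain ⟨T, hT, hsT, h3⟩ := 𝒮.pure_two s hs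
    exact subset_iUnion₂_of_subset T (mem_triangles.2 ⟨hT, h3⟩) (convexHull_mono hsT)

/-- Take `ν = -∇φ(a)`. Near `a` the closure of `Ω` lies in `φ ≤ 0`, while `φ(a) ≥ 0` because `a` is
not in the open set `Ω`. Hence `φ` has nonpositive derivative at `a` along every segment of `C` from
`a`. -/
theorem HasSmoothBoundary.exists_normal {Ω : Set Plane} (hΩ : HasSmoothBoundary Ω)
    (ho : IsOpen Ω) {a : Plane} (ha : a ∈ frontier Ω) :
    ∃ ν : Plane, ν ≠ 0 ∧ ∀ C : Set Plane, Convex ℝ C → C ⊆ closure Ω → a ∈ C →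
      ∀ p ∈ C, 0 ≤ inner ℝ ν (p - a) := by
  obtain ⟨φ, hφ, hd, hev⟩ := hΩ a ha
  have hc : Continuous φ := hφ.continuous
  refine ⟨-(InnerProductSpace.toDual ℝ Plane).symm (fderiv ℝ φ a), by simpa using hd, ?_⟩
  intro C hC hCΩ haC p hp
  rw [inner_neg_left, InnerProductSpace.toDual_symm_apply, Left.nonneg_neg_iff]
  have hnonpos : ∀ᶠ y in 𝓝 a, y ∈ closure Ω → φ y ≤ 0 := by
    filter_upwards [eventually_eventually_nhds.2 hev] with y hy hyΩ
    by_contra! hpos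
    obtain ⟨z, hz, hzΩ⟩ := ((mem_closure_iff_frequently.1 hyΩ).and_eventually
      (hy.and (hc.continuousAt.eventually_const_lt hpos))).exists
    exact absurd (hzΩ.1.1 hz) (by linarith [hzΩ.2])
  have ha0 : 0 ≤ φ a := by
    have h := hev.self_of_nhds
    rw [ho.frontier_eq] at ha
    by_contra! hneg
    exact ha.2 (h.2 hneg)
  have hline : Tendsto (fun t : ℝ => a + t • (p - a)) (𝓝[>] 0) (𝓝 a) := by
    have : Continuous fun t : ℝ => a + t • (p - a) := by fun_prop
    have := this.tendsto 0
    simp only [zero_smul, add_zero] at this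
    exact this.mono_left nhdsWithin_le_nhds
  have hder : HasDerivAt (fun t : ℝ => φ (a + t • (p - a))) (fderiv ℝ φ a (p - a)) 0 := by
    have h1 : HasDerivAt (fun t : ℝ => a + t • (p - a)) (p - a) 0 := by
      simpa using ((hasDerivAt_id (0 : ℝ)).smul_const (p - a)).const_add a
    have h2 : HasFDerivAt φ (fderiv ℝ φ a) (a + (0 : ℝ) • (p - a)) := by
      simpa using (hφ.differentiable (by simp) a).hasFDerivAt
    exact h2.comp_hasDerivAt 0 h1
  have hslope := (hasDerivWithinAt_iff_tendsto_slope' (by simp : (0 : ℝ) ∉ Ioi 0)).1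
    (hder.hasDerivWithinAt (s := Ioi 0))
  refine le_of_tendsto hslope ?_
  filter_upwards [hline.eventually hnonpos, self_mem_nhdsWithin,
    eventually_nhdsWithin_of_eventually_nhds (eventually_lt_nhds one_pos)] with t ht ht0 ht1
  have ht0 : 0 < t := ht0
  have := ht (hCΩ (hC.add_smul_sub_mem haC hp ⟨ht0.le, ht1.le⟩))
  rw [slope_def_field]
  simp only [zero_smul, add_zero, sub_zero]
  exact div_nonpos_of_nonpos_of_nonneg (by linarith) ht0.le

theorem exists_third {T : Finset Plane} (h3 : T.card = 3) (a p : Plane) :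
    ∃ q ∈ T, q ≠ a ∧ q ≠ p := by
  classical
  obtain ⟨q, hqS, hq⟩ : ∃ q ∈ T, q ∉ ({a, p} : Finset Plane) :=
    Finset.exists_mem_notMem_of_card_lt_card
      (by rw [h3]; exact (Finset.card_le_two).trans_lt (by norm_num))
  simp only [Finset.mem_insert, Finset.mem_singleton, not_or] at hq
  exact ⟨q, hqS, hq⟩

/-- If a vertex `a` is interior to a union of triangles, each edge of a triangle at `a` has one of
these triangles on its other side. -/
theorem exists_neighbor_of_vertex {K : Geometry.SimplicialComplex ℝ Plane}
    {𝒦 : Finset (Finset Plane)} (h𝒦 : ∀ T' ∈ 𝒦, T' ∈ K.faces ∧ T'.card = 3) {T : Finset Plane}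
    (hT : T ∈ K.faces) (h3 : T.card = 3) {a p : Plane} (ha : a ∈ T) (hp : p ∈ T) (hap : a ≠ p)
    (hx : a ∈ interior (⋃ T' ∈ 𝒦, cell T')) : ∃ T' ∈ 𝒦, T' ≠ T ∧ a ∈ T' ∧ p ∈ T' := by
  obtain ⟨q, hq, hqa, hqp⟩ := exists_third h3 a p
  have hline : Tendsto (fun t : ℝ => a + t • (p - a)) (𝓝[>] 0) (𝓝 a) := by
    have : Continuous fun t : ℝ => a + t • (p - a) := by fun_prop
    have := this.tendsto 0
    simp only [zero_smul, add_zero] at this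
    exact this.mono_left nhdsWithin_le_nhds
  obtain ⟨t, ⟨ht, ht1⟩, ht0⟩ := (((hline.eventually (isOpen_interior.mem_nhds hx)).and
    (eventually_nhdsWithin_of_eventually_nhds (eventually_lt_nhds one_pos))).and
    self_mem_nhdsWithin).exists
  exact exists_neighbor h𝒦 hT h3 ha hp hq hap hqa hqp ht0 ht1 ht

theorem vertexCondition_compMesh {Ω S : Set Plane} (ho : IsOpen Ω) (hΩ : HasSmoothBoundary Ω)
    (hΩS : Ω ⊆ S) {γ : ℝ} {𝒮 : Triangulation S} (hγ : 𝒮.ShapeRegular γ) {T : Finset Plane}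
    (hT : T ∈ 𝒮.compMesh Ω) {a : Plane} (ha : a ∈ T) :
    VertexCondition 𝒮.toSimplicialComplex γ (𝒮.compMesh Ω) a := by
  have hacl : a ∈ closure Ω := (Triangulation.mem_compMesh.1 hT).2 (subset_cell T ha)
  by_cases haΩ : a ∈ Ω
  · left
    intro X hX haX p hp hpa
    have hX' := (Triangulation.mem_compMesh.1 hX).1
    obtain ⟨T', hT', hne, ha', hp'⟩ := exists_neighbor_of_vertex (𝒦 := 𝒮.triangles)
      (fun T' hT' => Triangulation.mem_triangles.1 hT') hX'.1 hX'.2 haX hp hpa.symm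
      (by rw [𝒮.iUnion_cell]; exact interior_maximal hΩS ho haΩ)
    exact ⟨T', (Triangulation.mem_triangles.1 hT').1, (Triangulation.mem_triangles.1 hT').2,
      hγ T' hT', hne, ha', hp'⟩
  · right
    obtain ⟨ν, hν, h⟩ := hΩ.exists_normal ho (ho.frontier_eq ▸ ⟨hacl, haΩ⟩ : a ∈ frontier Ω)
    exact ⟨ν, hν, fun X hX haX p hp => h (cell X) (convex_convexHull ℝ _)
      (Triangulation.mem_compMesh.1 hX).2 (subset_cell X haX) p (subset_cell X hp)⟩

/-- Around a vertex in the open domain every edge of a mesh triangle has another mesh triangle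
across it. -/
theorem notMem_domain_of_boundary {K : Geometry.SimplicialComplex ℝ Plane}
    {𝒯 : Finset (Finset Plane)} (h𝒯 : ∀ T ∈ 𝒯, T ∈ K.faces ∧ T.card = 3) {T : Finset Plane}
    {a p : Plane} (hb : IsBoundaryEdge 𝒯 T p) (ha : a ∈ T) (hap : a ≠ p) : a ∉ domain 𝒯 := by
  intro hdom
  have hT := h𝒯 T hb.1
  obtain ⟨q, hq, hqa, hqp⟩ := exists_third hT.2 a p
  obtain ⟨T', hT', hne, ha', hq'⟩ :=
    exists_neighbor_of_vertex h𝒯 hT.1 hT.2 ha hq hqa.symm hdom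
  refine hne (hb.2.2 T' hT' ?_)
  rintro b ⟨hbT, hbp⟩
  rcases (isTriangle_of_mem_faces hT.1 hT.2).eq_of_mem ha hq hb.2.1 hqa.symm hap.symm hqp.symm hbT
    with rfl | rfl | rfl
  exacts [ha', hq', absurd rfl hbp]

/-! ### Piecewise smooth functions -/

/-- Restricted to a segment, `g` agrees with one of finitely many Lipschitz functions at points
accumulating at any given `t` from the right. This bounds the lower right slope of `g`, and a mean
value inequality finishes. -/
theorem lipschitzWith_of_selection {ι E : Type*} [NormedAddCommGroup E] [NormedSpace ℝ E]
    {s : Finset ι} {f : ι → E → ℝ} {C : NNReal}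
    (hf : ∀ i ∈ s, LipschitzWith C (f i)) {g : E → ℝ} (hg : Continuous g)
    (h : ∀ x, ∃ i ∈ s, g x = f i x) : LipschitzWith C g := by
  have key : ∀ x y : E, g y - g x ≤ C * ‖y - x‖ := by
    intro x y
    let ℓ : ℝ → E := fun t => x + t • (y - x)
    have hℓ : Continuous ℓ := by fun_prop
    have := image_le_of_liminf_slope_right_le_deriv_boundary (a := 0) (b := 1)
      (f := fun t => g (ℓ t) - g x) (B := fun t => C * ‖y - x‖ * t)
      (B' := fun _ => C * ‖y - x‖) ((hg.comp hℓ).sub continuous_const).continuousOn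
      (by simp [ℓ]) (by fun_prop)
      (fun t _ => by simpa using ((hasDerivAt_id t).const_mul (C * ‖y - x‖)).hasDerivWithinAt) ?_
      (right_mem_Icc.2 zero_le_one)
    · simpa [ℓ] using this
    · intro t _ r hr
      obtain ⟨i, hi, hfr⟩ : ∃ i ∈ s, ∃ᶠ z in 𝓝[>] t, g (ℓ z) = f i (ℓ z) := by
        by_contra! hcon
        have : ∀ᶠ z in 𝓝[>] t, ∀ i ∈ s, g (ℓ z) ≠ f i (ℓ z) :=
          (Finset.eventually_all s).2 fun i hi => hcon i hi
        obtain ⟨z, hz⟩ := this.exists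
        obtain ⟨i, hi, h'⟩ := h (ℓ z)
        exact hz i hi h'
      have hcl : IsClosed {z | g (ℓ z) = f i (ℓ z)} :=
        isClosed_eq (hg.comp hℓ) ((hf i hi).continuous.comp hℓ)
      -- The set of agreement is closed, so the selected piece also agrees at `t`, and its
      -- difference quotients there are those of `g`.
      have ht : g (ℓ t) = f i (ℓ t) :=
        hcl.closure_subset (mem_closure_iff_frequently.2 (hfr.filter_mono nhdsWithin_le_nhds))
      refine (hfr.and_eventually self_mem_nhdsWithin).mono ?_
      rintro z ⟨hz, hzt⟩
      have hzt : 0 < z - t := sub_pos.2 hzt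
      refine lt_of_le_of_lt ?_ hr
      rw [slope_def_field, div_le_iff₀ hzt]
      have h1 := (hf i hi).dist_le_mul (ℓ z) (ℓ t)
      have h2 : dist (ℓ z) (ℓ t) = ‖y - x‖ * (z - t) := by
        rw [dist_eq_norm]
        have : ℓ z - ℓ t = (z - t) • (y - x) := by simp only [ℓ]; module
        rw [this, norm_smul, Real.norm_of_nonneg hzt.le, mul_comm]
      rw [h2, Real.dist_eq] at h1
      rw [hz, ht]
      linarith [le_abs_self (f i (ℓ z) - f i (ℓ t))]
  refine LipschitzWith.of_dist_le_mul fun x y => ?_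
  rw [Real.dist_eq, dist_eq_norm, abs_le]
  constructor
  · have := key x y
    rw [norm_sub_rev] at this
    linarith
  · exact key y x

theorem integral_lineDeriv_eq_zero {g : Plane → ℝ} {C : NNReal} (hg : LipschitzWith C g)
    (hc : HasCompactSupport g) (e : Plane) : ∫ x, lineDeriv ℝ g x e = 0 := by
  have := LipschitzWith.integral_lineDeriv_mul_eq (μ := volume) (f := fun _ : Plane => (1 : ℝ))
    (LipschitzWith.const 1 : LipschitzWith 0 _) hg hc (-e)
  simpa [lineDeriv] using this.symm

/-! ### Continuous piecewise smooth functions and membership in `H¹`. -/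

section Piecewise

variable {𝒯 : Finset (Finset Plane)}

theorem domain_subset (𝒯 : Finset (Finset Plane)) : domain 𝒯 ⊆ ⋃ T ∈ 𝒯, cell T := interior_subset

theorem isOpen_domain (𝒯 : Finset (Finset Plane)) : IsOpen (domain 𝒯) := isOpen_interior

theorem interior_cell_subset_domain {T : Finset Plane} (hT : T ∈ 𝒯) :
    interior (cell T) ⊆ domain 𝒯 :=
  interior_mono (subset_iUnion₂_of_subset T hT subset_rfl)

theorem isBounded_domain (𝒯 : Finset (Finset Plane)) : Bornology.IsBounded (domain 𝒯) :=
  ((Bornology.isBounded_biUnion_finset 𝒯).2 fun T _ => (isCompact_cell T).isBounded).subset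
    (domain_subset 𝒯)

instance isFiniteMeasure_domain (𝒯 : Finset (Finset Plane)) :
    IsFiniteMeasure ((volume : Measure Plane).restrict (domain 𝒯)) :=
  isFiniteMeasure_restrict.2 (isBounded_domain 𝒯).measure_lt_top.ne

theorem ae_mem_interior_cell (𝒯 : Finset (Finset Plane)) :
    ∀ᵐ x ∂(volume : Measure Plane).restrict (domain 𝒯), ∃ T ∈ 𝒯, x ∈ interior (cell T) := by
  rw [ae_restrict_iff' (isOpen_domain 𝒯).measurableSet]
  have : ∀ᵐ x ∂(volume : Measure Plane), ∀ T ∈ 𝒯, x ∉ frontier (cell T) :=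
    (Finset.eventually_all 𝒯).2 fun T _ =>
      measure_eq_zero_iff_ae_notMem.1 ((convex_convexHull ℝ _).addHaar_frontier volume)
  filter_upwards [this] with x hx hxU
  have := domain_subset 𝒯 hxU
  simp only [mem_iUnion, exists_prop] at this
  obtain ⟨T, hT, hxT⟩ := this
  refine ⟨T, hT, ?_⟩
  by_contra hcon
  exact hx T hT ((isClosed_cell T).frontier_eq ▸ ⟨hxT, hcon⟩)

theorem exists_bound_of_piecewise {Q : Finset Plane → Plane → Plane}
    (hQ : ∀ T ∈ 𝒯, ContDiff ℝ ∞ (Q T)) :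
    ∃ C, ∀ T ∈ 𝒯, ∀ x ∈ cell T, ‖Q T x‖ ≤ C ∧ ‖fderiv ℝ (Q T) x‖ ≤ C := by
  have : ∀ T ∈ 𝒯, ∃ C, ∀ x ∈ cell T, ‖Q T x‖ ≤ C ∧ ‖fderiv ℝ (Q T) x‖ ≤ C := by
    intro T hT
    obtain ⟨C, hC⟩ := (isCompact_cell T).exists_bound_of_continuousOn
      (hQ T hT).continuous.continuousOn
    obtain ⟨C', hC'⟩ := (isCompact_cell T).exists_bound_of_continuousOn
      ((hQ T hT).continuous_fderiv (by simp)).continuousOn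
    exact ⟨max C C', fun x hx => ⟨(hC x hx).trans (le_max_left _ _),
      (hC' x hx).trans (le_max_right _ _)⟩⟩
  choose! C hC using this
  obtain ⟨M, hM⟩ := (𝒯.image C).exists_le
  refine ⟨M, fun T hT x hx => ?_⟩
  have := hM (C T) (Finset.mem_image_of_mem C hT)
  exact ⟨((hC T hT x hx).1).trans this, ((hC T hT x hx).2).trans this⟩

variable {Q : Finset Plane → Plane → Plane} (hQ : ∀ T ∈ 𝒯, ContDiff ℝ ∞ (Q T))
  {v : Plane → Plane} (hv : ∀ T ∈ 𝒯, ∀ x ∈ cell T, x ∈ domain 𝒯 → v x = Q T x)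
include hv

theorem eventuallyEq_of_mem_interior_cell {T : Finset Plane} (hT : T ∈ 𝒯) {x : Plane}
    (hx : x ∈ interior (cell T)) : v =ᶠ[𝓝 x] Q T := by
  filter_upwards [isOpen_interior.mem_nhds hx] with y hy
  exact hv T hT y (interior_subset hy) (interior_cell_subset_domain hT hy)

include hQ

/-- Near `x` only the finitely many closed cells containing `x` occur, and all their pieces take the
value `v x` at `x`. -/
theorem continuousAt_of_piecewise {x : Plane} (hx : x ∈ domain 𝒯) : ContinuousAt v x := by
  have hev : ∀ᶠ y in 𝓝 x, ∀ T ∈ 𝒯, x ∉ cell T → y ∉ cell T :=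
    (Finset.eventually_all 𝒯).2 fun T _ => by
      by_cases h : x ∈ cell T
      · simp [h]
      · filter_upwards [(isClosed_cell T).isOpen_compl.mem_nhds h] with y hy _ using hy
  rw [ContinuousAt, Metric.tendsto_nhds]
  intro ε hε
  have hev' : ∀ᶠ y in 𝓝 x, ∀ T ∈ 𝒯, dist (Q T y) (Q T x) < ε :=
    (Finset.eventually_all 𝒯).2 fun T hT =>
      Metric.tendsto_nhds.1 (hQ T hT).continuous.continuousAt ε hε
  filter_upwards [hev, hev', (isOpen_domain 𝒯).mem_nhds hx] with y h1 h2 h3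
  have := domain_subset 𝒯 h3
  simp only [mem_iUnion, exists_prop] at this
  obtain ⟨T, hT, hyT⟩ := this
  have hxT : x ∈ cell T := by_contra fun h => h1 T hT h hyT
  rw [hv T hT y hyT h3, hv T hT x hxT hx]
  exact h2 T hT

/-- A continuous piecewise smooth function is an `H¹` function. -/
theorem memH1_of_piecewise : MemH1 (domain 𝒯) v := by
  obtain ⟨C, hC⟩ := exists_bound_of_piecewise hQ
  have hvc : ContinuousOn v (domain 𝒯) := fun x hx =>
    (continuousAt_of_piecewise hQ hv hx).continuousWithinAt
  have hvm : AEStronglyMeasurable v (volume.restrict (domain 𝒯)) :=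
    hvc.aestronglyMeasurable (isOpen_domain 𝒯).measurableSet
  have hvb : ∀ᵐ x ∂(volume : Measure Plane).restrict (domain 𝒯), ‖v x‖ ≤ C := by
    filter_upwards [ae_mem_interior_cell 𝒯] with x ⟨T, hT, hx⟩
    rw [(eventuallyEq_of_mem_interior_cell hv hT hx).eq_of_nhds]
    exact (hC T hT x (interior_subset hx)).1
  have hGm : ∀ e : Plane, AEStronglyMeasurable (fun x => fderiv ℝ v x e)
      ((volume : Measure Plane).restrict (domain 𝒯)) := fun e =>
    (measurable_fderiv_apply_const ℝ v e).aestronglyMeasurable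
  have hGb : ∀ e : Plane, ∀ᵐ x ∂(volume : Measure Plane).restrict (domain 𝒯),
      ‖fderiv ℝ v x e‖ ≤ C * ‖e‖ := fun e => by
    filter_upwards [ae_mem_interior_cell 𝒯] with x ⟨T, hT, hx⟩
    rw [(eventuallyEq_of_mem_interior_cell hv hT hx).fderiv_eq]
    exact ((fderiv ℝ (Q T) x).le_opNorm e).trans
      (by gcongr; exact (hC T hT x (interior_subset hx)).2)
  refine ⟨MemLp.of_bound hvm C hvb, fun j x => fderiv ℝ v x (EuclideanSpace.single j 1),
    fun j => MemLp.of_bound (hGm _) _ (hGb _), ?_⟩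
  intro φ hφ hφc hφU j
  set e : Plane := EuclideanSpace.single j 1
  have hφd : Continuous fun x => fderiv ℝ φ x e :=
    (hφ.continuous_fderiv (by simp)).clm_apply continuous_const
  obtain ⟨M, hM⟩ := hφc.exists_bound_of_continuous hφ.continuous
  obtain ⟨M', hM'⟩ := (hφc.fderiv_apply ℝ e).exists_bound_of_continuous hφd
  have hM0 : 0 ≤ M := (norm_nonneg _).trans (hM 0)
  have hM0' : 0 ≤ M' := (norm_nonneg _).trans (hM' 0)
  have hI1 : Integrable (fun x => fderiv ℝ φ x e • v x)
      ((volume : Measure Plane).restrict (domain 𝒯)) := by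
    refine Integrable.of_bound (hφd.aestronglyMeasurable.smul hvm) (M' * C) ?_
    filter_upwards [hvb] with x hx
    rw [norm_smul]
    exact mul_le_mul (hM' x) hx (norm_nonneg _) hM0'
  have hI2 : Integrable (fun x => φ x • fderiv ℝ v x e)
      ((volume : Measure Plane).restrict (domain 𝒯)) := by
    refine Integrable.of_bound (hφ.continuous.aestronglyMeasurable.smul (hGm e)) (M * (C * ‖e‖)) ?_
    filter_upwards [hGb e] with x hx
    rw [norm_smul]
    exact mul_le_mul (hM x) hx (norm_nonneg _) hM0
  rw [eq_neg_iff_add_eq_zero, ← integral_add hI1 hI2]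
  ext i
  have hproj := (EuclideanSpace.proj (𝕜 := ℝ) i : Plane →L[ℝ] ℝ).integral_comp_comm (hI1.add hI2)
  change (EuclideanSpace.proj (𝕜 := ℝ) i : Plane →L[ℝ] ℝ) _ = 0
  refine hproj.symm.trans ?_
  -- The weak derivative formula says that the derivative of `φ vᵢ` has integral zero. This holds
  -- once the product, extended by zero, is known to be globally Lipschitz.
  set g : Plane → ℝ := fun x => φ x * v x i
  have hg0 : ∀ x, x ∉ tsupport φ → g =ᶠ[𝓝 x] 0 := fun x hx => by
    filter_upwards [(isClosed_tsupport φ).isOpen_compl.mem_nhds hx] with y hy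
    simp [g, image_eq_zero_of_notMem_tsupport hy]
  have hgc : Continuous g := by
    refine continuous_iff_continuousAt.2 fun x => ?_
    by_cases hx : x ∈ tsupport φ
    · have h1 := continuousAt_of_piecewise hQ hv (hφU hx)
      have h2 : ContinuousAt (fun y => v y i) x :=
        (EuclideanSpace.proj (𝕜 := ℝ) i : Plane →L[ℝ] ℝ).continuous.continuousAt.comp h1
      exact hφ.continuous.continuousAt.mul h2
    · exact continuousAt_const.congr (hg0 x hx).symm
  have hgs : HasCompactSupport g := hφc.mul_right
  obtain ⟨L, hL⟩ : ∃ L, LipschitzWith L g := by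
    have hsm : ∀ T ∈ 𝒯, ∃ L, LipschitzWith L fun x => φ x * Q T x i := by
      intro T hT
      have h1 : ContDiff ℝ ∞ fun x => Q T x i :=
        (EuclideanSpace.proj (𝕜 := ℝ) i : Plane →L[ℝ] ℝ).contDiff.comp (hQ T hT)
      exact ContDiff.lipschitzWith_of_hasCompactSupport (f := fun x => φ x * Q T x i)
        (hφc.mul_right) (hφ.mul h1) (by simp)
    choose! L hL using hsm
    obtain ⟨M, hM⟩ := (𝒯.image L).exists_le
    -- The extra index `none` is the zero function, used outside the support of `φ`.
    refine ⟨M, lipschitzWith_of_selection (s := Finset.insertNone 𝒯)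
      (f := fun o => o.elim (fun _ => 0) fun T x => φ x * Q T x i) ?_ hgc ?_⟩
    · intro o ho
      rcases o with _ | T
      · exact (LipschitzWith.const (0 : ℝ)).weaken zero_le
      · have hT : T ∈ 𝒯 := by simpa using ho
        exact (hL T hT).weaken (hM _ (Finset.mem_image_of_mem L hT))
    · intro x
      by_cases hx : x ∈ tsupport φ
      · have := domain_subset 𝒯 (hφU hx)
        simp only [mem_iUnion, exists_prop] at this
        obtain ⟨T, hT, hxT⟩ := this
        exact ⟨some T, by simpa using hT, by simp [g, hv T hT x hxT (hφU hx)]⟩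
      · exact ⟨none, by simp, (hg0 x hx).eq_of_nhds⟩
  have hint := integral_lineDeriv_eq_zero hL hgs e
  rw [← setIntegral_eq_integral_of_forall_compl_eq_zero (s := domain 𝒯)] at hint
  · rw [← hint]
    refine integral_congr_ae ?_
    filter_upwards [ae_mem_interior_cell 𝒯] with x ⟨T, hT, hx⟩
    have hev := eventuallyEq_of_mem_interior_cell hv hT hx
    have hdv : DifferentiableAt ℝ v x :=
      (((hQ T hT).differentiable (by simp)) x).congr_of_eventuallyEq hev
    have hdφ : DifferentiableAt ℝ φ x := hφ.differentiable (by simp) x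
    have hvi : HasFDerivAt (fun y => v y i)
        ((EuclideanSpace.proj (𝕜 := ℝ) i : Plane →L[ℝ] ℝ).comp (fderiv ℝ v x)) x :=
      (EuclideanSpace.proj (𝕜 := ℝ) i : Plane →L[ℝ] ℝ).hasFDerivAt.comp x hdv.hasFDerivAt
    have hgd := hdφ.hasFDerivAt.mul hvi
    have hgl : lineDeriv ℝ g x e = _ := (hgd.hasLineDerivAt e).lineDeriv
    rw [hgl]
    simp
    ring
  · intro x hx
    have : lineDeriv ℝ g x e = lineDeriv ℝ (0 : Plane → ℝ) x e :=
      (hg0 x fun h => hx (hφU h)).lineDeriv_eq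
    rw [this]
    simp [lineDeriv]

end Piecewise

/-! ### Edges -/

theorem edge_eq_segment {T : Finset Plane} {a b p : Plane} (hap : a ≠ p) (hbp : b ≠ p)
    (h : T = {a, b, p}) : edge T p = segment ℝ a b := by
  have : (T : Set Plane) \ {p} = {a, b} := by
    ext x; simp [h]
    constructor
    · tauto
    · rintro (rfl | rfl) <;> tauto
  rw [edge, this, convexHull_pair]

theorem edgeLength_eq {T : Finset Plane} {a b p : Plane} (hap : a ≠ p) (hbp : b ≠ p)
    (h : T = {a, b, p}) : edgeLength T p = ‖b - a‖ := by
  rw [edgeLength, edge_eq_segment hap hbp h, ← convexHull_pair, convexHull_diam, Metric.diam_pair,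
    dist_eq_norm, norm_sub_rev]

theorem edge_subset_cell (T : Finset Plane) (p : Plane) : edge T p ⊆ cell T :=
  convexHull_mono sdiff_subset

/-- Arc-length parametrization is an isometry, so it carries Lebesgue measure on the line to
one-dimensional Hausdorff measure. -/
theorem edgeIntegral_eq {T : Finset Plane} {a b p : Plane} (hab : a ≠ b) (hap : a ≠ p)
    (hbp : b ≠ p) (h : T = {a, b, p}) (q : Plane → ℝ) :
    edgeIntegral T p q = ‖b - a‖ * ∫ t in (0 : ℝ)..1, q (a + t • (b - a)) := by
  set L := ‖b - a‖
  have hL : 0 < L := norm_pos_iff.2 (sub_ne_zero.2 hab.symm)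
  let ι : ℝ → Plane := fun s => a + s • dir a b
  have hι : Isometry ι := Isometry.of_dist_eq fun s t => by
    have : ι s - ι t = (s - t) • dir a b := by simp only [ι]; module
    rw [dist_eq_norm, this, norm_smul, norm_dir hab.symm, mul_one, Real.dist_eq, Real.norm_eq_abs]
  have hLd : ∀ t : ℝ, (L * t) • dir a b = t • (b - a) := fun t => by
    rw [dir, smul_smul]
    congr 1
    change L * t * L⁻¹ = t
    field_simp
  have himg : edge T p = ι '' Icc 0 L := by
    rw [edge_eq_segment hap hbp h, segment_eq_image']
    ext x
    constructor
    · rintro ⟨t, ⟨h0, h1⟩, rfl⟩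
      exact ⟨L * t, ⟨by positivity, by nlinarith⟩, by simp only [ι, hLd]⟩
    · rintro ⟨s, ⟨h0, h1⟩, rfl⟩
      refine ⟨s / L, ⟨by positivity, by rw [div_le_one hL]; exact h1⟩, ?_⟩
      simp only [ι, ← hLd, mul_div_cancel₀ s hL.ne']
  have hemb : MeasurableEmbedding ι := hι.isClosedEmbedding.measurableEmbedding
  have hmap := hι.map_hausdorffMeasure (d := 1) (.inl zero_le_one)
  rw [hausdorffMeasure_real] at hmap
  have h1 : edgeIntegral T p q = ∫ s in Icc 0 L, q (ι s) := by
    have h2 := hemb.setIntegral_map (μ := volume) q (edge T p)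
    rw [himg, preimage_image_eq _ hι.injective] at h2
    rw [edgeIntegral, himg, ← h2, hmap, Measure.restrict_restrict_of_subset (image_subset_range _ _)]
  rw [h1, integral_Icc_eq_integral_Ioc, ← intervalIntegral.integral_of_le hL.le]
  have h3 := intervalIntegral.smul_integral_comp_mul_left (a := 0) (b := 1) (fun s => q (ι s)) L
  rw [mul_zero, mul_one, smul_eq_mul] at h3
  rw [← h3]
  simp only [ι, hLd]

theorem mem_edge_iff {T : Finset Plane} {a b p : Plane} (hap : a ≠ p) (hbp : b ≠ p)
    (h : T = {a, b, p}) {x : Plane} :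
    x ∈ edge T p ↔ ∃ t ∈ Icc (0 : ℝ) 1, x = a + t • (b - a) := by
  rw [edge_eq_segment hap hbp h, segment_eq_image']
  simp only [mem_image, eq_comm]

theorem edgeIntegral_congr {T : Finset Plane} {p : Plane} {f g : Plane → ℝ}
    (h : ∀ x ∈ edge T p, f x = g x) : edgeIntegral T p f = edgeIntegral T p g := by
  have hc : IsCompact (edge T p) :=
    Set.Finite.isCompact_convexHull ℝ (T.finite_toSet.subset sdiff_subset)
  exact setIntegral_congr_fun hc.isClosed.measurableSet h

theorem edgeIntegral_nonneg {T : Finset Plane} {p : Plane} {f : Plane → ℝ} (h : ∀ x, 0 ≤ f x) :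
    0 ≤ edgeIntegral T p f := integral_nonneg h

theorem edgeIntegral_le {T : Finset Plane} (hT : IsTriangle T) {p : Plane} (hp : p ∈ T)
    {f : Plane → ℝ} {C : ℝ} (h : ∀ x ∈ edge T p, |f x| ≤ C) :
    edgeIntegral T p f ≤ edgeLength T p * C := by
  obtain ⟨a, b, hab, hap, hbp, hT'⟩ := hT.exists_eq hp
  rw [edgeIntegral_eq hab hap hbp hT', edgeLength_eq hap hbp hT']
  refine mul_le_mul_of_nonneg_left ?_ (norm_nonneg _)
  have := intervalIntegral.norm_integral_le_of_norm_le_const (a := 0) (b := 1) (C := C)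
    (f := fun t => f (a + t • (b - a))) fun t ht => by
      rw [uIoc_of_le zero_le_one] at ht
      exact h _ ((mem_edge_iff hap hbp hT').2 ⟨t, ⟨ht.1.le, ht.2⟩, rfl⟩)
  rw [sub_zero, abs_one, mul_one] at this
  exact (le_abs_self _).trans this

theorem IsQuadraticOn.exists_coeff {D : Set Plane} {f : Plane → ℝ} (hf : IsQuadraticOn D f)
    (a u : Plane) : ∃ c₀ c₁ c₂ : ℝ, ∀ t : ℝ, a + t • u ∈ D →
      f (a + t • u) = c₀ + c₁ * t + c₂ * t ^ 2 := by
  obtain ⟨P, hP, h⟩ := hf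
  let ℓ : Fin 2 → Polynomial ℝ := fun i => Polynomial.C (a i) + Polynomial.C (u i) * Polynomial.X
  have hdeg : (MvPolynomial.aeval ℓ P).natDegree ≤ 2 * 1 :=
    MvPolynomial.aeval_natDegree_le P hP ℓ fun i => by
      simp only [ℓ]
      compute_degree
  set R := MvPolynomial.aeval ℓ P
  refine ⟨R.coeff 0, R.coeff 1, R.coeff 2, fun t ht => ?_⟩
  rw [h _ ht]
  have h1 : R.eval t = MvPolynomial.eval (fun i => (a + t • u) i) P := by
    have h2 : (Polynomial.evalRingHom t).comp (MvPolynomial.aeval ℓ).toRingHom =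
        MvPolynomial.eval (fun i => (a + t • u) i) := by
      refine MvPolynomial.ringHom_ext (fun r => ?_) (fun i => ?_)
      · simp
      · simp [ℓ]; ring
    exact congrArg (fun φ => φ P) h2
  rw [← h1, Polynomial.eval_eq_sum_range' (n := 3) (by omega)]
  simp [Finset.sum_range_succ]

/-- The midpoint of the edge of `T` opposite to `p`. -/
noncomputable def mid (T : Finset Plane) (p : Plane) : Plane := by
  classical exact (2 : ℝ)⁻¹ • ∑ a ∈ T.erase p, a

open Classical in
/-- The sum of squares of the nodal values on the edge of `T` opposite to `p`. -/
noncomputable def nodeSq (μ : Plane → ℝ) (T : Finset Plane) (p : Plane) : ℝ :=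
  ∑ a ∈ T.erase p, μ a ^ 2 + μ (mid T p) ^ 2

open Classical in
theorem erase_eq_pair {T : Finset Plane} {a b p : Plane} (hap : a ≠ p) (hbp : b ≠ p)
    (h : T = {a, b, p}) : T.erase p = {a, b} := by
  ext x; simp [h]
  constructor
  · tauto
  · rintro (rfl | rfl) <;> tauto

theorem mid_eq {T : Finset Plane} {a b p : Plane} (hab : a ≠ b) (hap : a ≠ p) (hbp : b ≠ p)
    (h : T = {a, b, p}) : mid T p = a + (2⁻¹ : ℝ) • (b - a) := by
  rw [mid, erase_eq_pair hap hbp h, Finset.sum_pair hab]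
  module

/-- Quadratic interpolation on an edge. -/
theorem IsQuadraticOn.eq_interpolation {T : Finset Plane} {a b p : Plane} (hab : a ≠ b)
    (hap : a ≠ p) (hbp : b ≠ p) (h : T = {a, b, p}) {μ : Plane → ℝ}
    (hμ : IsQuadraticOn (edge T p) μ) {t : ℝ} (ht : t ∈ Icc (0 : ℝ) 1) :
    μ (a + t • (b - a)) = μ a * ((1 - t) * (2 * (1 - t) - 1)) + μ b * (t * (2 * t - 1)) +
      μ (mid T p) * (4 * ((1 - t) * t)) := by
  obtain ⟨c₀, c₁, c₂, hc⟩ := hμ.exists_coeff a (b - a)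
  have hmem : ∀ s ∈ Icc (0 : ℝ) 1, a + s • (b - a) ∈ edge T p := fun s hs =>
    (mem_edge_iff hap hbp h).2 ⟨s, hs, rfl⟩
  have h0 := hc 0 (hmem 0 (by simp))
  have h1 := hc 1 (hmem 1 (by simp))
  have h2 := hc 2⁻¹ (hmem 2⁻¹ (by norm_num))
  rw [← mid_eq hab hap hbp h] at h2
  rw [zero_smul, add_zero] at h0
  rw [one_smul, add_sub_cancel] at h1
  rw [hc t (hmem t ht), h0, h1, h2]
  ring

theorem nodeSq_le_edgeIntegral {T : Finset Plane} (hT : IsTriangle T) {p : Plane} (hp : p ∈ T)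
    {μ : Plane → ℝ} (hμ : IsQuadraticOn (edge T p) μ) :
    edgeLength T p * nodeSq μ T p ≤ 30 * edgeIntegral T p fun x => μ x ^ 2 := by
  obtain ⟨a, b, hab, hap, hbp, h⟩ := hT.exists_eq hp
  rw [edgeIntegral_eq hab hap hbp h, edgeLength_eq hap hbp h, nodeSq, erase_eq_pair hap hbp h,
    Finset.sum_pair hab, mul_left_comm]
  refine mul_le_mul_of_nonneg_left ?_ (norm_nonneg _)
  set A := μ a
  set B := μ b
  set M := μ (mid T p)
  set c₁ := -3 * A - B + 4 * M with hc₁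
  set c₂ := 2 * A + 2 * B - 4 * M with hc₂
  have : ∫ t in (0 : ℝ)..1, μ (a + t • (b - a)) ^ 2 =
      ∫ t in (0 : ℝ)..1, (A ^ 2 + 2 * A * c₁ * t + (c₁ ^ 2 + 2 * A * c₂) * t ^ 2 +
        2 * c₁ * c₂ * t ^ 3 + c₂ ^ 2 * t ^ 4) := by
    refine intervalIntegral.integral_congr fun t ht => ?_
    rw [uIcc_of_le zero_le_one] at ht
    simp only [hμ.eq_interpolation hab hap hbp h ht]
    rw [hc₁, hc₂]
    ring
  rw [this, intervalIntegral.integral_add, intervalIntegral.integral_add,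
    intervalIntegral.integral_add, intervalIntegral.integral_add,
    intervalIntegral.integral_const_mul, intervalIntegral.integral_const_mul,
    intervalIntegral.integral_const_mul, intervalIntegral.integral_const_mul, integral_id,
    integral_pow, integral_pow, integral_pow, intervalIntegral.integral_const]
  · norm_num [hc₁, hc₂]
    -- Thirty times the integral minus the nodal squares is `(A - B)² + 2 (A + M)² + 2 (B + M)² + 11
    -- M²`.
    nlinarith [sq_nonneg (A - B), sq_nonneg (A + M), sq_nonneg (B + M), sq_nonneg M]
  all_goals exact Continuous.intervalIntegrable (by fun_prop) _ _

/-! ### Polynomials of bounded degree -/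

/-- `f` is a polynomial function of degree at most `n`. -/
def IsPolyFun (n : ℕ) (f : Plane → ℝ) : Prop :=
  ∃ P : MvPolynomial (Fin 2) ℝ, P.totalDegree ≤ n ∧
    ∀ x : Plane, f x = MvPolynomial.eval (fun i => x i) P

theorem IsPolyFun.const (c : ℝ) (n : ℕ) : IsPolyFun n fun _ => c :=
  ⟨MvPolynomial.C c, by simp, by simp⟩

theorem IsPolyFun.mono {m n : ℕ} {f : Plane → ℝ} (hf : IsPolyFun m f) (h : m ≤ n) :
    IsPolyFun n f := by
  obtain ⟨P, hP, e⟩ := hf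
  exact ⟨P, hP.trans h, e⟩

theorem IsPolyFun.add {n : ℕ} {f g : Plane → ℝ} (hf : IsPolyFun n f) (hg : IsPolyFun n g) :
    IsPolyFun n fun x => f x + g x := by
  obtain ⟨P, hP, e⟩ := hf
  obtain ⟨R, hR, e'⟩ := hg
  exact ⟨P + R, (MvPolynomial.totalDegree_add P R).trans (max_le hP hR), fun x => by
    simp only [map_add, e, e']⟩

theorem IsPolyFun.mul {m n : ℕ} {f g : Plane → ℝ} (hf : IsPolyFun m f) (hg : IsPolyFun n g) :
    IsPolyFun (m + n) fun x => f x * g x := by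
  obtain ⟨P, hP, e⟩ := hf
  obtain ⟨R, hR, e'⟩ := hg
  exact ⟨P * R, (MvPolynomial.totalDegree_mul P R).trans (add_le_add hP hR), fun x => by
    simp only [map_mul, e, e']⟩

theorem IsPolyFun.const_mul {n : ℕ} {f : Plane → ℝ} (c : ℝ) (hf : IsPolyFun n f) :
    IsPolyFun n fun x => c * f x := by
  simpa using (IsPolyFun.const c 0).mul hf

theorem IsPolyFun.sum {ι : Type*} {n : ℕ} {s : Finset ι} {f : ι → Plane → ℝ}
    (hf : ∀ i ∈ s, IsPolyFun n (f i)) : IsPolyFun n fun x => ∑ i ∈ s, f i x := by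
  classical
  induction s using Finset.induction_on with
  | empty => simpa using IsPolyFun.const 0 n
  | insert i s hi ih =>
    simp only [Finset.sum_insert hi]
    exact (hf i (by simp)).add (ih fun j hj => hf j (by simp [hj]))

theorem IsPolyFun.prod {ι : Type*} {s : Finset ι} {f : ι → Plane → ℝ}
    (hf : ∀ i ∈ s, IsPolyFun 1 (f i)) : IsPolyFun s.card fun x => ∏ i ∈ s, f i x := by
  classical
  induction s using Finset.induction_on with
  | empty => simpa using IsPolyFun.const 1 0
  | insert i s hi ih =>
    simp only [Finset.prod_insert hi, Finset.card_insert_of_notMem hi]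
    rw [add_comm]
    exact (hf i (by simp)).mul (ih fun j hj => hf j (by simp [hj]))

theorem isPolyFun_lam (T : Finset Plane) (a : Plane) : IsPolyFun 1 (lam T a) := by
  refine ⟨MvPolynomial.C (lam T a 0) +
    (MvPolynomial.C (gradLam T a (EuclideanSpace.single 0 1)) * MvPolynomial.X 0 +
      MvPolynomial.C (gradLam T a (EuclideanSpace.single 1 1)) * MvPolynomial.X 1), ?_, fun x => ?_⟩
  · have : ∀ (c : ℝ) (i : Fin 2), (MvPolynomial.C c * MvPolynomial.X i :
        MvPolynomial (Fin 2) ℝ).totalDegree ≤ 1 := fun c i =>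
      (MvPolynomial.totalDegree_mul _ _).trans (by simp)
    refine (MvPolynomial.totalDegree_add _ _).trans (max_le (by simp) ?_)
    exact (MvPolynomial.totalDegree_add _ _).trans (max_le (this _ _) (this _ _))
  · have h := lam_sub_lam T a x 0
    have hx : x = x 0 • EuclideanSpace.single 0 1 + x 1 • EuclideanSpace.single 1 (1 : ℝ) := by
      ext i; fin_cases i <;> simp
    rw [sub_zero] at h
    conv at h => rhs; rw [hx, map_add, map_smul, map_smul]
    simp only [smul_eq_mul] at h
    simp
    linarith

/-! ### Traces -/

theorem ctCell_subset_cell {T : Finset Plane} (hT : T.card = 3) (p : Plane) :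
    ctCell T p ⊆ cell T := by
  refine convexHull_min (insert_subset ?_ (sdiff_subset.trans (subset_cell T)))
    (convex_convexHull ℝ _)
  have := (convex_convexHull ℝ (T : Set Plane)).sum_mem (t := T) (w := fun _ => (3 : ℝ)⁻¹)
    (z := id) (fun _ _ => by positivity) (by simp [hT]) (fun x hx => subset_cell T hx)
  rw [barycenter, Finset.smul_sum]
  exact this

theorem edge_subset_closure_interior_ctCell {T : Finset Plane} (hT : IsTriangle T) {p : Plane}
    (hp : p ∈ T) : edge T p ⊆ closure (interior (ctCell T p)) := by
  obtain ⟨a, b, hab, hap, hbp, h⟩ := hT.exists_eq hp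
  have hsub : (T : Set Plane) \ {p} ⊆ insert (barycenter T) ((T : Set Plane) \ {p}) :=
    subset_insert _ _
  have hspan : affineSpan ℝ (insert (barycenter T) ((T : Set Plane) \ {p})) = ⊤ := by
    rw [eq_top_iff, ← hT.affineSpan_eq_top]
    refine affineSpan_le.2 fun x hx => ?_
    by_cases hxp : x = p
    · have ha : a ∈ affineSpan ℝ (insert (barycenter T) ((T : Set Plane) \ {p})) :=
        subset_affineSpan ℝ _ (hsub ⟨by simp [h], by simpa using hap⟩)
      have hb : b ∈ affineSpan ℝ (insert (barycenter T) ((T : Set Plane) \ {p})) :=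
        subset_affineSpan ℝ _ (hsub ⟨by simp [h], by simpa using hbp⟩)
      have hc : barycenter T ∈ affineSpan ℝ (insert (barycenter T) ((T : Set Plane) \ {p})) :=
        subset_affineSpan ℝ _ (mem_insert _ _)
      have hbar : barycenter T = (3 : ℝ)⁻¹ • (a + (b + p)) := by
        rw [barycenter, h, Finset.sum_insert (by simp [hab, hap]), Finset.sum_pair hbp]
      -- The missing vertex is recovered as `p = 3 c - a - b`, with `c` the barycenter.
      have h1 := AffineSubspace.smul_vsub_vadd_mem _ (3 : ℝ) hc ha ha
      have h2 := AffineSubspace.smul_vsub_vadd_mem _ (1 : ℝ) ha hb h1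
      convert! h2
      rw [hxp, hbar]
      simp only [vsub_eq_sub, vadd_eq_add]
      module
    · exact subset_affineSpan ℝ _ (hsub ⟨hx, hxp⟩)
  have hne : (interior (ctCell T p)).Nonempty :=
    interior_convexHull_nonempty_iff_affineSpan_eq_top.2 hspan
  have hconv : Convex ℝ (ctCell T p) := convex_convexHull ℝ _
  rw [hconv.closure_interior_eq_closure_of_nonempty_interior hne]
  exact (convexHull_mono hsub).trans subset_closure

theorem trace_eq {𝒯 : Finset (Finset Plane)} {Q : Finset Plane → Plane → Plane} {v : Plane → Plane}
    (hv : ∀ T ∈ 𝒯, ∀ x ∈ cell T, x ∈ domain 𝒯 → v x = Q T x) {T : Finset Plane} (hT𝒯 : T ∈ 𝒯)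
    (hT : IsTriangle T) (hQ : Continuous (Q T)) {p : Plane} (hp : p ∈ T) {x : Plane}
    (hx : x ∈ edge T p) : trace v T p x = Q T x := by
  refine extendFrom_eq (edge_subset_closure_interior_ctCell hT hp hx) ?_
  refine (hQ.continuousAt.mono_left nhdsWithin_le_nhds).congr' ?_
  filter_upwards [self_mem_nhdsWithin] with y hy
  have hy' := interior_mono (ctCell_subset_cell hT.2 p) hy
  exact (hv T hT𝒯 y (interior_subset hy') (interior_cell_subset_domain hT𝒯 hy')).symm

/-! ### The test field -/

open Classical in
/-- The piecewise quadratic field with vertex values `μ a • w a T` and with normal component `μ` at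
the midpoints of the boundary edges. -/
noncomputable def testField (𝒯 : Finset (Finset Plane)) (w : Plane → Finset Plane → Plane)
    (μ : Plane → ℝ) (T : Finset Plane) (x : Plane) : Plane :=
  ∑ a ∈ T, (μ a * (lam T a x * (2 * lam T a x - 1))) • w a T +
    ∑ p ∈ T with IsBoundaryEdge 𝒯 T p,
      (4 * μ (mid T p) * ∏ b ∈ T.erase p, lam T b x) • outwardNormal T p

open Classical in
/-- The sum of the sizes of the nodal values of `testField`. -/
noncomputable def nodeSum (𝒯 : Finset (Finset Plane)) (w : Plane → Finset Plane → Plane)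
    (μ : Plane → ℝ) (T : Finset Plane) : ℝ :=
  ∑ a ∈ T, |μ a| * ‖w a T‖ + ∑ p ∈ T with IsBoundaryEdge 𝒯 T p, |μ (mid T p)|

open Classical in
/-- The sum of the squared sizes of the nodal values of `testField`. -/
noncomputable def nodeSumSq (𝒯 : Finset (Finset Plane)) (w : Plane → Finset Plane → Plane)
    (μ : Plane → ℝ) (T : Finset Plane) : ℝ :=
  ∑ a ∈ T, μ a ^ 2 * ‖w a T‖ ^ 2 + ∑ p ∈ T with IsBoundaryEdge 𝒯 T p, μ (mid T p) ^ 2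

section TestField

variable {𝒯 : Finset (Finset Plane)} {w : Plane → Finset Plane → Plane} {μ : Plane → ℝ}

theorem nodeSumSq_nonneg (T : Finset Plane) : 0 ≤ nodeSumSq 𝒯 w μ T := by
  unfold nodeSumSq; positivity

theorem nodeSum_sq_le {T : Finset Plane} (h3 : T.card = 3) :
    nodeSum 𝒯 w μ T ^ 2 ≤ 6 * nodeSumSq 𝒯 w μ T := by
  classical
  have h1 : (∑ a ∈ T, |μ a| * ‖w a T‖) ^ 2 ≤ 3 * ∑ a ∈ T, μ a ^ 2 * ‖w a T‖ ^ 2 := by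
    have := sq_sum_le_card_mul_sum_sq (s := T) (f := fun a => |μ a| * ‖w a T‖)
    simpa [h3, mul_pow] using this
  have h2 : (∑ p ∈ T with IsBoundaryEdge 𝒯 T p, |μ (mid T p)|) ^ 2 ≤
      3 * ∑ p ∈ T with IsBoundaryEdge 𝒯 T p, μ (mid T p) ^ 2 := by
    have := sq_sum_le_card_mul_sum_sq (s := T.filter fun p => IsBoundaryEdge 𝒯 T p)
      (f := fun p => |μ (mid T p)|)
    simp only [sq_abs] at this
    refine this.trans (mul_le_mul_of_nonneg_right ?_ (Finset.sum_nonneg fun _ _ => sq_nonneg _))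
    exact_mod_cast (Finset.card_filter_le _ _).trans h3.le
  unfold nodeSum nodeSumSq
  have := add_sq_le (a := ∑ a ∈ T, |μ a| * ‖w a T‖)
    (b := ∑ p ∈ T with IsBoundaryEdge 𝒯 T p, |μ (mid T p)|)
  linarith

theorem contDiff_testField (𝒯 : Finset (Finset Plane)) (w : Plane → Finset Plane → Plane)
    (μ : Plane → ℝ) (T : Finset Plane) : ContDiff ℝ ∞ (testField 𝒯 w μ T) := by
  classical
  refine ContDiff.add (ContDiff.sum fun a _ => ?_) (ContDiff.sum fun p _ => ?_)
  · exact ContDiff.smul (contDiff_const.mul ((contDiff_lam T a).mul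
      ((contDiff_const.mul (contDiff_lam T a)).sub contDiff_const))) contDiff_const
  · exact ContDiff.smul (contDiff_const.mul (contDiff_prod fun b _ => contDiff_lam T b))
      contDiff_const

theorem isPolyFun_testField {T : Finset Plane} (h3 : T.card = 3) (i : Fin 2) :
    IsPolyFun 2 fun x => testField 𝒯 w μ T x i := by
  classical
  have h1 : ∀ a ∈ T, IsPolyFun 2 fun x =>
      w a T i * (μ a * (lam T a x * (2 * lam T a x + -1))) := fun a _ =>
    ((((isPolyFun_lam T a).mul (((isPolyFun_lam T a).const_mul 2).add
      (IsPolyFun.const (-1) 1))).const_mul (μ a)).const_mul (w a T i))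
  have h2 : ∀ p ∈ T.filter fun p => IsBoundaryEdge 𝒯 T p, IsPolyFun 2 fun x =>
      outwardNormal T p i * (4 * μ (mid T p) * ∏ b ∈ T.erase p, lam T b x) := fun p hp => by
    have hp := (Finset.mem_filter.1 hp).1
    refine (IsPolyFun.const_mul _ ?_).const_mul _
    exact (IsPolyFun.prod fun b _ => isPolyFun_lam T b).mono
      (by rw [Finset.card_erase_of_mem hp, h3])
  obtain ⟨P, hP, e⟩ := (IsPolyFun.sum h1).add (IsPolyFun.sum h2)
  refine ⟨P, hP, fun x => ?_⟩
  rw [← e x]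
  simp only [testField, PiLp.add_apply, WithLp.ofLp_sum, Finset.sum_apply, PiLp.smul_apply,
    smul_eq_mul, sub_eq_add_neg]
  congr 1 <;> exact Finset.sum_congr rfl fun _ _ => mul_comm _ _

theorem prod_lam_eq {T : Finset Plane} {p a b : Plane} (hab : a ≠ b) (hap : a ≠ p) (hbp : b ≠ p)
    (h : T = {a, b, p}) (x : Plane) [DecidableEq Plane] :
    ∏ c ∈ T.erase p, lam T c x = lam T a x * lam T b x := by
  have : T.erase p = {a, b} := by
    ext x; simp [h]
    constructor
    · tauto
    · rintro (rfl | rfl) <;> tauto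
  rw [this, Finset.prod_pair hab]

section Bounds

variable {T : Finset Plane} (hT : IsTriangle T)
include hT

theorem norm_testField_le {x : Plane} (hx : x ∈ cell T) :
    ‖testField 𝒯 w μ T x‖ ≤ 4 * nodeSum 𝒯 w μ T := by
  classical
  have h0 : ∀ a ∈ T, 0 ≤ lam T a x := (mem_cell_iff hT).1 hx
  have h1 : ∀ a ∈ T, lam T a x ≤ 1 := fun a ha => lam_le_one hT ha hx
  rw [nodeSum, mul_add, Finset.mul_sum, Finset.mul_sum]
  refine (norm_add_le _ _).trans (add_le_add ((norm_sum_le _ _).trans (Finset.sum_le_sum ?_))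
    ((norm_sum_le _ _).trans (Finset.sum_le_sum ?_)))
  · intro a ha
    have hl : |lam T a x * (2 * lam T a x - 1)| ≤ 4 := by
      rw [abs_le]; constructor <;> nlinarith [h0 a ha, h1 a ha]
    rw [norm_smul, Real.norm_eq_abs, abs_mul]
    calc |μ a| * |lam T a x * (2 * lam T a x - 1)| * ‖w a T‖ ≤ |μ a| * 4 * ‖w a T‖ := by gcongr
      _ = 4 * (|μ a| * ‖w a T‖) := by ring
  · intro p hp
    have hp := (Finset.mem_filter.1 hp).1
    have hl0 : 0 ≤ ∏ b ∈ T.erase p, lam T b x :=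
      Finset.prod_nonneg fun b hb => h0 b (Finset.mem_of_mem_erase hb)
    have hl1 : ∏ b ∈ T.erase p, lam T b x ≤ 1 :=
      Finset.prod_le_one (fun b hb => h0 b (Finset.mem_of_mem_erase hb))
        fun b hb => h1 b (Finset.mem_of_mem_erase hb)
    rw [norm_smul, (hT.outwardNormal_spec hp).1, mul_one, Real.norm_eq_abs, abs_mul, abs_mul,
      abs_of_nonneg hl0, abs_of_pos (by norm_num : (0 : ℝ) < 4)]
    exact mul_le_of_le_one_right (by positivity) hl1

theorem norm_fderiv_testField_le {γ : ℝ} (hγ : 0 < γ) (hf : IsFat γ T) {x : Plane}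
    (hx : x ∈ cell T) : ‖fderiv ℝ (testField 𝒯 w μ T) x‖ ≤
      8 * (2 * γ * Metric.diam (cell T))⁻¹ * nodeSum 𝒯 w μ T := by
  classical
  set g := (2 * γ * Metric.diam (cell T))⁻¹
  have hg : 0 < g := inv_pos.2 (by have := hT.diam_pos; positivity)
  have h0 : ∀ a ∈ T, 0 ≤ lam T a x := (mem_cell_iff hT).1 hx
  have h1 : ∀ a ∈ T, lam T a x ≤ 1 := fun a ha => lam_le_one hT ha hx
  have hG : ∀ a ∈ T, ‖gradLam T a‖ ≤ g := fun a ha => norm_gradLam_le hT hγ hf ha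
  have key : ∀ (f : Plane → ℝ) (f' : Plane →L[ℝ] ℝ) (k c : ℝ) (u : Plane), HasFDerivAt f f' x →
      ‖f'‖ ≤ c → ∃ F : Plane →L[ℝ] Plane, HasFDerivAt (fun y => (k * f y) • u) F x ∧
        ‖F‖ ≤ |k| * c * ‖u‖ := by
    intro f f' k c u h hc
    refine ⟨_, (h.const_mul k).smul_const u, ?_⟩
    rw [ContinuousLinearMap.norm_smulRight_apply, norm_smul, Real.norm_eq_abs]
    gcongr
  have hA : ∀ a ∈ T, ∃ F : Plane →L[ℝ] Plane,
      HasFDerivAt (fun y => (μ a * (lam T a y * (2 * lam T a y - 1))) • w a T) F x ∧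
        ‖F‖ ≤ 8 * g * (|μ a| * ‖w a T‖) := by
    intro a ha
    have hl := hasFDerivAt_lam T a x
    obtain ⟨F, hF, hF'⟩ := key _ _ (μ a) (8 * g) (w a T)
      (hl.mul ((hl.const_mul 2).sub_const 1)) (by
        calc _ ≤ ‖lam T a x • (2 : ℝ) • gradLam T a‖ + ‖(2 * lam T a x - 1) • gradLam T a‖ :=
              norm_add_le _ _
          _ = (|lam T a x| * 2 + |2 * lam T a x - 1|) * ‖gradLam T a‖ := by
              rw [norm_smul, norm_smul, norm_smul]; simp; ring
          _ ≤ 8 * g := by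
              have e1 : |lam T a x| ≤ 1 := by
                rw [abs_le]; constructor <;> linarith [h0 a ha, h1 a ha]
              have e2 : |2 * lam T a x - 1| ≤ 1 := by
                rw [abs_le]; constructor <;> linarith [h0 a ha, h1 a ha]
              exact mul_le_mul (by linarith) (hG a ha) (norm_nonneg _) (by norm_num))
    exact ⟨F, hF, hF'.trans (by apply le_of_eq; ring)⟩
  have hB : ∀ p ∈ T.filter fun p => IsBoundaryEdge 𝒯 T p, ∃ F : Plane →L[ℝ] Plane,
      HasFDerivAt (fun y => (4 * μ (mid T p) * ∏ b ∈ T.erase p, lam T b y) •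
        outwardNormal T p) F x ∧ ‖F‖ ≤ 8 * g * |μ (mid T p)| := by
    intro p hp
    have hp := (Finset.mem_filter.1 hp).1
    obtain ⟨a, b, hab, hap, hbp, h⟩ := hT.exists_eq hp
    have ha : a ∈ T := by simp [h]
    have hb : b ∈ T := by simp [h]
    simp only [prod_lam_eq hab hap hbp h]
    obtain ⟨F, hF, hF'⟩ := key _ _ (4 * μ (mid T p)) (2 * g) (outwardNormal T p)
      ((hasFDerivAt_lam T a x).mul (hasFDerivAt_lam T b x)) (by
        calc _ ≤ ‖lam T a x • gradLam T b‖ + ‖lam T b x • gradLam T a‖ := norm_add_le _ _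
          _ = |lam T a x| * ‖gradLam T b‖ + |lam T b x| * ‖gradLam T a‖ := by
              rw [norm_smul, norm_smul, Real.norm_eq_abs, Real.norm_eq_abs]
          _ ≤ 1 * g + 1 * g := by
              have e1 : |lam T a x| ≤ 1 := by
                rw [abs_le]; constructor <;> linarith [h0 a ha, h1 a ha]
              have e2 : |lam T b x| ≤ 1 := by
                rw [abs_le]; constructor <;> linarith [h0 b hb, h1 b hb]
              gcongr
              exacts [hG b hb, hG a ha]
          _ = 2 * g := by ring)
    refine ⟨F, hF, hF'.trans (le_of_eq ?_)⟩
    rw [(hT.outwardNormal_spec hp).1, abs_mul, abs_of_pos (by norm_num : (0 : ℝ) < 4)]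
    ring
  choose! F hF hF' using hA
  choose! G hG₁ hG₂ using hB
  have hd : HasFDerivAt (testField 𝒯 w μ T)
      (∑ a ∈ T, F a + ∑ p ∈ T with IsBoundaryEdge 𝒯 T p, G p) x :=
    (HasFDerivAt.fun_sum hF).add (HasFDerivAt.fun_sum hG₁)
  rw [hd.fderiv, nodeSum, mul_add, Finset.mul_sum, Finset.mul_sum]
  exact (norm_add_le _ _).trans (add_le_add
    ((norm_sum_le _ _).trans (Finset.sum_le_sum hF'))
    ((norm_sum_le _ _).trans (Finset.sum_le_sum hG₂)))

/-- The normal component of the test field on a boundary edge is `μ`. -/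
theorem inner_testField {p : Plane} (hb : IsBoundaryEdge 𝒯 T p)
    (hw : ∀ a ∈ T, a ≠ p → inner ℝ (w a T) (outwardNormal T p) = 1)
    (hμ : IsQuadraticOn (edge T p) μ) {x : Plane} (hx : x ∈ edge T p) :
    inner ℝ (testField 𝒯 w μ T x) (outwardNormal T p) = μ x := by
  classical
  have hp := hb.2.1
  obtain ⟨a, b, hab, hap, hbp, h⟩ := hT.exists_eq hp
  have ha : a ∈ T := by simp [h]
  have hbT : b ∈ T := by simp [h]
  obtain ⟨t, ht, rfl⟩ := (mem_edge_iff hap hbp h).1 hx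
  have la : lam T a (a + t • (b - a)) = 1 - t := by
    rw [lam_add_smul_sub, lam_self hT ha, lam_of_ne hT ha hbT hab.symm]; ring
  have lb : lam T b (a + t • (b - a)) = t := by
    rw [lam_add_smul_sub, lam_self hT hbT, lam_of_ne hT hbT ha hab]; ring
  have lp : lam T p (a + t • (b - a)) = 0 := by
    rw [lam_add_smul_sub, lam_of_ne hT hp ha hap, lam_of_ne hT hp hbT hbp]; ring
  set x := a + t • (b - a)
  rw [hμ.eq_interpolation hab hap hbp h ht, testField, inner_add_left]
  have e1 : ∑ c ∈ T, (μ c * (lam T c x * (2 * lam T c x - 1))) • w c T =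
      (μ a * ((1 - t) * (2 * (1 - t) - 1))) • w a T + (μ b * (t * (2 * t - 1))) • w b T := by
    rw [← Finset.add_sum_erase T _ hp, erase_eq_pair hap hbp h, Finset.sum_pair hab, lp, la, lb]
    simp
  -- On the edge opposite to `p` the bubbles of the other edges vanish, since each has `lam T p` as
  -- a factor.
  have e2 : ∑ q ∈ T with IsBoundaryEdge 𝒯 T q,
      (4 * μ (mid T q) * ∏ c ∈ T.erase q, lam T c x) • outwardNormal T q =
      (4 * μ (mid T p) * ((1 - t) * t)) • outwardNormal T p := by
    rw [Finset.sum_eq_single p]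
    · rw [prod_lam_eq hab hap hbp h, la, lb]
    · intro q _ hqp
      rw [Finset.prod_eq_zero (Finset.mem_erase.2 ⟨hqp.symm, hp⟩) lp, mul_zero, zero_smul]
    · intro hp'
      exact absurd (Finset.mem_filter.2 ⟨hp, hb⟩) hp'
  rw [e1, e2, inner_add_left, inner_smul_left, inner_smul_left, inner_smul_left, hw a ha hap,
    hw b hbT hbp, real_inner_self_eq_norm_sq, (hT.outwardNormal_spec hp).1]
  simp only [conj_trivial]
  ring

end Bounds

/-- The pieces of the test field match at common points in the domain. -/
theorem testField_eq {K : Geometry.SimplicialComplex ℝ Plane}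
    (h𝒯 : ∀ T ∈ 𝒯, T ∈ K.faces ∧ T.card = 3)
    (hw₁ : ∀ a X Y, FanAdj 𝒯 a X Y → w a X = w a Y)
    (hw₄ : ∀ T ∈ 𝒯, ∀ a ∈ T, w a T ≠ 0 → ∃ T' p, IsBoundaryEdge 𝒯 T' p ∧ a ∈ T' ∧ a ≠ p)
    {T T' : Finset Plane} (hT : T ∈ 𝒯) (hT' : T' ∈ 𝒯) {x : Plane} (hx : x ∈ cell T)
    (hx' : x ∈ cell T') (hU : x ∈ domain 𝒯) : testField 𝒯 w μ T x = testField 𝒯 w μ T' x := by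
  classical
  by_cases hne : T = T'
  · rw [hne]
  have tri := isTriangle_of_mem_faces (h𝒯 T hT).1 (h𝒯 T hT).2
  have tri' := isTriangle_of_mem_faces (h𝒯 T' hT').1 (h𝒯 T' hT').2
  have hull := K.inter_subset_convexHull (h𝒯 T hT).1 (h𝒯 T' hT').1 ⟨hx, hx'⟩
  -- A bubble nonzero at a point shared with a second triangle would force that triangle to contain
  -- the whole boundary edge.
  have bubble : ∀ X ∈ 𝒯, ∀ Y ∈ 𝒯, X ≠ Y → x ∈ cell X → x ∈ cell Y →
      ∑ p ∈ X with IsBoundaryEdge 𝒯 X p,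
        (4 * μ (mid X p) * ∏ b ∈ X.erase p, lam X b x) • outwardNormal X p = 0 := by
    intro X hX Y hY hXY hxX hxY
    refine Finset.sum_eq_zero fun p hp => ?_
    have hb := (Finset.mem_filter.1 hp).2
    rw [mul_eq_zero_of_right, zero_smul]
    by_contra hprod
    replace hprod := Finset.prod_ne_zero_iff.1 hprod
    refine hXY (hb.2.2 Y hY ?_).symm
    rintro c ⟨hc, hcp⟩
    exact mem_of_lam_ne_zero (h𝒯 X hX).1 (h𝒯 X hX).2 (h𝒯 Y hY).1 hc hxX hxY
      (hprod c (Finset.mem_erase.2 ⟨hcp, hc⟩))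
  have restr : ∀ X ∈ 𝒯, ∀ Y ∈ 𝒯, x ∈ cell X → x ∈ cell Y →
      ∑ a ∈ X, (μ a * (lam X a x * (2 * lam X a x - 1))) • w a X =
        ∑ a ∈ X ∩ Y, (μ a * (lam X a x * (2 * lam X a x - 1))) • w a X := by
    intro X hX Y hY hxX hxY
    refine (Finset.sum_subset Finset.inter_subset_left fun a ha haY => ?_).symm
    have : lam X a x = 0 := by
      by_contra h
      exact haY (Finset.mem_inter.2 ⟨ha, mem_of_lam_ne_zero (h𝒯 X hX).1 (h𝒯 X hX).2
        (h𝒯 Y hY).1 ha hxX hxY h⟩)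
    rw [this]; simp
  unfold testField
  rw [bubble T hT T' hT' hne hx hx', bubble T' hT' T hT (Ne.symm hne) hx' hx,
    restr T hT T' hT' hx hx', restr T' hT' T hT hx' hx, Finset.inter_comm T' T]
  congr 1
  refine Finset.sum_congr rfl fun a ha => ?_
  obtain ⟨haT, haT'⟩ := Finset.mem_inter.1 ha
  rw [lam_eq_lam_of_mem_hull tri tri' inter_subset_left inter_subset_right haT haT' hull]
  congr 1
  -- If the triangles share an edge at `a`, they are in one fan and the vectors agree. If they meet
  -- only in `a`, then `x = a` is in the domain, hence on no boundary edge, and both vectors vanish.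
  by_cases hex : ∃ b, b ≠ a ∧ b ∈ T ∧ b ∈ T'
  · exact hw₁ a T T' ⟨hT, hT', haT, haT', hex⟩
  · have hsingle : (T ∩ T' : Set Plane) = {a} := by
      ext b
      constructor
      · intro hb
        by_contra hba
        exact hex ⟨b, hba, hb.1, hb.2⟩
      · rintro rfl
        exact ⟨haT, haT'⟩
    rw [hsingle, convexHull_singleton] at hull
    obtain rfl : x = a := hull
    have hzero : ∀ X ∈ 𝒯, x ∈ X → w x X = 0 := by
      intro X hX hxX
      by_contra h
      obtain ⟨Y, p, hb, hxY, hxp⟩ := hw₄ X hX x hxX h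
      exact notMem_domain_of_boundary h𝒯 hb hxY hxp hU
    rw [hzero T hT haT, hzero T' hT' haT']

end TestField

/-! ### Sums over boundary edges -/

section SumBoundary

variable {𝒯 : Finset (Finset Plane)} {f g : Finset Plane → Plane → ℝ}

open Classical in
/-- The boundary edges, as pairs of a triangle and the opposite vertex. -/
noncomputable def boundaryEdges (𝒯 : Finset (Finset Plane)) : Finset (Σ _ : Finset Plane, Plane) :=
  𝒯.sigma fun T => T.filter fun p => IsBoundaryEdge 𝒯 T p

theorem sumBoundary_eq (𝒯 : Finset (Finset Plane)) (f : Finset Plane → Plane → ℝ) :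
    sumBoundary 𝒯 f = ∑ e ∈ boundaryEdges 𝒯, f e.1 e.2 :=
  (Finset.sum_sigma (σ := fun _ : Finset Plane => Plane) _ _ fun e => f e.1 e.2).symm

theorem mem_boundaryEdges {e : Σ _ : Finset Plane, Plane} :
    e ∈ boundaryEdges 𝒯 ↔ IsBoundaryEdge 𝒯 e.1 e.2 := by
  simp only [boundaryEdges, Finset.mem_sigma, Finset.mem_filter]
  exact ⟨fun h => h.2.2, fun h => ⟨h.1, h.2.1, h⟩⟩

theorem sumBoundary_le (h : ∀ T p, IsBoundaryEdge 𝒯 T p → f T p ≤ g T p) :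
    sumBoundary 𝒯 f ≤ sumBoundary 𝒯 g := by
  rw [sumBoundary_eq, sumBoundary_eq]
  exact Finset.sum_le_sum fun e he => h _ _ (mem_boundaryEdges.1 he)

theorem sumBoundary_congr (h : ∀ T p, IsBoundaryEdge 𝒯 T p → f T p = g T p) :
    sumBoundary 𝒯 f = sumBoundary 𝒯 g :=
  le_antisymm (sumBoundary_le fun T p hb => (h T p hb).le)
    (sumBoundary_le fun T p hb => (h T p hb).ge)

theorem sumBoundary_nonneg (h : ∀ T p, IsBoundaryEdge 𝒯 T p → 0 ≤ f T p) :
    0 ≤ sumBoundary 𝒯 f := by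
  rw [sumBoundary_eq]
  exact Finset.sum_nonneg fun e he => h _ _ (mem_boundaryEdges.1 he)

theorem sumBoundary_const_mul (c : ℝ) :
    sumBoundary 𝒯 (fun T p => c * f T p) = c * sumBoundary 𝒯 f := by
  rw [sumBoundary_eq, sumBoundary_eq, Finset.mul_sum]

theorem eq_zero_of_sumBoundary_eq_zero (h : ∀ T p, IsBoundaryEdge 𝒯 T p → 0 ≤ f T p)
    (h0 : sumBoundary 𝒯 f = 0) {T : Finset Plane} {p : Plane} (hb : IsBoundaryEdge 𝒯 T p) :
    f T p = 0 := by
  rw [sumBoundary_eq, Finset.sum_eq_zero_iff_of_nonneg fun e he => h _ _ (mem_boundaryEdges.1 he)]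
    at h0
  exact h0 ⟨T, p⟩ (mem_boundaryEdges.2 hb)

theorem sumBoundary_le_sum {F : Finset Plane → ℝ} (h3 : ∀ T ∈ 𝒯, T.card = 3)
    (hF : ∀ T ∈ 𝒯, 0 ≤ F T) : sumBoundary 𝒯 (fun T _ => F T) ≤ 3 * ∑ T ∈ 𝒯, F T := by
  classical
  rw [sumBoundary, Finset.mul_sum]
  refine Finset.sum_le_sum fun T hT => ?_
  rw [Finset.sum_const, nsmul_eq_mul]
  refine mul_le_mul_of_nonneg_right ?_ (hF T hT)
  exact_mod_cast (Finset.card_filter_le _ _).trans (h3 T hT).le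

end SumBoundary

theorem edgeLength_le {T : Finset Plane} (p : Plane) : edgeLength T p ≤ Metric.diam (cell T) :=
  Metric.diam_mono (edge_subset_cell T p) (isCompact_cell T).isBounded

/-- A barycentric coordinate rises from `0` to `1` along the edge, with slope at most `1 / (2 γ d)`.
-/
theorem le_edgeLength {T : Finset Plane} (hT : IsTriangle T) {γ : ℝ} (hγ : 0 < γ)
    (hf : IsFat γ T) {p : Plane} (hp : p ∈ T) :
    2 * γ * Metric.diam (cell T) ≤ edgeLength T p := by
  obtain ⟨a, b, hab, hap, hbp, h⟩ := hT.exists_eq hp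
  have ha : a ∈ T := by simp [h]
  have hb : b ∈ T := by simp [h]
  rw [edgeLength_eq hap hbp h]
  have h1 := lam_sub_lam T b b a
  rw [lam_self hT hb, lam_of_ne hT hb ha hab, sub_zero] at h1
  have h2 := (gradLam T b).le_opNorm (b - a)
  rw [← h1, norm_one] at h2
  have hd : 0 < 2 * γ * Metric.diam (cell T) := by have := hT.diam_pos; positivity
  have h3 := h2.trans (mul_le_mul_of_nonneg_right (norm_gradLam_le hT hγ hf hb) (norm_nonneg _))
  rw [inv_mul_eq_div, le_div_iff₀ hd] at h3
  linarith

theorem edgeLength_pos {T : Finset Plane} (hT : IsTriangle T) {p : Plane} (hp : p ∈ T) :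
    0 < edgeLength T p := by
  obtain ⟨a, b, hab, hap, hbp, h⟩ := hT.exists_eq hp
  rw [edgeLength_eq hap hbp h]
  exact norm_pos_iff.2 (sub_ne_zero.2 hab.symm)

/-! ### Counting triangles at a vertex -/

theorem volume_closedBall_plane (x : Plane) {r : ℝ} (hr : 0 ≤ r) :
    volume.real (Metric.closedBall x r) = Real.pi * r ^ 2 := by
  rw [Measure.real, EuclideanSpace.volume_closedBall_fin_two, ENNReal.toReal_mul,
    ENNReal.toReal_pow, ENNReal.toReal_ofReal hr]
  simp [mul_comm, Real.pi_pos.le]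

theorem volume_cell_le {T : Finset Plane} (hT : T.Nonempty) :
    volume.real (cell T) ≤ Real.pi * Metric.diam (cell T) ^ 2 := by
  obtain ⟨a, ha⟩ := hT
  rw [← volume_closedBall_plane a Metric.diam_nonneg]
  refine measureReal_mono (fun x hx => ?_) measure_closedBall_lt_top.ne
  rw [mem_closedBall_iff_norm]
  exact dist_le_diam_cell hx (subset_cell T ha)

theorem le_volume_cell {T : Finset Plane} {γ : ℝ} (hγ : 0 < γ) (hf : IsFat γ T) :
    Real.pi * (γ * Metric.diam (cell T)) ^ 2 ≤ volume.real (interior (cell T)) := by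
  obtain ⟨x, hx⟩ := hf
  have hfin : volume (cell T) ≠ ⊤ := (isCompact_cell T).measure_lt_top.ne
  have hfr : volume.real (cell T) ≤ volume.real (interior (cell T)) := by
    have h1 : volume (cell T) ≤ volume (interior (cell T)) + volume (frontier (cell T)) := by
      refine (measure_mono ?_).trans (measure_union_le _ _)
      exact subset_closure.trans (closure_eq_interior_union_frontier _).subset
    rw [cell, (convex_convexHull ℝ _).addHaar_frontier volume, add_zero] at h1
    exact ENNReal.toReal_mono (measure_ne_top_of_subset interior_subset hfin) h1
  rw [← volume_closedBall_plane x (mul_nonneg hγ.le Metric.diam_nonneg)]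
  exact (measureReal_mono hx hfin).trans hfr

theorem gradNormSq_le (v : Plane → Plane) (x : Plane) :
    gradNormSq v x ≤ 4 * ‖fderiv ℝ v x‖ ^ 2 := by
  have h : ∀ i j : Fin 2, (fderiv ℝ v x (EuclideanSpace.single j 1) i) ^ 2 ≤
      ‖fderiv ℝ v x‖ ^ 2 := fun i j => by
    rw [← sq_abs]
    refine pow_le_pow_left₀ (abs_nonneg _) ?_ 2
    rw [← Real.norm_eq_abs]
    refine (PiLp.norm_apply_le _ i).trans (((fderiv ℝ v x).le_opNorm _).trans ?_)
    simp
  simp only [gradNormSq, Fin.sum_univ_two]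
  linarith [h 0 0, h 0 1, h 1 0, h 1 1]

section Mesh

variable {K : Geometry.SimplicialComplex ℝ Plane} {𝒯 : Finset (Finset Plane)}
  (h𝒯 : ∀ T ∈ 𝒯, T ∈ K.faces ∧ T.card = 3)
include h𝒯

theorem disjoint_interior_cell {T T' : Finset Plane} (hT : T ∈ 𝒯) (hT' : T' ∈ 𝒯) (h : T ≠ T') :
    Disjoint (interior (cell T)) (interior (cell T')) := by
  rw [Set.disjoint_left]
  intro x hx hx'
  have tri := isTriangle_of_mem_faces (h𝒯 T hT).1 (h𝒯 T hT).2
  refine h (Finset.eq_of_subset_of_card_le (fun a ha => ?_)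
    (by rw [(h𝒯 T hT).2, (h𝒯 T' hT').2]))
  exact mem_of_lam_ne_zero (h𝒯 T hT).1 (h𝒯 T hT).2 (h𝒯 T' hT').1 ha (interior_subset hx)
    (interior_subset hx') ((mem_interior_cell_iff tri).1 hx a ha).ne'

-- An area count: the triangles at `a` have disjoint interiors inside a ball of radius `R D`, and
-- each contains a ball of radius `γ D / R`.
open Classical in
theorem card_filter_mem_le {γ D R : ℝ} (hγ : 0 < γ) (hD : 0 < D) (hR : 0 < R)
    (hfat : ∀ T ∈ 𝒯, IsFat γ T) (hDlow : ∀ T ∈ 𝒯, D ≤ R * Metric.diam (cell T))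
    (hDup : ∀ T ∈ 𝒯, Metric.diam (cell T) ≤ R * D) (a : Plane) :
    ((𝒯.filter fun T => a ∈ T).card : ℝ) ≤ R ^ 4 / γ ^ 2 := by
  set 𝒜 := 𝒯.filter fun T => a ∈ T
  have hsub : ⋃ T ∈ 𝒜, interior (cell T) ⊆ Metric.closedBall a (R * D) := by
    refine iUnion₂_subset fun T hT x hx => ?_
    obtain ⟨hT, ha⟩ := Finset.mem_filter.1 hT
    rw [mem_closedBall_iff_norm]
    exact (dist_le_diam_cell (interior_subset hx) (subset_cell T ha)).trans (hDup T hT)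
  have hsum : ∑ T ∈ 𝒜, volume.real (interior (cell T)) ≤ Real.pi * (R * D) ^ 2 := by
    rw [← volume_closedBall_plane a (by positivity), ← measureReal_biUnion_finset
      (fun T hT T' hT' hne => disjoint_interior_cell h𝒯 (Finset.mem_filter.1 hT).1
        (Finset.mem_filter.1 hT').1 hne) (fun T _ => isOpen_interior.measurableSet)
      (fun T _ => measure_ne_top_of_subset interior_subset (isCompact_cell T).measure_lt_top.ne)]
    exact measureReal_mono hsub measure_closedBall_lt_top.ne
  have hlow : (𝒜.card : ℝ) * (Real.pi * (γ * (D / R)) ^ 2) ≤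
      ∑ T ∈ 𝒜, volume.real (interior (cell T)) := by
    rw [← nsmul_eq_mul]
    refine Finset.card_nsmul_le_sum _ _ _ fun T hT => ?_
    have hT := (Finset.mem_filter.1 hT).1
    refine le_trans ?_ (le_volume_cell hγ (hfat T hT))
    have : D / R ≤ Metric.diam (cell T) := by
      rw [div_le_iff₀ hR, mul_comm]; exact hDlow T hT
    gcongr
  have h := hlow.trans hsum
  rw [le_div_iff₀ (by positivity)]
  have e : (𝒜.card : ℝ) * (Real.pi * (γ * (D / R)) ^ 2) =
      (𝒜.card * γ ^ 2) * (Real.pi * D ^ 2 / R ^ 2) := by ring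
  have e' : Real.pi * (R * D) ^ 2 = R ^ 4 * (Real.pi * D ^ 2 / R ^ 2) := by field_simp
  rw [e, e'] at h
  exact le_of_mul_le_mul_right h (by positivity)

end Mesh


-- A vertex with nonzero vector lies on some boundary edge, so its nodal value is one of that
-- edge's. Conversely each endpoint of a boundary edge is counted by at most `N` triangles. Midpoint
-- values are counted once, which gives the summand `1`.
open Classical in
theorem sum_nodeSumSq_le {𝒯 : Finset (Finset Plane)} {w : Plane → Finset Plane → Plane}
    {μ : Plane → ℝ} {W N : ℝ} (hN : 0 ≤ N)
    (hcount : ∀ a, ((𝒯.filter fun T => a ∈ T).card : ℝ) ≤ N)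
    (hw₃ : ∀ T ∈ 𝒯, ∀ a ∈ T, ‖w a T‖ ≤ W)
    (hw₄ : ∀ T ∈ 𝒯, ∀ a ∈ T, w a T ≠ 0 → ∃ T' p, IsBoundaryEdge 𝒯 T' p ∧ a ∈ T' ∧ a ≠ p) :
    ∑ T ∈ 𝒯, nodeSumSq 𝒯 w μ T ≤ (W ^ 2 * N + 1) * sumBoundary 𝒯 (nodeSq μ) := by
  have hvertex : ∀ T ∈ 𝒯, ∀ a ∈ T, μ a ^ 2 * ‖w a T‖ ^ 2 ≤
      W ^ 2 * ∑ e ∈ boundaryEdges 𝒯, if a ∈ e.1.erase e.2 then μ a ^ 2 else 0 := by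
    intro T hT a ha
    have hnn : ∀ e ∈ boundaryEdges 𝒯, 0 ≤ if a ∈ e.1.erase e.2 then μ a ^ 2 else 0 :=
      fun e _ => by split_ifs <;> positivity
    by_cases h0 : w a T = 0
    · rw [h0]
      simpa using mul_nonneg (sq_nonneg W) (Finset.sum_nonneg hnn)
    · obtain ⟨T', p, hb, ha', hap⟩ := hw₄ T hT a ha h0
      have h1 := Finset.single_le_sum hnn (mem_boundaryEdges.2 hb : (⟨T', p⟩ : Σ _, _) ∈ _)
      simp only [Finset.mem_erase, ha', ne_eq, hap, not_false_eq_true, and_self, if_true] at h1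
      have h2 : ‖w a T‖ ^ 2 ≤ W ^ 2 := pow_le_pow_left₀ (norm_nonneg _) (hw₃ T hT a ha) 2
      rw [mul_comm]
      simp only [Finset.mem_erase, ne_eq] at h1 ⊢
      exact mul_le_mul h2 h1 (sq_nonneg _) (sq_nonneg _)
  have hswap : ∀ e ∈ boundaryEdges 𝒯,
      ∑ T ∈ 𝒯, ∑ a ∈ T, (if a ∈ e.1.erase e.2 then μ a ^ 2 else 0) ≤
        N * ∑ a ∈ e.1.erase e.2, μ a ^ 2 := by
    intro e _
    have h1 : ∀ T ∈ 𝒯, ∑ a ∈ T, (if a ∈ e.1.erase e.2 then μ a ^ 2 else 0) =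
        ∑ a ∈ e.1.erase e.2, if a ∈ T then μ a ^ 2 else 0 := fun T _ => by
      rw [← Finset.sum_filter, ← Finset.sum_filter]
      refine Finset.sum_congr ?_ fun _ _ => rfl
      ext a; simp only [Finset.mem_filter]; exact and_comm
    rw [Finset.sum_congr rfl h1, Finset.sum_comm, Finset.mul_sum]
    refine Finset.sum_le_sum fun a _ => ?_
    rw [← Finset.sum_filter, Finset.sum_const, nsmul_eq_mul]
    exact mul_le_mul_of_nonneg_right (hcount a) (sq_nonneg _)
  unfold nodeSumSq
  rw [Finset.sum_add_distrib, sumBoundary_eq, add_mul, one_mul]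
  refine add_le_add ?_ ?_
  · calc ∑ T ∈ 𝒯, ∑ a ∈ T, μ a ^ 2 * ‖w a T‖ ^ 2
        ≤ ∑ T ∈ 𝒯, ∑ a ∈ T, W ^ 2 * ∑ e ∈ boundaryEdges 𝒯,
            (if a ∈ e.1.erase e.2 then μ a ^ 2 else 0) :=
          Finset.sum_le_sum fun T hT => Finset.sum_le_sum fun a ha => hvertex T hT a ha
      _ = W ^ 2 * ∑ e ∈ boundaryEdges 𝒯, ∑ T ∈ 𝒯, ∑ a ∈ T,
            (if a ∈ e.1.erase e.2 then μ a ^ 2 else 0) := by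
          simp only [← Finset.mul_sum]
          congr 1
          rw [Finset.sum_comm (s := boundaryEdges 𝒯) (t := 𝒯)]
          refine Finset.sum_congr rfl fun T _ => ?_
          exact Finset.sum_comm
      _ ≤ W ^ 2 * ∑ e ∈ boundaryEdges 𝒯, N * ∑ a ∈ e.1.erase e.2, μ a ^ 2 := by
          gcongr with e he
          exact hswap e he
      _ ≤ W ^ 2 * N * ∑ e ∈ boundaryEdges 𝒯, nodeSq μ e.1 e.2 := by
          rw [← Finset.mul_sum, mul_assoc]
          gcongr with e he
          exact le_add_of_nonneg_right (sq_nonneg _)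
  · have := sumBoundary_le (𝒯 := 𝒯) (f := fun T p => μ (mid T p) ^ 2) (g := nodeSq μ)
      fun T p _ => le_add_of_nonneg_left (Finset.sum_nonneg fun _ _ => sq_nonneg _)
    rw [sumBoundary_eq 𝒯 (nodeSq μ)] at this
    exact this

/-! ### The norm of the test field -/

theorem edgeIntegral_mono {T : Finset Plane} (hT : IsTriangle T) {p : Plane} (hp : p ∈ T)
    {f g : Plane → ℝ} (hf : Continuous f) (hg : Continuous g) (h : ∀ x, f x ≤ g x) :
    edgeIntegral T p f ≤ edgeIntegral T p g := by
  obtain ⟨a, b, hab, hap, hbp, hT'⟩ := hT.exists_eq hp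
  rw [edgeIntegral_eq hab hap hbp hT', edgeIntegral_eq hab hap hbp hT']
  refine mul_le_mul_of_nonneg_left ?_ (norm_nonneg _)
  exact intervalIntegral.integral_mono_on zero_le_one
    (Continuous.intervalIntegrable (by fun_prop) _ _)
    (Continuous.intervalIntegrable (by fun_prop) _ _) fun t _ => h _

section Norm

variable {K : Geometry.SimplicialComplex ℝ Plane} {𝒯 : Finset (Finset Plane)}
  (h𝒯 : ∀ T ∈ 𝒯, T ∈ K.faces ∧ T.card = 3) {w : Plane → Finset Plane → Plane} {μ : Plane → ℝ}
  {v : Plane → Plane}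
  (hv : ∀ T ∈ 𝒯, ∀ x ∈ cell T, x ∈ domain 𝒯 → v x = testField 𝒯 w μ T x)
include h𝒯 hv

/-- The area, at most `π d²`, cancels the factor `d⁻²` of the squared gradient, so the bound is
scale invariant. The constant is `4 · (8 / 2)² · 6`. -/
theorem integral_gradNormSq_le {γ : ℝ} (hγ : 0 < γ) (hfat : ∀ T ∈ 𝒯, IsFat γ T) :
    ∫ x in domain 𝒯, gradNormSq v x ≤
      384 * Real.pi / γ ^ 2 * ∑ T ∈ 𝒯, nodeSumSq 𝒯 w μ T := by
  have htri : ∀ T ∈ 𝒯, IsTriangle T := fun T hT =>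
    isTriangle_of_mem_faces (h𝒯 T hT).1 (h𝒯 T hT).2
  set c : Finset Plane → ℝ := fun T =>
    4 * (8 * (2 * γ * Metric.diam (cell T))⁻¹ * nodeSum 𝒯 w μ T) ^ 2 with hc
  have hc0 : ∀ T, 0 ≤ c T := fun T => by positivity
  have hint : ∀ T ∈ 𝒯, Integrable ((cell T).indicator fun _ => c T)
      ((volume : Measure Plane).restrict (domain 𝒯)) := fun T _ =>
    (integrable_const (c T)).indicator (isClosed_cell T).measurableSet
  calc ∫ x in domain 𝒯, gradNormSq v x
      ≤ ∫ x in domain 𝒯, ∑ T ∈ 𝒯, (cell T).indicator (fun _ => c T) x := by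
        refine integral_mono_of_nonneg (Eventually.of_forall fun x => ?_)
          (integrable_finsetSum 𝒯 hint) ?_
        · exact Finset.sum_nonneg fun i _ => Finset.sum_nonneg fun j _ => sq_nonneg _
        · filter_upwards [ae_mem_interior_cell 𝒯] with x ⟨T, hT, hx⟩
          refine le_trans ?_ (Finset.single_le_sum
            (f := fun T => (cell T).indicator (fun _ => c T) x)
            (fun T _ => indicator_nonneg (fun _ _ => hc0 T) x) hT)
          rw [indicator_of_mem (interior_subset hx)]
          refine (gradNormSq_le v x).trans ?_
          rw [(eventuallyEq_of_mem_interior_cell hv hT hx).fderiv_eq]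
          have := norm_fderiv_testField_le (𝒯 := 𝒯) (w := w) (μ := μ) (htri T hT) hγ (hfat T hT)
            (interior_subset hx)
          simp only [hc]
          gcongr
    _ = ∑ T ∈ 𝒯, ∫ x in domain 𝒯, (cell T).indicator (fun _ => c T) x := integral_finsetSum 𝒯 hint
    _ ≤ ∑ T ∈ 𝒯, 384 * Real.pi / γ ^ 2 * nodeSumSq 𝒯 w μ T := by
        refine Finset.sum_le_sum fun T hT => ?_
        rw [integral_indicator_const _ (isClosed_cell T).measurableSet, smul_eq_mul]
        have hd := (htri T hT).diam_pos
        have hne : T.Nonempty := Finset.card_pos.1 (by rw [(htri T hT).2]; norm_num)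
        have hvol : (volume.restrict (domain 𝒯)).real (cell T) ≤
            Real.pi * Metric.diam (cell T) ^ 2 :=
          (ENNReal.toReal_mono (isCompact_cell T).measure_lt_top.ne
            (Measure.restrict_apply_le _ _)).trans (volume_cell_le hne)
        calc _ ≤ Real.pi * Metric.diam (cell T) ^ 2 * c T :=
              mul_le_mul_of_nonneg_right hvol (hc0 T)
          _ = 64 * Real.pi / γ ^ 2 * nodeSum 𝒯 w μ T ^ 2 := by
              simp only [hc]; field_simp; ring
          _ ≤ 64 * Real.pi / γ ^ 2 * (6 * nodeSumSq 𝒯 w μ T) := by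
              gcongr; exact nodeSum_sq_le (htri T hT).2
          _ = _ := by ring
    _ = _ := by rw [Finset.mul_sum]

/-- The weight `1 / h_e` cancels the edge length. The constant is `3 · 4² · 6`, with at most three
boundary edges per triangle. -/
theorem sumBoundary_trace_le :
    sumBoundary 𝒯 (fun T p => (edgeLength T p)⁻¹ * edgeIntegral T p fun x => ‖trace v T p x‖ ^ 2) ≤
      288 * ∑ T ∈ 𝒯, nodeSumSq 𝒯 w μ T := by
  have htri : ∀ T ∈ 𝒯, IsTriangle T := fun T hT =>
    isTriangle_of_mem_faces (h𝒯 T hT).1 (h𝒯 T hT).2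
  have h1 : sumBoundary 𝒯 (fun T p => (edgeLength T p)⁻¹ *
      edgeIntegral T p fun x => ‖trace v T p x‖ ^ 2) ≤
      sumBoundary 𝒯 fun T _ => 96 * nodeSumSq 𝒯 w μ T := by
    refine sumBoundary_le fun T p hb => ?_
    have tri := htri T hb.1
    have hpos := edgeLength_pos tri hb.2.1
    rw [inv_mul_le_iff₀ hpos]
    refine edgeIntegral_le tri hb.2.1 fun x hx => ?_
    rw [abs_of_nonneg (sq_nonneg _), trace_eq hv hb.1 tri (contDiff_testField 𝒯 w μ T).continuous
      hb.2.1 hx]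
    have h := norm_testField_le (𝒯 := 𝒯) (w := w) (μ := μ) tri (edge_subset_cell T p hx)
    calc ‖testField 𝒯 w μ T x‖ ^ 2 ≤ (4 * nodeSum 𝒯 w μ T) ^ 2 := by gcongr
      _ = 16 * nodeSum 𝒯 w μ T ^ 2 := by ring
      _ ≤ 16 * (6 * nodeSumSq 𝒯 w μ T) := by gcongr; exact nodeSum_sq_le tri.2
      _ = _ := by ring
  refine h1.trans ((sumBoundary_le_sum (fun T hT => (h𝒯 T hT).2) fun T _ =>
    mul_nonneg (by norm_num) (nodeSumSq_nonneg T)).trans (le_of_eq ?_))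
  rw [← Finset.mul_sum]; ring

end Norm

/-- The constant in the norm bound for the test field. -/
noncomputable def fieldConst (γ R : ℝ) : ℝ :=
  -- The factors are the gradient and trace bounds by nodal values, the passage from triangles to
  -- boundary edges, and the passage from nodal values to edge integrals.
  (384 * Real.pi / γ ^ 2 + 288) * (((1 + γ⁻¹) ^ 2 * (R ^ 4 / γ ^ 2) + 1) * (30 * R / (2 * γ)))

theorem fieldConst_pos {γ R : ℝ} (hγ : 0 < γ) (hR : 0 < R) : 0 < fieldConst γ R := by
  have := Real.pi_pos
  unfold fieldConst; positivity

/-- There is a continuous piecewise quadratic field whose normal component on the boundary is a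
given multiplier and whose norm is controlled by the multiplier. -/
theorem exists_test_field {K : Geometry.SimplicialComplex ℝ Plane} {𝒯 : Finset (Finset Plane)}
    (h𝒯 : ∀ T ∈ 𝒯, T ∈ K.faces ∧ T.card = 3) {γ D R : ℝ} (hγ : 0 < γ) (hD : 0 < D) (hR : 0 < R)
    (hfat : ∀ T ∈ 𝒯, IsFat γ T) (hDlow : ∀ T ∈ 𝒯, D ≤ R * Metric.diam (cell T))
    (hDup : ∀ T ∈ 𝒯, Metric.diam (cell T) ≤ R * D)
    (hvc : ∀ T ∈ 𝒯, ∀ a ∈ T, VertexCondition K γ 𝒯 a) {μ : Plane → ℝ}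
    (hμ : μ ∈ multiplierSpace 𝒯) :
    ∃ v : Plane → Plane, MemH1 (domain 𝒯) v ∧ ContinuousOn v (domain 𝒯) ∧
      (∀ T ∈ 𝒯, ∀ p ∈ T, ∀ i : Fin 2, IsQuadraticOn (interior (ctCell T p)) fun x => v x i) ∧
      (∀ T p, IsBoundaryEdge 𝒯 T p → ∀ x ∈ edge T p,
        inner ℝ (trace v T p x) (outwardNormal T p) = μ x) ∧
      (∀ T p, IsBoundaryEdge 𝒯 T p → edgeIntegral T p (fun x => μ x ^ 2) ≤
        edgeIntegral T p fun x => ‖trace v T p x‖ ^ 2) ∧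
      norm1h 𝒯 v ^ 2 ≤
        fieldConst γ R / D * sumBoundary 𝒯 (fun T p => edgeIntegral T p fun x => μ x ^ 2) := by
  classical
  have htri : ∀ T ∈ 𝒯, IsTriangle T := fun T hT =>
    isTriangle_of_mem_faces (h𝒯 T hT).1 (h𝒯 T hT).2
  obtain ⟨w, hw₁, hw₂, hw₃, hw₄⟩ := exists_vertex_vectors h𝒯 hγ hfat hvc
  -- The choice of triangle is immaterial in the domain, where all pieces agree.
  let v : Plane → Plane := fun x =>
    if h : ∃ T ∈ 𝒯, x ∈ cell T then testField 𝒯 w μ h.choose x else 0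
  have hv : ∀ T ∈ 𝒯, ∀ x ∈ cell T, x ∈ domain 𝒯 → v x = testField 𝒯 w μ T x := by
    intro T hT x hx hU
    have h : ∃ T ∈ 𝒯, x ∈ cell T := ⟨T, hT, hx⟩
    simp only [v, dif_pos h]
    exact testField_eq h𝒯 hw₁ hw₄ h.choose_spec.1 hT h.choose_spec.2 hx hU
  have hQ : ∀ T ∈ 𝒯, ContDiff ℝ ∞ (testField 𝒯 w μ T) := fun T _ => contDiff_testField 𝒯 w μ T
  refine ⟨v, memH1_of_piecewise hQ hv,
    fun x hx => (continuousAt_of_piecewise hQ hv hx).continuousWithinAt, ?_, ?_, ?_, ?_⟩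
  · intro T hT p _ i
    obtain ⟨P, hP, e⟩ := isPolyFun_testField (𝒯 := 𝒯) (w := w) (μ := μ) (htri T hT).2 i
    refine ⟨P, hP, fun x hx => ?_⟩
    have hx' := interior_mono (ctCell_subset_cell (htri T hT).2 p) hx
    simp only [← e x, hv T hT x (interior_subset hx') (interior_cell_subset_domain hT hx')]
  · intro T p hb x hx
    rw [trace_eq hv hb.1 (htri T hb.1) (hQ T hb.1).continuous hb.2.1 hx]
    exact inner_testField (htri T hb.1) hb (fun a ha hap => hw₂ T p a hb ha hap) (hμ.2 T p hb) hx
  · intro T p hb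
    have hc := (hQ T hb.1).continuous
    rw [edgeIntegral_congr (f := fun x => μ x ^ 2)
      (g := fun x => inner ℝ (testField 𝒯 w μ T x) (outwardNormal T p) ^ 2) fun x hx => by
        rw [inner_testField (htri T hb.1) hb (fun a ha hap => hw₂ T p a hb ha hap)
          (hμ.2 T p hb) hx],
      edgeIntegral_congr (f := fun x => ‖trace v T p x‖ ^ 2)
        (g := fun x => ‖testField 𝒯 w μ T x‖ ^ 2) fun x hx => by
          rw [trace_eq hv hb.1 (htri T hb.1) hc hb.2.1 hx]]
    refine edgeIntegral_mono (htri T hb.1) hb.2.1 (by fun_prop) (by fun_prop) fun x => ?_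
    rw [← sq_abs]
    refine pow_le_pow_left₀ (abs_nonneg _) ((abs_real_inner_le_norm _ _).trans ?_) 2
    rw [((htri T hb.1).outwardNormal_spec hb.2.1).1, mul_one]
  · have hE : 0 ≤ ∑ T ∈ 𝒯, nodeSumSq 𝒯 w μ T := Finset.sum_nonneg fun T _ => nodeSumSq_nonneg T
    have hgrad := integral_gradNormSq_le h𝒯 hv hγ hfat
    have hbdry := sumBoundary_trace_le h𝒯 hv
    have hnode := sum_nodeSumSq_le (μ := μ) (by positivity)
      (card_filter_mem_le h𝒯 hγ hD hR hfat hDlow hDup) hw₃ hw₄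
    have hsq : sumBoundary 𝒯 (nodeSq μ) ≤ 30 * R / (2 * γ) / D *
        sumBoundary 𝒯 (fun T p => edgeIntegral T p fun x => μ x ^ 2) := by
      rw [← sumBoundary_const_mul]
      refine sumBoundary_le fun T p hb => ?_
      have h1 := nodeSq_le_edgeIntegral (htri T hb.1) hb.2.1 (hμ.2 T p hb)
      have h2 : 2 * γ / R * D ≤ edgeLength T p := by
        refine le_trans ?_ (le_edgeLength (htri T hb.1) hγ (hfat T hb.1) hb.2.1)
        have := hDlow T hb.1
        rw [div_mul_eq_mul_div, div_le_iff₀ hR]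
        nlinarith
      have h3 : 0 ≤ nodeSq μ T p := by unfold nodeSq; positivity
      have h4 : 2 * γ / R * D * nodeSq μ T p ≤ 30 * edgeIntegral T p fun x => μ x ^ 2 :=
        (mul_le_mul_of_nonneg_right h2 h3).trans h1
      have e : nodeSq μ T p = R / (2 * γ) / D * (2 * γ / R * D * nodeSq μ T p) := by field_simp
      rw [e]
      calc _ ≤ R / (2 * γ) / D * (30 * edgeIntegral T p fun x => μ x ^ 2) := by gcongr
        _ = _ := by ring
    rw [norm1h, Real.sq_sqrt]
    · calc _ ≤ (384 * Real.pi / γ ^ 2 + 288) * ∑ T ∈ 𝒯, nodeSumSq 𝒯 w μ T := by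
            rw [add_mul]; exact add_le_add hgrad hbdry
        _ ≤ (384 * Real.pi / γ ^ 2 + 288) * (((1 + γ⁻¹) ^ 2 * (R ^ 4 / γ ^ 2) + 1) *
            (30 * R / (2 * γ) / D *
              sumBoundary 𝒯 (fun T p => edgeIntegral T p fun x => μ x ^ 2))) := by
            have := Real.pi_pos
            gcongr
            exact hnode.trans (by gcongr)
        _ = _ := by rw [fieldConst]; ring
    · refine add_nonneg (integral_nonneg fun x =>
        Finset.sum_nonneg fun i _ => Finset.sum_nonneg fun j _ => sq_nonneg _)
        (sumBoundary_nonneg fun T p _ => mul_nonneg (inv_nonneg.2 Metric.diam_nonneg)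
          (edgeIntegral_nonneg fun x => sq_nonneg _))

/-! ### Constant fields -/

theorem IsTriangle.nonempty_interior {T : Finset Plane} (hT : IsTriangle T) :
    (interior (cell T)).Nonempty :=
  interior_convexHull_nonempty_iff_affineSpan_eq_top.2 hT.affineSpan_eq_top

theorem trace_eq_zero {𝒯 : Finset (Finset Plane)} {v : Plane → Plane}
    (hv : ContinuousOn v (domain 𝒯)) (h0 : v =ᵐ[volume.restrict (domain 𝒯)] 0)
    {T : Finset Plane} (hT𝒯 : T ∈ 𝒯) (hT : IsTriangle T) {p : Plane} (hp : p ∈ T) {x : Plane}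
    (hx : x ∈ edge T p) : trace v T p x = 0 := by
  have h := Measure.eqOn_open_of_ae_eq h0 (isOpen_domain 𝒯) hv continuousOn_const
  refine extendFrom_eq (edge_subset_closure_interior_ctCell hT hp hx) ?_
  refine tendsto_const_nhds.congr' ?_
  filter_upwards [self_mem_nhdsWithin] with y hy
  exact (h (interior_cell_subset_domain hT𝒯 (interior_mono (ctCell_subset_cell hT.2 p) hy))).symm

/-- The velocity space contains a nonzero constant field. -/
theorem exists_const_mem_velocitySpace {𝒯 : Finset (Finset Plane)} (hne : 𝒯.Nonempty)
    (htri : ∀ T ∈ 𝒯, IsTriangle T) : ∃ v, v ∈ velocitySpaceNonzero 𝒯 := by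
  set n : Plane := ∑ e ∈ boundaryEdges 𝒯, edgeLength e.1 e.2 • outwardNormal e.1 e.2
  -- Flux of a constant field is its inner product with `n`, so a nonzero vector orthogonal to `n`
  -- suffices; the vanishing of `n` for a closed boundary need not be proved.
  obtain ⟨c, hc0, hcn⟩ : ∃ c : Plane, c ≠ 0 ∧ inner ℝ c n = 0 := by
    by_cases hn : n = 0
    · exact ⟨EuclideanSpace.single 0 1, by simp, by rw [hn, inner_zero_right]⟩
    · refine ⟨rot n, fun h => hn ?_, by rw [inner_rot, cr_self]⟩
      rw [← norm_eq_zero, ← norm_rot, h, norm_zero]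
  have hv : ∀ T ∈ 𝒯, ∀ x ∈ cell T, x ∈ domain 𝒯 →
      (fun _ : Plane => c) x = (fun (_ : Finset Plane) (_ : Plane) => c) T x := fun _ _ _ _ _ => rfl
  refine ⟨fun _ => c, ⟨memH1_of_piecewise (fun _ _ => contDiff_const) hv, fun T _ p _ i =>
    ⟨MvPolynomial.C (c i), by simp, by simp⟩, ?_⟩, fun h => ?_⟩
  · have : boundaryPairing 𝒯 (fun _ => c) (fun _ => 1) =
        sumBoundary 𝒯 fun T p => inner ℝ c (edgeLength T p • outwardNormal T p) := by
      refine sumBoundary_congr fun T p hb => ?_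
      have e : edgeIntegral T p (fun x => inner ℝ (trace (fun _ => c) T p x)
          (outwardNormal T p) * 1) = edgeIntegral T p fun _ => inner ℝ c (outwardNormal T p) :=
        edgeIntegral_congr fun x hx => by
          rw [trace_eq hv hb.1 (htri T hb.1) continuous_const hb.2.1 hx, mul_one]
      obtain ⟨a, b, hab, hap, hbp, h⟩ := (htri T hb.1).exists_eq hb.2.1
      rw [e, edgeIntegral_eq hab hap hbp h, edgeLength_eq hap hbp h, inner_smul_right]
      simp
    rw [this, sumBoundary_eq, ← inner_sum]
    exact hcn
  · have h' := Measure.eqOn_open_of_ae_eq h (isOpen_domain 𝒯) continuousOn_const continuousOn_const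
    obtain ⟨T, hT⟩ := hne
    obtain ⟨x, hx⟩ := (htri T hT).nonempty_interior
    exact hc0 (h' (interior_cell_subset_domain hT hx))

theorem eq_zero_on_edge {T : Finset Plane} (hT : IsTriangle T) {p : Plane} (hp : p ∈ T)
    {μ : Plane → ℝ} (hμ : IsQuadraticOn (edge T p) μ)
    (h0 : edgeIntegral T p (fun x => μ x ^ 2) = 0) {x : Plane} (hx : x ∈ edge T p) : μ x = 0 := by
  classical
  have h1 := nodeSq_le_edgeIntegral hT hp hμ
  rw [h0, mul_zero] at h1
  have h2 : nodeSq μ T p ≤ 0 := by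
    by_contra! hcon
    exact absurd h1 (not_le.2 (mul_pos (edgeLength_pos hT hp) hcon))
  obtain ⟨a, b, hab, hap, hbp, h⟩ := hT.exists_eq hp
  rw [nodeSq, erase_eq_pair hap hbp h, Finset.sum_pair hab] at h2
  obtain ⟨t, ht, rfl⟩ := (mem_edge_iff hap hbp h).1 hx
  have ha : μ a = 0 := by nlinarith [sq_nonneg (μ a), sq_nonneg (μ b), sq_nonneg (μ (mid T p))]
  have hb : μ b = 0 := by nlinarith [sq_nonneg (μ a), sq_nonneg (μ b), sq_nonneg (μ (mid T p))]
  have hm : μ (mid T p) = 0 := by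
    nlinarith [sq_nonneg (μ a), sq_nonneg (μ b), sq_nonneg (μ (mid T p))]
  rw [hμ.eq_interpolation hab hap hbp h ht, ha, hb, hm]
  ring

/-- The inf-sup estimate on a single mesh. -/
theorem exists_velocity_le {K : Geometry.SimplicialComplex ℝ Plane} {𝒯 : Finset (Finset Plane)}
    (h𝒯 : ∀ T ∈ 𝒯, T ∈ K.faces ∧ T.card = 3) (hne : 𝒯.Nonempty) {γ D R : ℝ} (hγ : 0 < γ)
    (hD : 0 < D) (hR : 0 < R) (hfat : ∀ T ∈ 𝒯, IsFat γ T)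
    (hDlow : ∀ T ∈ 𝒯, D ≤ R * Metric.diam (cell T))
    (hDup : ∀ T ∈ 𝒯, Metric.diam (cell T) ≤ R * D)
    (hvc : ∀ T ∈ 𝒯, ∀ a ∈ T, VertexCondition K γ 𝒯 a) {μ : Plane → ℝ}
    (hμ : μ ∈ multiplierSpace₀ 𝒯) :
    ∃ v ∈ velocitySpaceNonzero 𝒯, (Real.sqrt (fieldConst γ R * R))⁻¹ * normNegHalf 𝒯 μ ≤
      boundaryPairing 𝒯 v μ / norm1h 𝒯 v := by
  have htri : ∀ T ∈ 𝒯, IsTriangle T := fun T hT =>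
    isTriangle_of_mem_faces (h𝒯 T hT).1 (h𝒯 T hT).2
  set P := sumBoundary 𝒯 (fun T p => edgeIntegral T p fun x => μ x ^ 2) with hP
  have hPnn : ∀ T p, IsBoundaryEdge 𝒯 T p → 0 ≤ edgeIntegral T p fun x => μ x ^ 2 :=
    fun T p _ => edgeIntegral_nonneg fun x => sq_nonneg _
  have hP0 : 0 ≤ P := sumBoundary_nonneg hPnn
  have hC := fieldConst_pos hγ hR
  have hneg : normNegHalf 𝒯 μ ≤ Real.sqrt (R * D * P) := by
    refine Real.sqrt_le_sqrt ?_
    rw [hP, ← sumBoundary_const_mul]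
    exact sumBoundary_le fun T p hb => mul_le_mul_of_nonneg_right
      ((edgeLength_le p).trans (hDup T hb.1)) (hPnn T p hb)
  -- If `P = 0`, both sides vanish, but a nonzero velocity must still be exhibited: in the extended
  -- reals the supremum over an empty set is `-∞`.
  rcases hP0.eq_or_lt with h0 | hpos
  · obtain ⟨v, hv⟩ := exists_const_mem_velocitySpace hne htri
    refine ⟨v, hv, ?_⟩
    have h1 : normNegHalf 𝒯 μ = 0 := by
      refine le_antisymm (hneg.trans ?_) (Real.sqrt_nonneg _)
      rw [← h0, mul_zero, Real.sqrt_zero]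
    have h2 : boundaryPairing 𝒯 v μ = 0 := by
      have : boundaryPairing 𝒯 v μ = sumBoundary 𝒯 fun _ _ => 0 := by
        refine sumBoundary_congr fun T p hb => ?_
        have e := edgeIntegral_congr (T := T) (p := p)
          (f := fun x => inner ℝ (trace v T p x) (outwardNormal T p) * μ x) (g := fun _ => 0)
          fun x hx => by
            rw [eq_zero_on_edge (htri T hb.1) hb.2.1 (hμ.1.2 T p hb)
              (eq_zero_of_sumBoundary_eq_zero hPnn h0.symm hb) hx, mul_zero]
        rw [e]
        simp [edgeIntegral]
      rw [this, sumBoundary_eq, Finset.sum_const_zero]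
    rw [h1, h2, mul_zero, zero_div]
  · obtain ⟨v, hvH, hvcont, hvq, hvn, hvt, hvb⟩ :=
      exists_test_field h𝒯 hγ hD hR hfat hDlow hDup hvc hμ.1
    have hpair : boundaryPairing 𝒯 v μ = P := by
      refine sumBoundary_congr fun T p hb => edgeIntegral_congr fun x hx => ?_
      rw [hvn T p hb x hx, sq]
    have hflux : boundaryPairing 𝒯 v (fun _ => 1) = 0 := by
      refine Eq.trans ?_ hμ.2
      refine sumBoundary_congr fun T p hb => edgeIntegral_congr fun x hx => ?_
      rw [hvn T p hb x hx, mul_one]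
    have hv0 : ¬v =ᵐ[volume.restrict (domain 𝒯)] 0 := by
      intro h
      have : P = sumBoundary 𝒯 fun _ _ => 0 := by
        refine sumBoundary_congr fun T p hb => ?_
        have e := edgeIntegral_congr (T := T) (p := p) (f := fun x => μ x ^ 2) (g := fun _ => 0)
          fun x hx => by
            rw [← hvn T p hb x hx, trace_eq_zero hvcont h hb.1 (htri T hb.1) hb.2.1 hx,
              inner_zero_left]
            simp
        rw [e]
        simp [edgeIntegral]
      rw [this, sumBoundary_eq, Finset.sum_const_zero] at hpos
      exact hpos.false
    refine ⟨v, ⟨⟨hvH, hvq, hflux⟩, hv0⟩, ?_⟩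
    -- The boundary part of the norm alone is positive, since `μ` is a normal component of the
    -- trace.
    have hnorm : 0 < norm1h 𝒯 v := by
      refine Real.sqrt_pos.2 (add_pos_of_nonneg_of_pos (integral_nonneg fun x =>
        Finset.sum_nonneg fun i _ => Finset.sum_nonneg fun j _ => sq_nonneg _) ?_)
      have h1 : (R * D)⁻¹ * P ≤ sumBoundary 𝒯 fun T p =>
          (edgeLength T p)⁻¹ * edgeIntegral T p fun x => ‖trace v T p x‖ ^ 2 := by
        rw [hP, ← sumBoundary_const_mul]
        refine sumBoundary_le fun T p hb => ?_
        have := edgeLength_pos (htri T hb.1) hb.2.1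
        exact mul_le_mul (inv_anti₀ this ((edgeLength_le p).trans (hDup T hb.1))) (hvt T p hb)
          (hPnn T p hb) (inv_nonneg.2 this.le)
      exact lt_of_lt_of_le (by positivity) h1
    have hle : norm1h 𝒯 v ≤ Real.sqrt (fieldConst γ R / D * P) := Real.le_sqrt_of_sq_le hvb
    rw [hpair, le_div_iff₀ hnorm]
    calc (Real.sqrt (fieldConst γ R * R))⁻¹ * normNegHalf 𝒯 μ * norm1h 𝒯 v
        ≤ (Real.sqrt (fieldConst γ R * R))⁻¹ * Real.sqrt (R * D * P) *
            Real.sqrt (fieldConst γ R / D * P) := by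
          have : 0 ≤ norm1h 𝒯 v := hnorm.le
          gcongr
      _ = P := by
          rw [mul_assoc, ← Real.sqrt_mul (by positivity)]
          have e : R * D * P * (fieldConst γ R / D * P) = fieldConst γ R * R * P ^ 2 := by
            field_simp
          rw [e, Real.sqrt_mul (mul_pos hC hR).le (P ^ 2), Real.sqrt_sq hP0, inv_mul_cancel_left₀]
          exact (Real.sqrt_pos.2 (by positivity)).ne'

end StokesFEM

/-! ### The uniform inf-sup estimate. -/

theorem lemma4p7 (Ω S : Set StokesFEM.Plane)
    (hΩ_open : IsOpen Ω) (hΩ_conn : IsConnected Ω) (hΩ_bdd : Bornology.IsBounded Ω)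
    (hΩ_smooth : StokesFEM.HasSmoothBoundary Ω) (hΩS : Ω ⊆ S)
    (γ ρ : ℝ) (hγ : 0 < γ) :
    ∃ β₂ : ℝ, 0 < β₂ ∧
      ∀ 𝒮 : StokesFEM.Triangulation S, 𝒮.ShapeRegular γ → 𝒮.QuasiUniform ρ →
        (𝒮.compMesh Ω).Nonempty →
        ∀ μ ∈ StokesFEM.multiplierSpace₀ (𝒮.compMesh Ω),
          ((β₂ * StokesFEM.normNegHalf (𝒮.compMesh Ω) μ : ℝ) : EReal) ≤
            ⨆ v ∈ StokesFEM.velocitySpaceNonzero (𝒮.compMesh Ω),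
              ((StokesFEM.boundaryPairing (𝒮.compMesh Ω) v μ /
                StokesFEM.norm1h (𝒮.compMesh Ω) v : ℝ) : EReal) := by
  have hR : 0 < max ρ 1 := lt_max_of_lt_right one_pos
  refine ⟨(Real.sqrt (StokesFEM.fieldConst γ (max ρ 1) * max ρ 1))⁻¹,
    inv_pos.2 (Real.sqrt_pos.2 (mul_pos (StokesFEM.fieldConst_pos hγ hR) hR)), ?_⟩
  intro 𝒮 hshape hquasi hne μ hμ
  have hmem : ∀ T ∈ 𝒮.compMesh Ω, T ∈ 𝒮.faces ∧ T.card = 3 := fun T hT =>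
    (StokesFEM.Triangulation.mem_compMesh.1 hT).1
  have htris : ∀ T ∈ 𝒮.compMesh Ω, T ∈ 𝒮.triangles := fun T hT =>
    StokesFEM.Triangulation.mem_triangles.2 (hmem T hT)
  obtain ⟨T₀, hT₀⟩ := id hne
  have hq : ∀ T ∈ 𝒮.triangles, ∀ T' ∈ 𝒮.triangles, Metric.diam (StokesFEM.cell T) ≤
      max ρ 1 * Metric.diam (StokesFEM.cell T') := fun T hT T' hT' =>
    (hquasi T hT T' hT').trans
      (mul_le_mul_of_nonneg_right (le_max_left _ _) Metric.diam_nonneg)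
  -- The reference length `D` is the diameter of an arbitrary mesh triangle `T₀`. The constant
  -- depends only on `γ` and `max ρ 1`, where the maximum secures positivity.
  obtain ⟨v, hv, hle⟩ := StokesFEM.exists_velocity_le (K := 𝒮.toSimplicialComplex) hmem hne hγ
    (StokesFEM.isTriangle_of_mem_faces (hmem T₀ hT₀).1 (hmem T₀ hT₀).2).diam_pos hR
    (fun T hT => hshape T (htris T hT)) (fun T hT => hq T₀ (htris T₀ hT₀) T (htris T hT))
    (fun T hT => hq T (htris T hT) T₀ (htris T₀ hT₀))
    (fun T hT a ha => StokesFEM.vertexCondition_compMesh hΩ_open hΩ_smooth hΩS hshape hT ha) hμ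
  exact (EReal.coe_le_coe_iff.2 hle).trans (le_iSup₂_of_le v hv le_rfl)
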